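/- Let $n\ge 2$, $m=2n-2$, and let $G=\mathrm{Spin}(2n-1,1)$ with Lie algebra $\mathfrak g=\mathfrak{so}(2n-1,1)=\{X\in M_{2n}(\mathbb R): XI+IX^{t}=0\}$, $I=\mathrm{diag}(1,\dots,1,-1)$. Let $P=MAN$ be the minimal parabolic subgroup lying over $M_1AN\subset \mathrm{SO}_e(2n-1,1)$, where $M_1=\{\mathrm{diag}(W,1,1):W\in\mathrm{SO}(m)\}$, $A=\exp(\mathbb R H_0)$, $N=\exp(\mathfrak n)$, $H_0=\mathrm{diag}\bigl(0_m,\begin{pmatrix}0&1\\1&0\end{pmatrix}\bigr)$ and $$\mathfrak n=\Bigl\{\begin{pmatrix}0&-\alpha^{t}&\alpha^{t}\\ \alpha&0&0\\ \alpha&0&0\end{pmatrix}:\alpha\in\mathbb R^{m}\Bigr\}.$$ Let $\mathfrak p=\mathfrak m+\mathfrak a+\mathfrak n$ be the Lie algebra of $P$, and $\mathfrak l=\mathfrak m+\mathfrak a$; regard $\mathfrak l^{*}$ as the set of elements of $\mathfrak p^{*}$ vanishing on $\mathfrak n$. A coadjoint $P$-orbit in $\mathfrak p^{*}$ has depth zero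 if it is contained in $\mathfrak l^{*}$, and depth one otherwise. Let $(X,Y)=\frac12\mathrm{tr}(XY)$ on $\mathfrak g$, $\iota(X)=(X,\cdot)\in\mathfrak g^*$, $\mathrm{pr}(X)=\iota(X)|_{\mathfrak p}$. A depth one orbit contains some $\mathrm{pr}\begin{pmatrix}Y&\beta^{t}&\beta^{t}\\-\beta&0&0\\ \beta&0&0\end{pmatrix}$ with $Y\in\mathfrak{so}(m)$, $0\ne\beta\in\mathbb R^{m}$, $Y\beta^{t}=0$; the matrix $Y$ has singular values $x_1,x_1,\dots,x_{n-2},x_{n-2},0,0$ with $x_1\ge\dots\ge x_{n-2}\ge0$, and $(x_1,\dots,x_{n-2})$ are called the singular values of the orbit. Let $a_1\ge\dots\ge a_{n-2}\ge|a_{n-1}|$ and $a_n\ge0$ be real numbers, let $f=\iota\bigl(\mathrm{diag}(a_1H',\dots,a_{n-1}H',a_nH)\bigr)$ with $H'=\begin{pmatrix}0&1\\-1&0\end{pmatrix}$, $H=\begin{pmatrix}0&1\\1&0\end{pmatrix}$, let $\mathcal O_f=G\cdot f\subset\mathfrak g^{*}$, and let $q:\mathcal O_f\to\mathfrak p^{*}$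 be the moment map, i.e. restriction of functionals to $\mathfrak p$. Let $g'_\infty\in G$ be a preimage of $\mathrm{diag}(I_{2n-3},-1,-1,1)$. Then: (1) $P\cdot q(f)$ and $P\cdot q(g'_\infty\cdot f)$ are depth zero orbits, and they coincide if and only if $a_{n-1}=a_n=0$. (2) If $f\neq0$, then $q(\mathcal O_f)$ is the union of $P\cdot q(f)$, $P\cdot q(g'_\infty\cdot f)$ and all depth one coadjoint $P$-orbits whose singular values satisfy $$a_1\ge x_1\ge a_2\ge x_2\ge\dots\ge a_{n-2}\ge x_{n-2}\ge|a_{n-1}|$$ and moreover, in the degenerate case $a_{n-1}=a_n=0$, $x_i=0$ for every $1\le i\le n-2$ with $a_{i+1}=0$. If $f=0$, then $q(\mathcal O_f)=\{0\}$. (3) If $g\in G$ and $g\cdot f\notin P\cdot f\cup Pg'_\infty\cdot f$, then the reduced space $q^{-1}(q(g\cdot f))/\mathrm{Stab}_P(q(g\cdot f))$ is a singleton. (4) The map $q$ is weakly proper: the preimage of each compact subset of $q(\mathcal O_f)\cap\Upsilon_{sr}$ is compact. Here $\Upsilon_{sr}\subset\mathfrak p^*$ is the set of strongly regular elements, i.e.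 of those $\psi$ whose coadjoint $P$-orbit has maximal dimension and for which the reductive factor $\{X\in\mathfrak p(\psi):\mathrm{ad}\,X\text{ is semisimple}\}$ has maximal dimension among those of all $\psi'\in\mathfrak p^*$ with coadjoint orbit of maximal dimension; $\mathfrak p(\psi)$ is the stabilizer of $\psi$ in $\mathfrak p$. (5) The map $q$ is proper if and only if $f=0$. -/

import Mathlib

open Matrix

attribute [local instance] LieRing.ofAssociativeRing

noncomputable section

namespace SpinOrbit

/-! The integer `r` is `n - 2`, so the group is `Spin(2n-1,1) = Spin(2r+3,1)` and `m = 2n-2 = 2r+2`. -/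

/-- Coordinates of `ℝ^m`, `m = 2(r+1)`: the pair `(s, i)` is the coordinate `s` of the `i`-th plane. -/
abbrev Coord (r : ℕ) : Type := Fin 2 × Fin (r + 1)

/-- Coordinates of `ℝ^{m+2}`; `Sum.inr 0` and `Sum.inr 1` are the coordinates `m+1` and `m+2`. -/
abbrev Idx (r : ℕ) : Type := Coord r ⊕ Fin 2

/-- The signature: `+1` on the first `m+1` coordinates and `-1` on the last one. -/
def sign (r : ℕ) : Idx r → ℝ := Sum.elim (fun _ => 1) ![1, -1]

/-- The matrix `I_{m+1,1}`. -/
def J (r : ℕ) : Matrix (Idx r) (Idx r) ℝ := diagonal (sign r)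

/-- The quadratic form `x_1^2 + ⋯ + x_{m+1}^2 - x_{m+2}^2`. -/
def quad (r : ℕ) : QuadraticForm ℝ (Idx r → ℝ) := QuadraticMap.weightedSumSquares ℝ (sign r)

/-- The group `G = Spin(m+1,1)`. -/
abbrev G (r : ℕ) : Type := spinGroup (quad r)

/-- The Lie algebra `𝔤 = 𝔰𝔬(m+1,1)`. -/
abbrev 𝔤 (r : ℕ) : LieSubalgebra ℝ (Matrix (Idx r) (Idx r) ℝ) :=
  skewAdjointMatricesLieSubalgebra (J r)

/-! ### The covering map from `Spin(m+1,1)` to matrices -/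

/-- A left inverse of the inclusion of `ℝ^{m+2}` in its Clifford algebra. -/
def cliffordVec (r : ℕ) : CliffordAlgebra (quad r) →ₗ[ℝ] (Idx r → ℝ) :=
  ExteriorAlgebra.ιInv ∘ₗ (CliffordAlgebra.equivExterior (quad r)).toLinearMap

theorem cliffordVec_ι (r : ℕ) (v : Idx r → ℝ) :
    cliffordVec r (CliffordAlgebra.ι (quad r) v) = v := by
  simp [cliffordVec, CliffordAlgebra.equivExterior]
  exact ExteriorAlgebra.ι_leftInverse v

/-- The linear map `v ↦ k v k⁻¹` of `ℝ^{m+2}`. -/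
def vecMap (r : ℕ) (k : G r) : (Idx r → ℝ) →ₗ[ℝ] (Idx r → ℝ) :=
  cliffordVec r ∘ₗ (LinearMap.mulLeft ℝ (k : CliffordAlgebra (quad r)) ∘ₗ
    LinearMap.mulRight ℝ ((k⁻¹ : G r) : CliffordAlgebra (quad r))) ∘ₗ CliffordAlgebra.ι (quad r)

theorem ι_vecMap (r : ℕ) (k : G r) (v : Idx r → ℝ) :
    CliffordAlgebra.ι (quad r) (vecMap r k v) =
      (k : CliffordAlgebra (quad r)) * CliffordAlgebra.ι (quad r) v * ((k⁻¹ : G r) :) := by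
  obtain ⟨w, hw⟩ := spinGroup.conjAct_smul_ι_mem_range_ι
    (x := spinGroup.toUnits k) k.2 v
  rw [ConjAct.units_smul_def, ConjAct.ofConjAct_toConjAct] at hw
  have h : (k : CliffordAlgebra (quad r)) * CliffordAlgebra.ι (quad r) v * ((k⁻¹ : G r) :)
      = CliffordAlgebra.ι (quad r) w := hw.symm
  have : vecMap r k v = cliffordVec r
      ((k : CliffordAlgebra (quad r)) * (CliffordAlgebra.ι (quad r) v * ((k⁻¹ : G r) :))) := rfl
  rw [this, ← mul_assoc, h, cliffordVec_ι]

theorem ι_inj (r : ℕ) : Function.Injective (CliffordAlgebra.ι (quad r)) :=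
  Function.LeftInverse.injective (cliffordVec_ι r)

/-- The covering homomorphism `G → G_1 = SO_e(m+1,1)`, as a map to matrices. -/
def ρ (r : ℕ) : G r →* Matrix (Idx r) (Idx r) ℝ where
  toFun k := LinearMap.toMatrix' (vecMap r k)
  map_one' := by
    have : vecMap r 1 = LinearMap.id := by
      ext1 v; ext1; apply ι_inj; simp [ι_vecMap]
    rw [this, LinearMap.toMatrix'_id]
  map_mul' k l := by
    rw [← LinearMap.toMatrix'_mul]
    congr 1
    apply LinearMap.ext
    intro v
    apply ι_inj
    simp [ι_vecMap, mul_assoc]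

theorem ρ_mulVec (r : ℕ) (k : G r) (v : Idx r → ℝ) : ρ r k *ᵥ v = vecMap r k v := by
  change LinearMap.toMatrix' _ *ᵥ v = _
  rw [LinearMap.toMatrix'_mulVec]

theorem quad_vecMap (r : ℕ) (k : G r) (v : Idx r → ℝ) : quad r (vecMap r k v) = quad r v := by
  apply FaithfulSMul.algebraMap_injective ℝ (CliffordAlgebra (quad r))
  have hk : ((k⁻¹ : G r) : CliffordAlgebra (quad r)) * (k : CliffordAlgebra (quad r)) = 1 :=
    congrArg Subtype.val (inv_mul_cancel k)
  have hk' : (k : CliffordAlgebra (quad r)) * ((k⁻¹ : G r) : CliffordAlgebra (quad r)) = 1 :=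
    congrArg Subtype.val (mul_inv_cancel k)
  rw [← CliffordAlgebra.ι_sq_scalar, ← CliffordAlgebra.ι_sq_scalar, ι_vecMap]
  generalize hx : (k : CliffordAlgebra (quad r)) = x at *
  generalize hy : ((k⁻¹ : G r) : CliffordAlgebra (quad r)) = y at *
  have h2 : x * CliffordAlgebra.ι (quad r) v * y * (x * CliffordAlgebra.ι (quad r) v * y)
      = x * (CliffordAlgebra.ι (quad r) v * (y * x) * CliffordAlgebra.ι (quad r) v) * y := by
    simp only [mul_assoc]
  rw [h2, hk, mul_one, CliffordAlgebra.ι_sq_scalar, ← Algebra.commutes, mul_assoc, hk', mul_one]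

theorem quad_eq (r : ℕ) (v : Idx r → ℝ) : quad r v = v ⬝ᵥ (J r *ᵥ v) := by
  simp only [quad, J, QuadraticMap.weightedSumSquares_apply, mulVec_diagonal, dotProduct,
    smul_eq_mul]
  exact Finset.sum_congr rfl fun i _ => by ring

theorem J_transpose (r : ℕ) : (J r)ᵀ = J r := diagonal_transpose _

/-- The image of the covering map preserves the form. -/
theorem ρ_adj (r : ℕ) (k : G r) : (ρ r k)ᵀ * J r * ρ r k = J r := by
  have hq (v : Idx r → ℝ) : v ⬝ᵥ (((ρ r k)ᵀ * J r * ρ r k) *ᵥ v) = v ⬝ᵥ (J r *ᵥ v) := by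
    rw [← quad_eq, ← quad_vecMap r k v, quad_eq, ← ρ_mulVec]
    rw [← mulVec_mulVec, ← mulVec_mulVec, dotProduct_mulVec v (ρ r k)ᵀ, vecMul_transpose]
  have hS : ((ρ r k)ᵀ * J r * ρ r k)ᵀ = (ρ r k)ᵀ * J r * ρ r k := by
    simp [transpose_mul, J_transpose, Matrix.mul_assoc]
  generalize (ρ r k)ᵀ * J r * ρ r k = S at hq hS
  have hJ := J_transpose r
  generalize J r = T at hq hJ
  ext i j
  have h1 := hq (Pi.single i 1)
  have h2 := hq (Pi.single j 1)
  have h3 := hq (Pi.single i 1 + Pi.single j 1)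
  have hS' : S j i = S i j := congrFun (congrFun hS i) j
  have hT' : T j i = T i j := congrFun (congrFun hJ i) j
  simp [mulVec_add, add_dotProduct] at h1 h2 h3
  linarith

theorem ρ_mul_inv (r : ℕ) (k : G r) : ρ r k * ρ r k⁻¹ = 1 := by
  rw [← map_mul, mul_inv_cancel, map_one]

theorem ρ_inv_mul (r : ℕ) (k : G r) : ρ r k⁻¹ * ρ r k = 1 := by
  rw [← map_mul, inv_mul_cancel, map_one]

theorem ρ_transpose_mul_J (r : ℕ) (k : G r) : (ρ r k)ᵀ * J r = J r * ρ r k⁻¹ := by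
  have := congrArg (· * ρ r k⁻¹) (ρ_adj r k)
  simpa only [Matrix.mul_assoc, ρ_mul_inv, Matrix.mul_one] using this

theorem mem_𝔤 (r : ℕ) (X : Matrix (Idx r) (Idx r) ℝ) : X ∈ 𝔤 r ↔ Xᵀ * J r = J r * -X := by
  rw [mem_skewAdjointMatricesLieSubalgebra, mem_skewAdjointMatricesSubmodule]
  rfl

/-! ### Adjoint and coadjoint representations -/

theorem Ad_mem (r : ℕ) (k : G r) (X : 𝔤 r) : ρ r k * X.1 * ρ r k⁻¹ ∈ 𝔤 r := by
  have hX := (mem_𝔤 r _).1 X.2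
  have h := ρ_transpose_mul_J r k⁻¹
  rw [inv_inv] at h
  rw [mem_𝔤, transpose_mul, transpose_mul, Matrix.mul_assoc, Matrix.mul_assoc,
    ρ_transpose_mul_J, ← Matrix.mul_assoc X.1ᵀ, hX, ← Matrix.mul_assoc, ← Matrix.mul_assoc, h]
  simp [Matrix.mul_assoc]

/-- The adjoint action of `k ∈ G` on `𝔤`. -/
def Ad (r : ℕ) (k : G r) : 𝔤 r →L[ℝ] 𝔤 r where
  toFun X := ⟨ρ r k * X.1 * ρ r k⁻¹, Ad_mem r k X⟩
  map_add' X Y := Subtype.ext (by simp [mul_add, Matrix.add_mul])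
  map_smul' c X := Subtype.ext (by simp)
  cont := by
    refine Continuous.subtype_mk ?_ _
    fun_prop

/-- The dual space `𝔤^*`. -/
abbrev 𝔤Dual (r : ℕ) : Type := StrongDual ℝ (𝔤 r)

/-- The coadjoint action of `G` on `𝔤^*`. -/
instance coadjointAction (r : ℕ) : MulAction (G r) (𝔤Dual r) where
  smul k φ := φ.comp (Ad r k⁻¹)
  one_smul φ := by
    ext X
    change φ _ = φ _
    congr 1
    apply Subtype.ext
    simp [Ad]
  mul_smul k l φ := by
    ext X
    change φ _ = φ _
    congr 1
    apply Subtype.ext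
    simp [Ad, Matrix.mul_assoc]

/-- The isomorphism `𝔤 → 𝔤^*` given by the form `(X, Y) = tr (X Y) / 2`. -/
def iota (r : ℕ) (X : 𝔤 r) : 𝔤Dual r where
  toFun Y := (1 / 2) * (X.1 * Y.1).trace
  map_add' Y Z := by simp [Matrix.mul_add, mul_add]
  map_smul' c Y := by simp; ring
  cont := by fun_prop

/-! ### The parabolic subalgebra and the parabolic subgroup -/

/-- The block `H = (0 1; 1 0)`. -/
def blockH : Matrix (Fin 2) (Fin 2) ℝ := !![0, 1; 1, 0]

/-- The block `H' = (0 1; -1 0)`. -/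
def blockH' : Matrix (Fin 2) (Fin 2) ℝ := !![0, 1; -1, 0]

/-- The matrix of the element `diag(Y, 0) + t H_0 + X_α` of `𝔪 + 𝔞 + 𝔫`. -/
def parMat (r : ℕ) (Y : Matrix (Coord r) (Coord r) ℝ) (t : ℝ) (α : Coord r → ℝ) :
    Matrix (Idx r) (Idx r) ℝ :=
  fromBlocks Y (of fun i => ![-α i, α i]) (of ![α, α]) (t • blockH)

/-- The matrix `X_{Y,β,t}`, an element of the opposite parabolic subalgebra if `Y` is
skew-symmetric. -/
def oppMat (r : ℕ) (Y : Matrix (Coord r) (Coord r) ℝ) (β : Coord r → ℝ) (t : ℝ) :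
    Matrix (Idx r) (Idx r) ℝ :=
  fromBlocks Y (of fun i => ![β i, β i]) (of ![-β, β]) (t • blockH)

/-- The isotropic vector `(0, …, 0, 1, 1)`. -/
def v₀ (r : ℕ) : Idx r → ℝ := Sum.elim 0 1

theorem mem_par_iff (r : ℕ) (X : 𝔤 r) :
    (∃ Y t α, X.1 = parMat r Y t α) ↔ ∃ t : ℝ, X.1 *ᵥ v₀ r = t • v₀ r := by
  constructor
  · rintro ⟨Y, t, α, h⟩
    refine ⟨t, ?_⟩
    rw [h, parMat, v₀, fromBlocks_mulVec]
    ext i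
    rcases i with i | i
    · simp [mulVec, dotProduct]
    · fin_cases i <;> simp [mulVec, dotProduct, blockH]
  · rintro ⟨t, h⟩
    obtain ⟨X, hX⟩ := X
    rw [mem_𝔤] at hX
    have hs (i j) : X j i * sign r j = -(sign r i * X i j) := by
      have := congrFun (congrFun hX i) j
      simpa [J, mul_diagonal, diagonal_mul] using this
    have hv (i) : X i (Sum.inr 0) + X i (Sum.inr 1) = t * v₀ r i := by
      have := congrFun h i
      simpa [mulVec, dotProduct, v₀, Fintype.sum_sum_type] using this
    refine ⟨X.toBlocks₁₁, t, fun i => X (Sum.inr 1) (Sum.inl i), ?_⟩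
    have e00 := hs (Sum.inr 0) (Sum.inr 0)
    have e11 := hs (Sum.inr 1) (Sum.inr 1)
    have v0 := hv (Sum.inr 0)
    have v1 := hv (Sum.inr 1)
    simp [sign, v₀] at e00 e11 v0 v1
    have z00 : X (Sum.inr 0) (Sum.inr 0) = 0 := by linarith
    have z11 : X (Sum.inr 1) (Sum.inr 1) = 0 := by linarith
    ext i j
    rcases i with i | i <;> rcases j with j | j
    · simp [parMat, toBlocks₁₁]
    · have a0 := hs (Sum.inl i) (Sum.inr 0)
      have a1 := hs (Sum.inl i) (Sum.inr 1)
      have a2 := hv (Sum.inl i)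
      simp [sign, v₀] at a0 a1 a2
      fin_cases j <;> simp [parMat] <;> linarith
    · have a0 := hs (Sum.inl j) (Sum.inr 0)
      have a1 := hs (Sum.inl j) (Sum.inr 1)
      have a2 := hv (Sum.inl j)
      simp [sign, v₀] at a0 a1 a2
      fin_cases i <;> simp [parMat]; linarith
    · fin_cases i <;> fin_cases j <;> simp [parMat, blockH] <;> linarith

/-- The parabolic subalgebra `𝔭 = 𝔪 + 𝔞 + 𝔫` of `𝔤`. -/
def 𝔭 (r : ℕ) : LieSubalgebra ℝ (𝔤 r) where
  carrier := {X | ∃ Y t α, X.1 = parMat r Y t α}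
  zero_mem' := (mem_par_iff r 0).2 ⟨0, by simp⟩
  add_mem' {X Y} hX hY := by
    obtain ⟨s, hs⟩ := (mem_par_iff r X).1 hX
    obtain ⟨t, ht⟩ := (mem_par_iff r Y).1 hY
    exact (mem_par_iff r _).2 ⟨s + t, by simp [add_mulVec, hs, ht, add_smul]⟩
  smul_mem' c X hX := by
    obtain ⟨s, hs⟩ := (mem_par_iff r X).1 hX
    exact (mem_par_iff r _).2 ⟨c * s, by simp [smul_mulVec, hs, mul_smul]⟩
  lie_mem' {X Y} hX hY := by
    obtain ⟨s, hs⟩ := (mem_par_iff r X).1 hX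
    obtain ⟨t, ht⟩ := (mem_par_iff r Y).1 hY
    refine (mem_par_iff r _).2 ⟨0, ?_⟩
    rw [LieSubalgebra.coe_bracket, LieRing.of_associative_ring_bracket, sub_mulVec,
      ← mulVec_mulVec, ← mulVec_mulVec, hs, ht, mulVec_smul, mulVec_smul, hs, ht, smul_comm]
    simp

/-- The element `diag(W, 1, 1)`; for `W ∈ SO(m)` these are the elements of `M_1`. -/
def mMat (r : ℕ) (W : Matrix (Coord r) (Coord r) ℝ) : Matrix (Idx r) (Idx r) ℝ :=
  fromBlocks W 0 0 1

/-- The element `exp (s H_0)` of `A`. -/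
def aMat (r : ℕ) (s : ℝ) : Matrix (Idx r) (Idx r) ℝ :=
  fromBlocks 1 0 0 !![Real.cosh s, Real.sinh s; Real.sinh s, Real.cosh s]

/-- The element `n_α = exp (X_α)` of `N`. -/
def nMat (r : ℕ) (α : Coord r → ℝ) : Matrix (Idx r) (Idx r) ℝ :=
  fromBlocks 1 (of fun i => ![-α i, α i]) (of ![α, α])
    !![1 - (α ⬝ᵥ α) / 2, (α ⬝ᵥ α) / 2; -((α ⬝ᵥ α) / 2), 1 + (α ⬝ᵥ α) / 2]

theorem mMat_mul (r : ℕ) (W W' : Matrix (Coord r) (Coord r) ℝ) :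
    mMat r W * mMat r W' = mMat r (W * W') := by
  simp [mMat, fromBlocks_multiply]

theorem aMat_mul (r : ℕ) (s t : ℝ) : aMat r s * aMat r t = aMat r (s + t) := by
  simp only [aMat, fromBlocks_multiply, Real.cosh_add, Real.sinh_add]
  congr 1 <;> ext i j
  · simp
  · simp
  · simp
  · fin_cases i <;> fin_cases j <;> simp [Matrix.mul_apply] <;> ring

theorem mMat_aMat (r : ℕ) (W : Matrix (Coord r) (Coord r) ℝ) (s : ℝ) :
    aMat r s * mMat r W = mMat r W * aMat r s := by
  simp [mMat, aMat, fromBlocks_multiply]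

theorem nMat_mul (r : ℕ) (α β : Coord r → ℝ) : nMat r α * nMat r β = nMat r (α + β) := by
  have hc : β ⬝ᵥ α = α ⬝ᵥ β := dotProduct_comm _ _
  have hs : (α + β) ⬝ᵥ (α + β) = α ⬝ᵥ α + 2 * (α ⬝ᵥ β) + β ⬝ᵥ β := by
    rw [add_dotProduct, dotProduct_add, dotProduct_add, hc]; ring
  have hv0 : (α ᵥ* of fun i => ![-β i, β i]) 0 = -(α ⬝ᵥ β) := by simp [vecMul, dotProduct]
  have hv1 : (α ᵥ* of fun i => ![-β i, β i]) 1 = α ⬝ᵥ β := by simp [vecMul, dotProduct]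
  simp only [nMat, fromBlocks_multiply, hs]
  congr 1 <;> ext i j
  · simp [Matrix.mul_apply]
  · fin_cases j <;> simp [Matrix.mul_apply] <;> ring
  · fin_cases i <;> simp [Matrix.mul_apply] <;> ring
  · fin_cases i <;> fin_cases j <;> simp [hv0, hv1] <;> ring

theorem nMat_mMat (r : ℕ) (α : Coord r → ℝ) (W : Matrix (Coord r) (Coord r) ℝ)
    (hW : W * Wᵀ = 1) : nMat r α * mMat r W = mMat r W * nMat r (α ᵥ* W) := by
  have h1 : W *ᵥ (α ᵥ* W) = α := by
    rw [← mulVec_transpose, mulVec_mulVec, hW, one_mulVec]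
  have h2 : (α ᵥ* W) ⬝ᵥ (α ᵥ* W) = α ⬝ᵥ α := by
    rw [← dotProduct_mulVec, h1]
  simp only [nMat, mMat, fromBlocks_multiply, h2]
  congr 1 <;> ext i j
  · simp
  · have := congrFun h1 i
    simp only [mulVec, dotProduct] at this
    fin_cases j <;> simp [Matrix.mul_apply, this]
  · fin_cases i <;> simp [Matrix.mul_apply, vecMul, dotProduct]
  · simp

theorem nMat_aMat (r : ℕ) (α : Coord r → ℝ) (s : ℝ) :
    nMat r α * aMat r s = aMat r s * nMat r (Real.exp (-s) • α) := by
  have h0 : Real.exp (-s) * Real.exp s = 1 := by rw [← Real.exp_add]; simp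
  have hc := Real.cosh_eq s
  have hs := Real.sinh_eq s
  simp only [nMat, aMat, fromBlocks_multiply, dotProduct_smul, smul_dotProduct, smul_eq_mul, hc, hs]
  generalize Real.exp (-s) = y at *
  generalize Real.exp s = x at *
  generalize α ⬝ᵥ α = q
  congr 1 <;> ext i j
  · simp
  · fin_cases j <;> simp [Matrix.mul_apply] <;> ring
  · fin_cases i <;> simp [Matrix.mul_apply] <;> linear_combination (-α j) * h0
  · fin_cases i <;> fin_cases j <;> simp [Matrix.mul_apply]
    · linear_combination (q * y / 2) * h0
    · linear_combination (-q * y / 2) * h0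
    · linear_combination (q * y / 2) * h0
    · linear_combination (-q * y / 2) * h0

theorem mMat_one (r : ℕ) : mMat r 1 = 1 := by simp [mMat]

theorem aMat_zero (r : ℕ) : aMat r 0 = 1 := by
  rw [aMat, ← fromBlocks_one]
  congr 1
  ext i j
  fin_cases i <;> fin_cases j <;> simp

theorem nMat_zero (r : ℕ) : nMat r 0 = 1 := by
  rw [nMat, ← fromBlocks_one]
  congr 1 <;> ext i j
  · fin_cases j <;> simp
  · fin_cases i <;> simp
  · fin_cases i <;> fin_cases j <;> simp

theorem man_mul (r : ℕ) (W W' : Matrix (Coord r) (Coord r) ℝ) (s s' : ℝ) (α α' : Coord r → ℝ)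
    (hW' : W' * W'ᵀ = 1) :
    (mMat r W * aMat r s * nMat r α) * (mMat r W' * aMat r s' * nMat r α') =
      mMat r (W * W') * aMat r (s + s') * nMat r (Real.exp (-s') • (α ᵥ* W') + α') := by
  rw [← mMat_mul, ← aMat_mul, ← nMat_mul]
  simp only [Matrix.mul_assoc]
  rw [← Matrix.mul_assoc (nMat r α), nMat_mMat r α W' hW']
  simp only [Matrix.mul_assoc]
  rw [← Matrix.mul_assoc (nMat r _) (aMat r s'), nMat_aMat]
  simp only [Matrix.mul_assoc]
  rw [← Matrix.mul_assoc (aMat r s) (mMat r W'), mMat_aMat]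
  simp only [Matrix.mul_assoc]

/-- The minimal parabolic subgroup `P = M A N` of `G`: the elements which lie over
`M_1 A N ⊆ SO_e(m+1,1)`, where `M_1 = SO(m)`. -/
def P (r : ℕ) : Subgroup (G r) where
  carrier := {k | ∃ W ∈ specialOrthogonalGroup (Coord r) ℝ, ∃ s α,
    ρ r k = mMat r W * aMat r s * nMat r α}
  one_mem' := ⟨1, one_mem _, 0, 0, by simp [mMat_one, aMat_zero, nMat_zero]⟩
  mul_mem' := by
    rintro k l ⟨W, hW, s, α, h⟩ ⟨W', hW', s', α', h'⟩
    refine ⟨W * W', mul_mem hW hW', s + s', Real.exp (-s') • (α ᵥ* W') + α', ?_⟩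
    rw [map_mul, h, h', man_mul]
    exact (mem_orthogonalGroup_iff _ _).1 (mem_specialOrthogonalGroup_iff.1 hW').1
  inv_mem' := by
    rintro k ⟨W, hW, s, α, h⟩
    have hO : W * Wᵀ = 1 := (mem_orthogonalGroup_iff _ _).1 (mem_specialOrthogonalGroup_iff.1 hW).1
    have hO' : Wᵀ * W = 1 := (mem_orthogonalGroup_iff' _ _).1 (mem_specialOrthogonalGroup_iff.1 hW).1
    refine ⟨Wᵀ, ?_, -s, -(Real.exp s • (α ᵥ* Wᵀ)), ?_⟩
    · rw [mem_specialOrthogonalGroup_iff] at hW ⊢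
      refine ⟨(mem_orthogonalGroup_iff _ _).2 ?_, by rw [det_transpose, hW.2]⟩
      change Wᵀ * Wᵀᵀ = 1
      rw [transpose_transpose, hO']
    · have hm := man_mul r W Wᵀ s (-s) α (-(Real.exp s • (α ᵥ* Wᵀ)))
        (by rw [transpose_transpose, hO'])
      rw [← h, hO, neg_neg, add_neg_cancel, add_neg_cancel, mMat_one, aMat_zero, nMat_zero,
        Matrix.one_mul, Matrix.one_mul] at hm
      have := congrArg (ρ r k⁻¹ * ·) hm
      simpa only [← Matrix.mul_assoc, ρ_inv_mul, Matrix.one_mul, Matrix.mul_one] using this.symm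

theorem ρ_P_v₀ (r : ℕ) (k : G r) (hk : k ∈ P r) : ∃ t : ℝ, ρ r k *ᵥ v₀ r = t • v₀ r := by
  obtain ⟨W, -, s, α, h⟩ := hk
  have hn : nMat r α *ᵥ v₀ r = v₀ r := by
    rw [nMat, v₀, fromBlocks_mulVec]
    ext i
    rcases i with i | i
    · simp [mulVec, dotProduct]
    · fin_cases i <;> simp [mulVec, dotProduct]
  have ha : aMat r s *ᵥ v₀ r = Real.exp s • v₀ r := by
    rw [aMat, v₀, fromBlocks_mulVec]
    ext i
    rcases i with i | i
    · simp [mulVec, dotProduct]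
    · fin_cases i <;> simp [mulVec, dotProduct, Real.cosh_eq, Real.sinh_eq] <;> ring
  have hm : mMat r W *ᵥ v₀ r = v₀ r := by
    rw [mMat, v₀, fromBlocks_mulVec]
    ext i
    rcases i with i | i <;> simp
  exact ⟨Real.exp s, by rw [h, ← mulVec_mulVec, ← mulVec_mulVec, hn, ha, mulVec_smul, hm]⟩

theorem Ad_mem_𝔭 (r : ℕ) (k : P r) (X : 𝔭 r) : Ad r k X ∈ 𝔭 r := by
  obtain ⟨s, hs⟩ := ρ_P_v₀ r k k.2
  obtain ⟨t, ht⟩ := ρ_P_v₀ r (k : G r)⁻¹ ((P r).inv_mem k.2)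
  obtain ⟨c, hc⟩ := (mem_par_iff r X).1 X.2
  refine (mem_par_iff r _).2 ⟨t * c * s, ?_⟩
  change (ρ r k * X.1.1 * ρ r (k : G r)⁻¹) *ᵥ v₀ r = _
  rw [← mulVec_mulVec, ← mulVec_mulVec, ht, mulVec_smul, hc, mulVec_smul, mulVec_smul, hs,
    smul_smul, smul_smul, mul_assoc]

/-- The adjoint action of `k ∈ P` on `𝔭`. -/
def AdP (r : ℕ) (k : P r) : 𝔭 r →L[ℝ] 𝔭 r where
  toFun X := ⟨Ad r k X, Ad_mem_𝔭 r k X⟩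
  map_add' X Y := Subtype.ext (by simp)
  map_smul' c X := Subtype.ext (by simp)
  cont := by
    refine Continuous.subtype_mk ?_ _
    exact (Ad r k).continuous.comp continuous_subtype_val

/-- The dual space `𝔭^*`. -/
abbrev 𝔭Dual (r : ℕ) : Type := StrongDual ℝ (𝔭 r)

/-- The coadjoint action of `P` on `𝔭^*`. -/
instance coadjointActionP (r : ℕ) : MulAction (P r) (𝔭Dual r) where
  smul k φ := φ.comp (AdP r k⁻¹)
  one_smul φ := by
    ext X
    change φ _ = φ _
    congr 1
    apply Subtype.ext
    apply Subtype.ext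
    simp [AdP, Ad]
  mul_smul k l φ := by
    ext X
    change φ _ = φ _
    congr 1
    apply Subtype.ext
    apply Subtype.ext
    simp [AdP, Ad, Matrix.mul_assoc]

/-! ### The moment map and the data of the orbit `O_f` -/

/-- The restriction map `𝔤^* → 𝔭^*`. -/
def res (r : ℕ) (φ : 𝔤Dual r) : 𝔭Dual r where
  toFun X := φ X
  map_add' X Y := by simp
  map_smul' c X := by simp
  cont := φ.continuous.comp continuous_subtype_val

/-- The coadjoint orbit `O_f = G · f`. -/
abbrev orb (r : ℕ) (f : 𝔤Dual r) : Set (𝔤Dual r) := MulAction.orbit (G r) f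

/-- The moment map `q : O_f → 𝔭^*`. -/
def q (r : ℕ) (f : 𝔤Dual r) : orb r f → 𝔭Dual r := fun φ => res r φ

/-- The matrix `t'_a = diag(a_1 H', …, a_{n-1} H', a_n H)`; the last argument is `a_n`. -/
def tMat (r : ℕ) (a : Fin (r + 1) → ℝ) (c : ℝ) : Matrix (Idx r) (Idx r) ℝ :=
  fromBlocks (blockDiagonal fun i => a i • blockH') 0 0 (c • blockH)

theorem tMat_mem (r : ℕ) (a : Fin (r + 1) → ℝ) (c : ℝ) : tMat r a c ∈ 𝔤 r := by
  have hJ : J r = fromBlocks 1 0 0 (diagonal ![1, -1]) := by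
    rw [J, ← diagonal_one, fromBlocks_diagonal]; rfl
  have hH : (blockH')ᵀ = -blockH' := by
    ext i j; fin_cases i <;> fin_cases j <;> simp [blockH']
  rw [mem_𝔤, tMat, hJ, fromBlocks_transpose, fromBlocks_multiply, fromBlocks_neg,
    fromBlocks_multiply, blockDiagonal_transpose]
  congr 1
  · simp only [transpose_smul, hH]
    rw [← blockDiagonal_neg]
    simp only [Matrix.mul_one, Matrix.mul_zero, Matrix.zero_mul, add_zero, Matrix.one_mul]
    congr 1
    ext i : 1
    simp
  · simp
  · simp
  · ext i j; fin_cases i <;> fin_cases j <;> simp [blockH, Matrix.mul_apply]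

/-- The functional `f = ι(t'_a)`. -/
def semisimpleElt (r : ℕ) (a : Fin (r + 1) → ℝ) (c : ℝ) : 𝔤Dual r :=
  iota r ⟨tMat r a c, tMat_mem r a c⟩

/-- The coordinate vector of the coordinate `2n-2`. -/
def eP (r : ℕ) : Idx r → ℝ := Pi.single (Sum.inl (1, Fin.last r)) 1

/-- The coordinate vector of the coordinate `2n-1`. -/
def eQ (r : ℕ) : Idx r → ℝ := Pi.single (Sum.inr 0) 1

theorem quad_single (r : ℕ) (i : Idx r) : quad r (Pi.single i 1) = sign r i := by
  rw [quad_eq]; simp [J]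

theorem ι_eP_sq (r : ℕ) : CliffordAlgebra.ι (quad r) (eP r) * CliffordAlgebra.ι (quad r) (eP r) = 1 := by
  rw [CliffordAlgebra.ι_sq_scalar, eP, quad_single]; simp [sign]

theorem ι_eQ_sq (r : ℕ) : CliffordAlgebra.ι (quad r) (eQ r) * CliffordAlgebra.ι (quad r) (eQ r) = 1 := by
  rw [CliffordAlgebra.ι_sq_scalar, eQ, quad_single]; simp [sign]

theorem gInf_mem (r : ℕ) :
    CliffordAlgebra.ι (quad r) (eP r) * CliffordAlgebra.ι (quad r) (eQ r) ∈ spinGroup (quad r) := by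
  have hP := ι_eP_sq r
  have hQ := ι_eQ_sq r
  refine spinGroup.mem_iff.2 ⟨pinGroup.mem_iff.2 ⟨?_, ?_, ?_⟩, ?_⟩
  · refine mul_mem ?_ ?_
    · exact ⟨⟨_, _, hP, hP⟩, Subgroup.subset_closure ⟨_, rfl⟩, rfl⟩
    · exact ⟨⟨_, _, hQ, hQ⟩, Subgroup.subset_closure ⟨_, rfl⟩, rfl⟩
  · rw [star_mul, CliffordAlgebra.star_ι, CliffordAlgebra.star_ι, neg_mul_neg, mul_assoc,
      ← mul_assoc (CliffordAlgebra.ι (quad r) (eP r)), hP, one_mul, hQ]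
  · rw [star_mul, CliffordAlgebra.star_ι, CliffordAlgebra.star_ι, neg_mul_neg, mul_assoc,
      ← mul_assoc (CliffordAlgebra.ι (quad r) (eQ r)), hQ, one_mul, hP]
  · exact CliffordAlgebra.ι_mul_ι_mem_evenOdd_zero _ _ _

/-- The element `g'_∞`, a preimage in `G` of `diag(I_{2n-3}, -1, -1, 1)`. -/
def gInf (r : ℕ) : G r :=
  ⟨CliffordAlgebra.ι (quad r) (eP r) * CliffordAlgebra.ι (quad r) (eQ r), gInf_mem r⟩

theorem ρ_gInf (r : ℕ) : ρ r (gInf r) =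
    diagonal fun i => if i = Sum.inl (1, Fin.last r) ∨ i = Sum.inr 0 then -1 else 1 := by
  have hP := ι_eP_sq r
  have hQ := ι_eQ_sq r
  have hanti (i j : Idx r) (h : i ≠ j) :
      CliffordAlgebra.ι (quad r) (Pi.single i 1) * CliffordAlgebra.ι (quad r) (Pi.single j 1) =
      -(CliffordAlgebra.ι (quad r) (Pi.single j 1) * CliffordAlgebra.ι (quad r) (Pi.single i 1)) := by
    apply CliffordAlgebra.ι_mul_ι_comm_of_isOrtho
    rw [QuadraticMap.isOrtho_def, quad_single, quad_single, quad_eq]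
    simp [J, mulVec_add, add_dotProduct, diagonal_apply, h, h.symm]
  have hinv : (((gInf r)⁻¹ : G r) : CliffordAlgebra (quad r)) =
      CliffordAlgebra.ι (quad r) (eQ r) * CliffordAlgebra.ι (quad r) (eP r) := by
    change star (CliffordAlgebra.ι (quad r) (eP r) * CliffordAlgebra.ι (quad r) (eQ r)) = _
    rw [star_mul, CliffordAlgebra.star_ι, CliffordAlgebra.star_ι, neg_mul_neg]
  have hval : ((gInf r : G r) : CliffordAlgebra (quad r)) =
      CliffordAlgebra.ι (quad r) (eP r) * CliffordAlgebra.ι (quad r) (eQ r) := rfl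
  have hPQ := hanti (Sum.inl (1, Fin.last r)) (Sum.inr 0) (by simp)
  apply Matrix.ext_of_mulVec_single
  intro j
  rw [ρ_mulVec]
  apply ι_inj
  rw [ι_vecMap, hinv, hval]
  by_cases hj : j = Sum.inl (1, Fin.last r) ∨ j = Sum.inr 0
  · have hd : (diagonal fun i : Idx r => if i = Sum.inl (1, Fin.last r) ∨ i = Sum.inr 0
        then (-1 : ℝ) else 1) *ᵥ Pi.single j 1 = -Pi.single j 1 := by
      rw [mulVec_single_one]
      ext i
      by_cases hij : i = j
      · subst hij; simp [col_apply, hj]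
      · simp [col_apply, diagonal_apply_ne _ hij, hij]
    rw [hd, map_neg]
    rcases hj with rfl | rfl
    · change _ * CliffordAlgebra.ι (quad r) (eP r) * _ = -CliffordAlgebra.ι (quad r) (eP r)
      change CliffordAlgebra.ι (quad r) (eP r) * CliffordAlgebra.ι (quad r) (eQ r) =
        -(CliffordAlgebra.ι (quad r) (eQ r) * CliffordAlgebra.ι (quad r) (eP r)) at hPQ
      generalize CliffordAlgebra.ι (quad r) (eP r) = p at *
      generalize CliffordAlgebra.ι (quad r) (eQ r) = q at *
      have : p * q * p * (q * p) = -(q * (p * p) * q) * p := by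
        rw [hPQ]; simp only [neg_mul, mul_assoc]
      rw [this, hP, mul_one, hQ, neg_mul, one_mul]
    · change _ * CliffordAlgebra.ι (quad r) (eQ r) * _ = -CliffordAlgebra.ι (quad r) (eQ r)
      change CliffordAlgebra.ι (quad r) (eP r) * CliffordAlgebra.ι (quad r) (eQ r) =
        -(CliffordAlgebra.ι (quad r) (eQ r) * CliffordAlgebra.ι (quad r) (eP r)) at hPQ
      generalize CliffordAlgebra.ι (quad r) (eP r) = p at *
      generalize CliffordAlgebra.ι (quad r) (eQ r) = q at *
      have : p * q * q * (q * p) = p * (q * q) * (q * p) := by simp only [mul_assoc]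
      rw [this, hQ, mul_one, ← mul_assoc, hPQ, neg_mul, mul_assoc, hP, mul_one]
  · have hd : (diagonal fun i : Idx r => if i = Sum.inl (1, Fin.last r) ∨ i = Sum.inr 0
        then (-1 : ℝ) else 1) *ᵥ Pi.single j 1 = Pi.single j 1 := by
      rw [mulVec_single_one]
      ext i
      by_cases hij : i = j
      · subst hij; simp [col_apply, hj]
      · simp [col_apply, diagonal_apply_ne _ hij, hij]
    rw [hd]
    push Not at hj
    have h1 := hanti j _ hj.1
    have h2 := hanti j _ hj.2
    change _ * CliffordAlgebra.ι (quad r) (eP r) =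
      -(CliffordAlgebra.ι (quad r) (eP r) * _) at h1
    change _ * CliffordAlgebra.ι (quad r) (eQ r) =
      -(CliffordAlgebra.ι (quad r) (eQ r) * _) at h2
    generalize CliffordAlgebra.ι (quad r) (eP r) = p at *
    generalize CliffordAlgebra.ι (quad r) (eQ r) = q at *
    generalize CliffordAlgebra.ι (quad r) (Pi.single j 1) = v at *
    have : p * q * v * (q * p) = p * q * (v * q) * p := by simp only [mul_assoc]
    rw [this, h2]
    have : p * q * -(q * v) * p = -(p * (q * q) * (v * p)) := by
      simp only [mul_assoc, mul_neg, neg_mul]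
    rw [this, hQ, h1, mul_one, mul_neg, neg_neg, ← mul_assoc, hP, one_mul]

/-! ### Coadjoint `P`-orbits in `𝔭^*` -/

/-- Coadjoint `P`-orbits in `𝔭^*`. -/
def IsPOrbit (r : ℕ) (O : Set (𝔭Dual r)) : Prop := ∃ ψ, O = MulAction.orbit (P r) ψ

/-- The subspace `𝔩^*` of `𝔭^*`: the functionals which vanish on `𝔫`. -/
def 𝔩Dual (r : ℕ) : Set (𝔭Dual r) := {ψ | ∀ X : 𝔭 r, (∃ α, X.1.1 = parMat r 0 0 α) → ψ X = 0}

/-- A coadjoint `P`-orbit of depth zero. -/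
def IsDepthZero (r : ℕ) (O : Set (𝔭Dual r)) : Prop := IsPOrbit r O ∧ O ⊆ 𝔩Dual r

/-- A coadjoint `P`-orbit of depth one. -/
def IsDepthOne (r : ℕ) (O : Set (𝔭Dual r)) : Prop := IsPOrbit r O ∧ ¬ O ⊆ 𝔩Dual r

/-- The map `pr : 𝔤 → 𝔭^*`. -/
def pr (r : ℕ) (X : 𝔤 r) : 𝔭Dual r := res r (iota r X)

open Polynomial in
/-- The singular values of the coadjoint `P`-orbit `O` of depth one are `x_1 ≥ ⋯ ≥ x_{n-2} ≥ 0`: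
`O` contains some `pr (X_{Y,β,0})` with `β ≠ 0` and `Y β^t = 0` such that the singular values of
the skew-symmetric matrix `Y`, that is the square roots of the eigenvalues of `Y^t Y`, are
`x_1, x_1, …, x_{n-2}, x_{n-2}, 0, 0`. -/
def HasSingularValues (r : ℕ) (O : Set (𝔭Dual r)) (x : Fin r → ℝ) : Prop :=
  Antitone x ∧ (∀ i, 0 ≤ x i) ∧
    ∃ (Y : Matrix (Coord r) (Coord r) ℝ) (β : Coord r → ℝ) (Z : 𝔤 r),
      Z.1 = oppMat r Y β 0 ∧ β ≠ 0 ∧ Y *ᵥ β = 0 ∧ pr r Z ∈ O ∧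
      (Yᵀ * Y).charpoly = X ^ 2 * ∏ i, (X - C (x i ^ 2)) ^ 2

/-! ### Strongly regular elements and weak properness -/

/-- The stabilizer `𝔭(ψ)` of `ψ ∈ 𝔭^*` in `𝔭`. -/
def stabAlg (r : ℕ) (ψ : 𝔭Dual r) : Submodule ℝ (𝔭 r) where
  carrier := {X | ∀ Y, ψ ⁅X, Y⁆ = 0}
  zero_mem' := by simp
  add_mem' hX hY Z := by rw [add_lie, map_add, hX Z, hY Z, add_zero]
  smul_mem' c X hX Z := by rw [smul_lie, map_smul, hX Z, smul_zero]

/-- `ψ` is regular: its coadjoint orbit has maximal dimension, that is `𝔭(ψ)` has minimal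
dimension. -/
def IsRegularElt (r : ℕ) (ψ : 𝔭Dual r) : Prop :=
  ∀ ψ', Module.finrank ℝ (stabAlg r ψ) ≤ Module.finrank ℝ (stabAlg r ψ')

/-- The dimension of the reductive factor `{X ∈ 𝔭(ψ) : ad X is semisimple}`, a subspace of `𝔭(ψ)`
for regular `ψ`. -/
def reductiveDim (r : ℕ) (ψ : 𝔭Dual r) : ℕ :=
  Module.finrank ℝ (Submodule.span ℝ
    {X : 𝔭 r | X ∈ stabAlg r ψ ∧ (LieAlgebra.ad ℝ (𝔭 r) X).IsSemisimple})

/-- `ψ` is strongly regular: it is regular and its reductive factor has maximal dimension among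
those of all regular elements. -/
def IsStronglyRegular (r : ℕ) (ψ : 𝔭Dual r) : Prop :=
  IsRegularElt r ψ ∧ ∀ ψ', IsRegularElt r ψ' → reductiveDim r ψ' ≤ reductiveDim r ψ

/-- The moment map `q` is weakly proper: the preimage of each compact subset of
`q(O_f) ∩ Υ_sr` is compact, where `Υ_sr` is the set of strongly regular elements of `𝔭^*`. -/
def IsWeaklyProper (r : ℕ) (f : 𝔤Dual r) : Prop :=
  ∀ Ω : Set (𝔭Dual r), IsCompact Ω → Ω ⊆ Set.range (q r f) ∩ {ψ | IsStronglyRegular r ψ} →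
    IsCompact (q r f ⁻¹' Ω)

/-! ### Reduced spaces -/

/-- The reduced space `q⁻¹(ψ) / Stab_P(ψ)`. -/
def ReducedSpace (r : ℕ) (f : 𝔤Dual r) (ψ : 𝔭Dual r) : Type :=
  Quotient ((MulAction.orbitRel (MulAction.stabilizer (P r) ψ) (𝔤Dual r)).comap
    (fun φ : {φ : orb r f // q r f φ = ψ} => (φ : 𝔤Dual r)))

end SpinOrbit
end

open SpinOrbit

/-! Write T for `tMat` and attach to the point k·f the isotropic vector x = ρ(k)⁻¹v₀. The group P is
exactly the stabilizer of the ray of v₀ (`mem_P_of_ray`), so the P-orbit of k·f depends only on the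
ray of x modulo the centralizer of T. By `pr_eq_iff` the restriction of k·f to 𝔭 amounts to a triple
(Y, τ, b): the 𝔪-block of Z = Ad(k)T and the two components of Zv₀. Depth zero means b = 0, that is,
x is an eigenvector of T; up to the centralizer such an x lies on the ray of v₀ or of g'_∞⁻¹v₀
(`mem_orbit_of_lin_eq_zero`).

Depth one rests on `resolvent_eq`. The determinant of t − Z + s v₀(Jv₀)ᵗ is computed twice. A Schur
complement expresses its s-coefficient by det(t − Y) and bᵗ(t − Y)⁻¹b only; after conjugation to T
the same coefficient is a partial fraction sum in t² whose residues are the squared lengths of the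
components of x in the eigenspaces of T².

Image: N can be used to reach Yb = 0. Isotropy of x turns the identity into a statement on
polynomials: with x_i the squared singular values' roots, ∏(μ + x_i²) is a convex combination of the
products ∏_{i≠k}(μ + a_i²), the weight of index k being proportional to (a_k² + c²) times the
squared length of x in the k-th plane. Sign changes make the roots interlace (`exists_interlacing`),
and Lagrange interpolation recovers weights from interlacing numbers (`exists_weights`). A weight
must vanish where a_k = c = 0, which is the extra condition of the degenerate case. Orthogonal
conjugacy of skew matrices (`exists_specialOrthogonal_conj`) shows that the singular values
determine the orbit.

Reduced spaces: equal restrictions give equal residues, and the centralizer of T is transitive on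
isotropic future vectors with given eigencomponent lengths and a timelike c²-component
(`exists_centralizer_move`). Hence a depth one fibre lies in a single P-orbit.

The two depth zero orbits have τ = c and τ = −c, and 𝔪-blocks conjugate by a matrix of determinant
−1. If every a_i is nonzero, a matrix commuting with the block has nonnegative determinant
(`det_nonneg_of_commute`), so the orbits differ.

Properness: for f ≠ 0 the fibre over q(f) contains an unbounded curve in N·f. Regular functionals
have b ≠ 0, so |b| is bounded above and away from zero on a compact set of them; moving x by the
centralizer makes its time coordinate comparable to |b|, and a decomposition of k into a factor of P
and an orthogonal factor then has bounded parameters. -/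

set_option linter.unusedSimpArgs false

namespace SpinOrbit

/-! ### The Lorentz form and reflections -/

/-- The symmetric bilinear form of signature `(m+1,1)`. -/
def bil (r : ℕ) (u v : Idx r → ℝ) : ℝ := u ⬝ᵥ (J r *ᵥ v)

theorem bil_eq_sum (r : ℕ) (u v : Idx r → ℝ) : bil r u v = ∑ i, sign r i * (u i * v i) := by
  simp only [bil, J, mulVec_diagonal, dotProduct]
  exact Finset.sum_congr rfl fun i _ => by ring

theorem bil_comm (r : ℕ) (u v : Idx r → ℝ) : bil r u v = bil r v u := by
  simp only [bil_eq_sum, mul_comm]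

@[simp] theorem bil_add_left (r : ℕ) (u u' v : Idx r → ℝ) :
    bil r (u + u') v = bil r u v + bil r u' v := add_dotProduct _ _ _

@[simp] theorem bil_add_right (r : ℕ) (u v v' : Idx r → ℝ) :
    bil r u (v + v') = bil r u v + bil r u v' := by
  simp [bil, mulVec_add]

@[simp] theorem bil_zero_left (r : ℕ) (v : Idx r → ℝ) : bil r 0 v = 0 := zero_dotProduct _

@[simp] theorem bil_smul_left (r : ℕ) (c : ℝ) (u v : Idx r → ℝ) :
    bil r (c • u) v = c * bil r u v := by simp [bil]

@[simp] theorem bil_smul_right (r : ℕ) (c : ℝ) (u v : Idx r → ℝ) :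
    bil r u (c • v) = c * bil r u v := by simp [bil, mulVec_smul]

@[simp] theorem bil_sub_left (r : ℕ) (u u' v : Idx r → ℝ) :
    bil r (u - u') v = bil r u v - bil r u' v := sub_dotProduct _ _ _

@[simp] theorem bil_sub_right (r : ℕ) (u v v' : Idx r → ℝ) :
    bil r u (v - v') = bil r u v - bil r u v' := by
  simp [bil, mulVec_sub]

theorem bil_apply (r : ℕ) (u v : Idx r → ℝ) :
    bil r u v = (u ∘ Sum.inl) ⬝ᵥ (v ∘ Sum.inl) + u (Sum.inr 0) * v (Sum.inr 0)
      - u (Sum.inr 1) * v (Sum.inr 1) := by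
  rw [bil_eq_sum, Fintype.sum_sum_type]
  simp [sign, dotProduct]
  ring

/-- The reflection in the hyperplane orthogonal to `d`. -/
noncomputable def refl (r : ℕ) (d : Idx r → ℝ) : Matrix (Idx r) (Idx r) ℝ :=
  1 - (2 / bil r d d) • vecMulVec d (J r *ᵥ d)

theorem refl_mulVec (r : ℕ) (d u : Idx r → ℝ) :
    refl r d *ᵥ u = u - (2 * bil r d u / bil r d d) • d := by
  rw [refl, sub_mulVec, one_mulVec, smul_mulVec, vecMulVec_mulVec]
  have : (J r *ᵥ d) ⬝ᵥ u = bil r d u := by rw [bil_comm, bil, dotProduct_comm]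
  rw [this]
  simp only [op_smul_eq_smul, smul_smul]
  congr 2
  ring

theorem bil_refl (r : ℕ) (d u v : Idx r → ℝ) (hd : bil r d d ≠ 0) :
    bil r (refl r d *ᵥ u) (refl r d *ᵥ v) = bil r u v := by
  simp only [refl_mulVec, bil_sub_left, bil_sub_right, bil_smul_left, bil_smul_right, bil_comm r u d]
  field_simp
  ring

theorem det_refl (r : ℕ) (d : Idx r → ℝ) (hd : bil r d d ≠ 0) : (refl r d).det = -1 := by
  have h : refl r d = 1 + replicateCol Unit (-(2 / bil r d d) • d) * replicateRow Unit (J r *ᵥ d) := by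
    ext i j
    simp [refl, vecMulVec_apply, Matrix.mul_apply]
    ring
  rw [h, det_one_add_replicateCol_mul_replicateRow, dotProduct_smul, dotProduct_comm]
  change 1 + _ * bil r d d = _
  field_simp
  norm_num

theorem refl_mul_self (r : ℕ) (d : Idx r → ℝ) (hd : bil r d d ≠ 0) : refl r d * refl r d = 1 := by
  apply Matrix.ext_of_mulVec_single
  intro i
  rw [← mulVec_mulVec, one_mulVec]
  simp only [refl_mulVec, bil_sub_right, bil_smul_right]
  rw [sub_sub, ← add_smul, sub_eq_self]
  convert zero_smul ℝ d
  field_simp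
  ring

theorem transpose_J_eq_iff (r : ℕ) (A : Matrix (Idx r) (Idx r) ℝ) :
    Aᵀ * J r * A = J r ↔ ∀ u v, bil r (A *ᵥ u) (A *ᵥ v) = bil r u v := by
  have h (u v : Idx r → ℝ) : bil r (A *ᵥ u) (A *ᵥ v) = u ⬝ᵥ ((Aᵀ * J r * A) *ᵥ v) := by
    rw [bil, ← mulVec_mulVec, ← mulVec_mulVec, dotProduct_mulVec u Aᵀ, vecMul_transpose]
  constructor
  · intro hA u v
    rw [h, hA, bil]
  · intro hA
    ext i j
    have := (h (Pi.single i 1) (Pi.single j 1)).symm.trans (hA _ _)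
    simpa [bil] using this

theorem bil_ρ (r : ℕ) (k : G r) (u v : Idx r → ℝ) :
    bil r (ρ r k *ᵥ u) (ρ r k *ᵥ v) = bil r u v :=
  (transpose_J_eq_iff r _).1 (ρ_adj r k) u v

theorem quad_eq_bil (r : ℕ) (v : Idx r → ℝ) : quad r v = bil r v v := quad_eq r v

-- The Clifford relation du + ud = 2⟨d,u⟩, read as a rule for moving `d` to the right past `u`.
open CliffordAlgebra in
theorem ι_mul_ι_refl (r : ℕ) (d u : Idx r → ℝ) (hd : bil r d d ≠ 0) :
    ι (quad r) d * ι (quad r) u = -(ι (quad r) (refl r d *ᵥ u) * ι (quad r) d) := by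
  have h1 := ι_mul_ι_add_swap (Q := quad r) d u
  have h2 := ι_sq_scalar (quad r) d
  have h3 : QuadraticMap.polar (quad r) d u = 2 * bil r d u := by
    simp only [QuadraticMap.polar, quad_eq_bil, bil_add_left, bil_add_right, bil_comm r u d]
    ring
  rw [h3] at h1
  rw [quad_eq_bil] at h2
  rw [refl_mulVec, map_sub, map_smul, sub_mul, smul_mul_assoc, h2, eq_sub_of_add_eq h1,
    Algebra.smul_def, ← map_mul (algebraMap ℝ _), div_mul_cancel₀ _ hd, neg_sub]

/-! ### Elements of the spin group as products of vectors -/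

/-- The product of the reflections in the vectors of a list. -/
noncomputable def reflProd (r : ℕ) (l : List (Idx r → ℝ)) : Matrix (Idx r) (Idx r) ℝ :=
  (l.map (refl r)).prod

/-- The product of the vectors of a list in the Clifford algebra. -/
noncomputable def vecProd (r : ℕ) (l : List (Idx r → ℝ)) : CliffordAlgebra (quad r) :=
  (l.map (CliffordAlgebra.ι (quad r))).prod

-- Iterating the rule for one vector. For an even number of factors it identifies conjugation by the
-- product with the product of reflections.
open CliffordAlgebra in
theorem vecProd_mul_ι (r : ℕ) (l : List (Idx r → ℝ)) (hl : ∀ d ∈ l, bil r d d ≠ 0)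
    (u : Idx r → ℝ) : vecProd r l * ι (quad r) u =
      (-1 : ℝ) ^ l.length • (ι (quad r) (reflProd r l *ᵥ u) * vecProd r l) := by
  induction l generalizing u with
  | nil => simp [vecProd, reflProd]
  | cons d l ih =>
    have h1 := ih (fun x hx => hl x (List.mem_cons_of_mem _ hx)) u
    have h2 := ι_mul_ι_refl r d (reflProd r l *ᵥ u) (hl d List.mem_cons_self)
    have e : vecProd r (d :: l) = ι (quad r) d * vecProd r l := by simp [vecProd]
    have e' : reflProd r (d :: l) = refl r d * reflProd r l := by simp [reflProd]
    rw [e, e', mul_assoc, h1, mul_smul_comm, ← mul_assoc, h2, ← mulVec_mulVec, List.length_cons,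
      pow_succ, mul_neg_one, neg_smul, neg_mul, smul_neg, mul_assoc]

-- The spinor norm of a product of vectors. For elements of the spin group it is 1, which later
-- fixes the time orientation.
open CliffordAlgebra in
theorem vecProd_mul_star (r : ℕ) (l : List (Idx r → ℝ)) :
    vecProd r l * star (vecProd r l) =
      algebraMap ℝ _ (l.map fun d => -bil r d d).prod := by
  induction l with
  | nil => simp [vecProd]
  | cons d l ih =>
    have e : vecProd r (d :: l) = ι (quad r) d * vecProd r l := by simp [vecProd]
    rw [e, star_mul, mul_assoc, ← mul_assoc (vecProd r l), ih, Algebra.commutes, ← mul_assoc,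
      CliffordAlgebra.star_ι, mul_neg, ι_sq_scalar, quad_eq_bil, ← map_neg, ← map_mul]
    simp

open CliffordAlgebra in
theorem vecProd_mem_evenOdd (r : ℕ) (l : List (Idx r → ℝ)) :
    vecProd r l ∈ evenOdd (quad r) (l.length : ZMod 2) := by
  induction l with
  | nil => simpa [vecProd] using SetLike.GradedOne.one_mem (A := evenOdd (quad r))
  | cons d l ih =>
    have e : vecProd r (d :: l) = ι (quad r) d * vecProd r l := by simp [vecProd]
    rw [e, List.length_cons, Nat.cast_add, Nat.cast_one, add_comm]
    exact SetLike.mul_mem_graded (ι_mem_evenOdd_one _ _) ih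

-- The Lipschitz group is a group closure, so inverses of vectors occur among the generators; the
-- inverse of an anisotropic vector is a multiple of it, so words in vectors suffice.
open CliffordAlgebra in
theorem exists_vecProd_of_mem_lipschitz (r : ℕ) (x : (CliffordAlgebra (quad r))ˣ)
    (hx : x ∈ lipschitzGroup (quad r)) :
    ∃ l : List (Idx r → ℝ), (∀ d ∈ l, bil r d d ≠ 0) ∧ (x : CliffordAlgebra (quad r)) = vecProd r l := by
  have hunit (y : (CliffordAlgebra (quad r))ˣ) (d : Idx r → ℝ) (hd : ι (quad r) d = y) :
      bil r d d ≠ 0 := by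
    intro h0
    have h := ι_sq_scalar (quad r) d
    rw [quad_eq_bil, h0, map_zero, hd, ← Units.val_mul] at h
    exact (y * y).ne_zero h
  rw [lipschitzGroup, ← Subgroup.mem_toSubmonoid, Subgroup.closure_toSubmonoid] at hx
  obtain ⟨l, hl, rfl⟩ := Submonoid.exists_list_of_mem_closure hx
  clear hx
  induction l with
  | nil => exact ⟨[], by simp, by simp [vecProd]⟩
  | cons y l ih =>
    obtain ⟨l', hl', e⟩ := ih fun z hz => hl z (List.mem_cons_of_mem _ hz)
    have key : ∃ d, ι (quad r) d = y := by
      rcases hl y List.mem_cons_self with ⟨d, hd⟩ | ⟨d, hd⟩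
      · exact ⟨d, hd⟩
      · have h0 := hunit _ d hd
        refine ⟨(bil r d d)⁻¹ • d, ?_⟩
        have h := ι_sq_scalar (quad r) d
        rw [quad_eq_bil] at h
        have h1 : ((y⁻¹ : (CliffordAlgebra (quad r))ˣ) : CliffordAlgebra (quad r)) * ι (quad r) ((bil r d d)⁻¹ • d) = 1 := by
          change ι (quad r) d = _ at hd
          rw [← hd, map_smul, mul_smul_comm, h, Algebra.smul_def, ← map_mul, inv_mul_cancel₀ h0, map_one]
        exact (Units.inv_mul_eq_one.1 h1).symm
    obtain ⟨d, hd⟩ := key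
    refine ⟨d :: l', ?_, ?_⟩
    · intro z hz
      rcases List.mem_cons.1 hz with rfl | hz
      · exact hunit _ _ hd
      · exact hl' z hz
    · simp [vecProd, hd, e]

-- The number of factors is even because the even and odd parts of the Clifford algebra meet only in
-- zero; the product of the norms is the spinor norm.
open CliffordAlgebra in
theorem exists_vecProd (r : ℕ) (k : G r) :
    ∃ l : List (Idx r → ℝ), (∀ d ∈ l, bil r d d ≠ 0) ∧ Even l.length ∧
      (l.map fun d => bil r d d).prod = 1 ∧ ρ r k = reflProd r l := by
  obtain ⟨hp, he⟩ := spinGroup.mem_iff.1 k.2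
  obtain ⟨⟨x, hx, hxk⟩, hu⟩ := pinGroup.mem_iff.1 hp
  obtain ⟨l, hl, hxl⟩ := exists_vecProd_of_mem_lipschitz r x hx
  have hkl : (k : CliffordAlgebra (quad r)) = vecProd r l := by rw [← hxl, ← hxk]; rfl
  have hinj : Function.Injective (algebraMap ℝ (CliffordAlgebra (quad r))) :=
    FaithfulSMul.algebraMap_injective _ _
  have hkk : (k : CliffordAlgebra (quad r)) * ((k⁻¹ : G r) :) = 1 :=
    congrArg Subtype.val (mul_inv_cancel k)
  have hk0 : (k : CliffordAlgebra (quad r)) ≠ 0 := by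
    intro h
    rw [h, zero_mul] at hkk
    exact zero_ne_one hkk
  have heven : Even l.length := by
    rw [← ZMod.natCast_eq_zero_iff_even]
    have hm := vecProd_mem_evenOdd r l
    rw [← hkl] at hm
    rcases (by decide : ∀ z : ZMod 2, z = 0 ∨ z = 1) (l.length : ZMod 2) with h | h
    · exact h
    · rw [h] at hm
      exact absurd ((Submodule.disjoint_def.1 (evenOdd_isCompl (Q := quad r)).disjoint) _ he hm) hk0
  refine ⟨l, hl, heven, ?_, ?_⟩
  · have h := vecProd_mul_star r l
    rw [← hkl] at h
    have h1 : (k : CliffordAlgebra (quad r)) * star (k : CliffordAlgebra (quad r)) = 1 :=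
      (Unitary.mem_iff.1 hu).2
    rw [h1, ← map_one (algebraMap ℝ _)] at h
    have h2 := hinj h
    have h3 : ∀ l : List (Idx r → ℝ), (l.map fun d => -bil r d d).prod =
        (-1) ^ l.length * (l.map fun d => bil r d d).prod := by
      intro l
      induction l with
      | nil => simp
      | cons d l ih => simp [ih, pow_succ]; ring
    rw [h3, heven.neg_one_pow, one_mul] at h2
    exact h2.symm
  · apply Matrix.ext_of_mulVec_single
    intro i
    rw [ρ_mulVec]
    apply ι_inj
    rw [ι_vecMap, hkl, vecProd_mul_ι r l hl, heven.neg_one_pow, one_smul, ← hkl, mul_assoc, hkk,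
      mul_one]

/-- Products of two spacelike reflections lift to the spin group. -/
theorem exists_rotor (r : ℕ) (d e : Idx r → ℝ) (hd : 0 < bil r d d) (he : 0 < bil r e e) :
    ∃ k : G r, ρ r k = refl r d * refl r e := by
  classical
  -- A spacelike vector may be normalized without changing its reflection, and a product of two unit
  -- vectors is unitary in the Clifford algebra.
  have hunit (v : Idx r → ℝ) (hv : 0 < bil r v v) :
      bil r ((√(bil r v v))⁻¹ • v) ((√(bil r v v))⁻¹ • v) = 1 ∧
      refl r ((√(bil r v v))⁻¹ • v) = refl r v := by
    have h1 : bil r ((√(bil r v v))⁻¹ • v) ((√(bil r v v))⁻¹ • v) = 1 := by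
      have := Real.mul_self_sqrt hv.le
      have h0 := (Real.sqrt_pos.2 hv).ne'
      simp only [bil_smul_left, bil_smul_right]
      field_simp
      rw [sq, this]
    refine ⟨h1, ?_⟩
    apply Matrix.ext_of_mulVec_single
    intro i
    rw [refl_mulVec, refl_mulVec, h1, bil_smul_left, smul_smul]
    congr 2
    have := Real.mul_self_sqrt hv.le
    have h0 := (Real.sqrt_pos.2 hv).ne'
    field_simp
    rw [sq, this]
    field_simp
  obtain ⟨d1, d2⟩ := hunit d hd
  obtain ⟨e1, e2⟩ := hunit e he
  rw [← d2, ← e2]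
  generalize (√(bil r d d))⁻¹ • d = v at *
  generalize (√(bil r e e))⁻¹ • e = w at *
  have hV : CliffordAlgebra.ι (quad r) v * CliffordAlgebra.ι (quad r) v = 1 := by
    rw [CliffordAlgebra.ι_sq_scalar, quad_eq_bil, d1, map_one]
  have hW : CliffordAlgebra.ι (quad r) w * CliffordAlgebra.ι (quad r) w = 1 := by
    rw [CliffordAlgebra.ι_sq_scalar, quad_eq_bil, e1, map_one]
  have hmem : CliffordAlgebra.ι (quad r) v * CliffordAlgebra.ι (quad r) w ∈ spinGroup (quad r) := by
    refine spinGroup.mem_iff.2 ⟨pinGroup.mem_iff.2 ⟨?_, ?_, ?_⟩, ?_⟩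
    · refine mul_mem ?_ ?_
      · exact ⟨⟨_, _, hV, hV⟩, Subgroup.subset_closure ⟨_, rfl⟩, rfl⟩
      · exact ⟨⟨_, _, hW, hW⟩, Subgroup.subset_closure ⟨_, rfl⟩, rfl⟩
    · rw [star_mul, CliffordAlgebra.star_ι, CliffordAlgebra.star_ι, neg_mul_neg, mul_assoc,
        ← mul_assoc (CliffordAlgebra.ι (quad r) v), hV, one_mul, hW]
    · rw [star_mul, CliffordAlgebra.star_ι, CliffordAlgebra.star_ι, neg_mul_neg, mul_assoc,
        ← mul_assoc (CliffordAlgebra.ι (quad r) w), hW, one_mul, hV]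
    · exact CliffordAlgebra.ι_mul_ι_mem_evenOdd_zero _ _ _
  refine ⟨⟨_, hmem⟩, ?_⟩
  set k : G r := ⟨_, hmem⟩ with hk
  have hkk : (k : CliffordAlgebra (quad r)) * ((k⁻¹ : G r) :) = 1 :=
    congrArg Subtype.val (mul_inv_cancel k)
  have hkl : (k : CliffordAlgebra (quad r)) = vecProd r [v, w] := by simp [hk, vecProd]
  have hR : refl r v * refl r w = reflProd r [v, w] := by simp [reflProd]
  rw [hR]
  apply Matrix.ext_of_mulVec_single
  intro i
  rw [ρ_mulVec]
  apply ι_inj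
  rw [ι_vecMap, hkl, vecProd_mul_ι r _ (by simp [d1, e1])]
  rw [← hkl, List.length_cons, List.length_cons, List.length_nil]
  norm_num
  rw [mul_assoc, hkk, mul_one]

end SpinOrbit

namespace SpinOrbit

/-! ### Time orientation -/

/-- The time coordinate vector. -/
def eT (r : ℕ) : Idx r → ℝ := Pi.single (Sum.inr 1) 1

theorem bil_eT (r : ℕ) (u : Idx r → ℝ) : bil r u (eT r) = -u (Sum.inr 1) := by
  have : (eT r) ∘ Sum.inl = 0 := by ext i; simp [eT]
  rw [bil_apply, this]
  simp [eT]

theorem dotProduct_sq_le {n : Type*} [Fintype n] (u v : n → ℝ) :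
    (u ⬝ᵥ v) ^ 2 ≤ (u ⬝ᵥ u) * (v ⬝ᵥ v) := by
  simpa [dotProduct, sq] using Finset.sum_mul_sq_le_sq_mul_sq Finset.univ u v

theorem dotProduct_self_nonneg' {n : Type*} [Fintype n] (u : n → ℝ) : 0 ≤ u ⬝ᵥ u :=
  Finset.sum_nonneg fun i _ => mul_self_nonneg (u i)

/-- The spatial part of a vector. -/
def spatial (r : ℕ) (u : Idx r → ℝ) : Idx r → ℝ := Function.update u (Sum.inr 1) 0

theorem bil_spatial (r : ℕ) (u v : Idx r → ℝ) :
    bil r u v = spatial r u ⬝ᵥ spatial r v - u (Sum.inr 1) * v (Sum.inr 1) := by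
  have h (w : Idx r → ℝ) : (spatial r w) ∘ Sum.inl = w ∘ Sum.inl := by ext i; simp [spatial]
  have e : spatial r u ⬝ᵥ spatial r v = (u ∘ Sum.inl) ⬝ᵥ (v ∘ Sum.inl) + u (Sum.inr 0) * v (Sum.inr 0) := by
    simp [dotProduct, Fintype.sum_sum_type, spatial]
  rw [bil_apply, e]

/-- The reverse Cauchy-Schwarz inequality for vectors in the future cone. -/
theorem bil_neg_of_future (r : ℕ) (u v : Idx r → ℝ) (hu : bil r u u < 0) (hut : 0 < u (Sum.inr 1))
    (hv : bil r v v ≤ 0) (hvt : 0 < v (Sum.inr 1)) : bil r u v < 0 := by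
  rw [bil_spatial] at *
  have h := dotProduct_sq_le (spatial r u) (spatial r v)
  have h1 := dotProduct_self_nonneg' (spatial r u)
  have h2 := dotProduct_self_nonneg' (spatial r v)
  have h3 : (spatial r u ⬝ᵥ spatial r v) ^ 2 < (u (Sum.inr 1) * v (Sum.inr 1)) ^ 2 := by
    calc _ ≤ _ := h
      _ ≤ (spatial r u ⬝ᵥ spatial r u) * (v (Sum.inr 1) * v (Sum.inr 1)) :=
        mul_le_mul_of_nonneg_left (by linarith) h1
      _ < (u (Sum.inr 1) * u (Sum.inr 1)) * (v (Sum.inr 1) * v (Sum.inr 1)) :=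
        mul_lt_mul_of_pos_right (by linarith) (by positivity)
      _ = _ := by ring
  have := abs_lt_of_sq_lt_sq h3 (by positivity)
  linarith [le_abs_self (spatial r u ⬝ᵥ spatial r v), this]

/-- A vector orthogonal to a timelike vector is spacelike. -/
theorem bil_pos_of_orthogonal (r : ℕ) (u v : Idx r → ℝ) (hu : bil r u u < 0)
    (huv : bil r u v = 0) (hv : v ≠ 0) : 0 < bil r v v := by
  rw [bil_spatial] at *
  have h := dotProduct_sq_le (spatial r u) (spatial r v)
  have h1 := dotProduct_self_nonneg' (spatial r u)
  have h2 := dotProduct_self_nonneg' (spatial r v)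
  rw [sub_eq_zero.1 huv] at h
  by_contra hc
  have h3 : spatial r v ⬝ᵥ spatial r v ≤ v (Sum.inr 1) * v (Sum.inr 1) := by linarith
  have h4 : v (Sum.inr 1) = 0 := by
    by_contra h0
    have hp : 0 < v (Sum.inr 1) * v (Sum.inr 1) := mul_self_pos.2 h0
    have : (spatial r u ⬝ᵥ spatial r u) * (spatial r v ⬝ᵥ spatial r v) <
        (u (Sum.inr 1) * u (Sum.inr 1)) * (v (Sum.inr 1) * v (Sum.inr 1)) :=
      lt_of_le_of_lt (mul_le_mul_of_nonneg_left h3 h1) (mul_lt_mul_of_pos_right (by linarith) hp)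
    linarith
  rw [h4, mul_zero] at h3
  have h5 : spatial r v = 0 := dotProduct_self_eq_zero.1 (le_antisymm h3 h2)
  apply hv
  ext i
  by_cases hi : i = Sum.inr 1
  · rw [hi, h4]; rfl
  · have := congrFun h5 i
    simpa [spatial, hi] using this

/-- The matrices of `SO_e(m+1,1)`. -/
structure IsLor (r : ℕ) (A : Matrix (Idx r) (Idx r) ℝ) : Prop where
  adj : Aᵀ * J r * A = J r
  det : A.det = 1
  pos : 0 < A (Sum.inr 1) (Sum.inr 1)

theorem IsLor.bil {r : ℕ} {A : Matrix (Idx r) (Idx r) ℝ} (h : IsLor r A) (u v : Idx r → ℝ) :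
    bil r (A *ᵥ u) (A *ᵥ v) = bil r u v := (transpose_J_eq_iff r A).1 h.adj u v

theorem mulVec_eT (r : ℕ) (A : Matrix (Idx r) (Idx r) ℝ) (i : Idx r) :
    (A *ᵥ eT r) i = A i (Sum.inr 1) := by
  simp [eT]

theorem J_mul_J (r : ℕ) : J r * J r = 1 := by
  rw [J, diagonal_mul_diagonal, ← diagonal_one]
  congr 1
  ext i
  rcases i with i | i
  · simp [sign]
  · fin_cases i <;> simp [sign]

theorem apply_eT (r : ℕ) (A : Matrix (Idx r) (Idx r) ℝ) :
    A (Sum.inr 1) (Sum.inr 1) = -bil r (A *ᵥ eT r) (eT r) := by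
  rw [bil_eT, mulVec_eT, neg_neg]

theorem bil_eT_eT (r : ℕ) : bil r (eT r) (eT r) = -1 := by
  rw [bil_eT]; simp [eT]

/-- The image of the time vector still has norm −1, so its time coordinate has absolute value at
least 1. -/
theorem one_le_sq_apply (r : ℕ) (A : Matrix (Idx r) (Idx r) ℝ) (hA : Aᵀ * J r * A = J r) :
    1 ≤ A (Sum.inr 1) (Sum.inr 1) ^ 2 := by
  have h := (transpose_J_eq_iff r A).1 hA (eT r) (eT r)
  rw [bil_eT_eT, bil_spatial, mulVec_eT] at h
  nlinarith [dotProduct_self_nonneg' (spatial r (A *ᵥ eT r))]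

theorem transpose_J_mul (r : ℕ) (A B : Matrix (Idx r) (Idx r) ℝ) (hA : Aᵀ * J r * A = J r)
    (hB : Bᵀ * J r * B = J r) : (A * B)ᵀ * J r * (A * B) = J r := by
  rw [transpose_J_eq_iff] at *
  intro u v
  rw [← mulVec_mulVec, ← mulVec_mulVec, hA, hB]

/-- The sign of the time-time entry is multiplicative. -/
theorem mul_apply_pos (r : ℕ) (A B : Matrix (Idx r) (Idx r) ℝ) (hA : Aᵀ * J r * A = J r)
    (hB : Bᵀ * J r * B = J r) :
    0 < (A * B) (Sum.inr 1) (Sum.inr 1) * (A (Sum.inr 1) (Sum.inr 1) * B (Sum.inr 1) (Sum.inr 1)) := by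
  set C := J r * Aᵀ * J r with hC
  have hCA : C * A = 1 := by rw [hC, Matrix.mul_assoc, Matrix.mul_assoc, ← Matrix.mul_assoc Aᵀ, hA, J_mul_J]
  have hAC : A * C = 1 := mul_eq_one_comm.1 hCA
  have hb := (transpose_J_eq_iff r A).1 hA
  have hAB : (A * B) (Sum.inr 1) (Sum.inr 1) = -bil r (C *ᵥ eT r) (B *ᵥ eT r) := by
    rw [apply_eT r (A * B), ← hb (C *ᵥ eT r), mulVec_mulVec, mulVec_mulVec, hAC, one_mulVec, bil_comm]
  have hCt : C (Sum.inr 1) (Sum.inr 1) = A (Sum.inr 1) (Sum.inr 1) := by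
    rw [apply_eT r C, apply_eT r A, ← hb (C *ᵥ eT r), mulVec_mulVec, hAC, one_mulVec, bil_comm]
  have hCC : bil r (C *ᵥ eT r) (C *ᵥ eT r) = -1 := by
    rw [← hb, mulVec_mulVec, hAC, one_mulVec, bil_eT_eT]
  have hBB : bil r (B *ᵥ eT r) (B *ᵥ eT r) = -1 := by
    rw [(transpose_J_eq_iff r B).1 hB, bil_eT_eT]
  have ha := one_le_sq_apply r A hA
  have hb' := one_le_sq_apply r B hB
  set a := A (Sum.inr 1) (Sum.inr 1) with ha'
  set b := B (Sum.inr 1) (Sum.inr 1) with hb''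
  -- Scaling by the time entries `a` and `b` puts both vectors in the future cone whatever the signs
  -- are; C = JAᵗJ is the inverse of A.
  have h := bil_neg_of_future r (a • (C *ᵥ eT r)) (b • (B *ᵥ eT r))
    (by simp only [bil_smul_left, bil_smul_right, hCC]; nlinarith)
    (by rw [Pi.smul_apply, mulVec_eT, hCt, smul_eq_mul]; nlinarith)
    (by simp only [bil_smul_left, bil_smul_right, hBB]; nlinarith)
    (by rw [Pi.smul_apply, mulVec_eT, smul_eq_mul]; nlinarith)
  rw [bil_smul_left, bil_smul_right] at h
  rw [hAB]
  linarith

theorem IsLor.mul {r : ℕ} {A B : Matrix (Idx r) (Idx r) ℝ} (hA : IsLor r A) (hB : IsLor r B) :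
    IsLor r (A * B) := by
  refine ⟨transpose_J_mul r A B hA.adj hB.adj, by rw [det_mul, hA.det, hB.det, one_mul], ?_⟩
  have := mul_apply_pos r A B hA.adj hB.adj
  exact pos_of_mul_pos_left this (mul_pos hA.pos hB.pos).le

theorem refl_adj (r : ℕ) (d : Idx r → ℝ) (hd : bil r d d ≠ 0) :
    (refl r d)ᵀ * J r * refl r d = J r :=
  (transpose_J_eq_iff r _).2 fun u v => bil_refl r d u v hd

/-- Spacelike reflections preserve the time orientation and timelike ones reverse it. -/
theorem refl_apply_pos (r : ℕ) (d : Idx r → ℝ) (hd : bil r d d ≠ 0) :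
    0 < refl r d (Sum.inr 1) (Sum.inr 1) * bil r d d := by
  have h : refl r d (Sum.inr 1) (Sum.inr 1) * bil r d d = bil r d d + 2 * d (Sum.inr 1) ^ 2 := by
    rw [apply_eT r (refl r d), refl_mulVec, bil_sub_left, bil_eT_eT, bil_smul_left, bil_eT]
    field_simp
    ring
  rw [h]
  have h2 : bil r d d + d (Sum.inr 1) ^ 2 = spatial r d ⬝ᵥ spatial r d := by rw [bil_spatial]; ring
  have h1 := dotProduct_self_nonneg' (spatial r d)
  by_cases h0 : d (Sum.inr 1) = 0
  · rw [h0] at h2 ⊢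
    have : 0 ≤ bil r d d := by linarith
    simpa using lt_of_le_of_ne this hd.symm
  · have : 0 < d (Sum.inr 1) ^ 2 := by positivity
    linarith

theorem reflProd_props (r : ℕ) (l : List (Idx r → ℝ)) (hl : ∀ d ∈ l, bil r d d ≠ 0) :
    (reflProd r l)ᵀ * J r * reflProd r l = J r ∧ (reflProd r l).det = (-1) ^ l.length ∧
      0 < reflProd r l (Sum.inr 1) (Sum.inr 1) * (l.map fun d => bil r d d).prod := by
  induction l with
  | nil => simp [reflProd]
  | cons d l ih =>
    obtain ⟨h1, h2, h3⟩ := ih fun x hx => hl x (List.mem_cons_of_mem _ hx)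
    have hd := hl d List.mem_cons_self
    have e' : reflProd r (d :: l) = refl r d * reflProd r l := by simp [reflProd]
    rw [e']
    refine ⟨transpose_J_mul r _ _ (refl_adj r d hd) h1, ?_, ?_⟩
    · rw [det_mul, det_refl r d hd, h2, List.length_cons, pow_succ']
    · have h4 := mul_apply_pos r _ _ (refl_adj r d hd) h1
      have h5 := refl_apply_pos r d hd
      rw [List.map_cons, List.prod_cons]
      have h6 := mul_pos (mul_pos h4 h5) h3
      refine pos_of_mul_pos_left (b := (refl r d (Sum.inr 1) (Sum.inr 1) * reflProd r l (Sum.inr 1) (Sum.inr 1)) ^ 2) ?_ (sq_nonneg _)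
      linarith

/-- An even number of reflections gives determinant 1, and spinor norm 1 means that an even number
of them are timelike. -/
theorem isLor_ρ (r : ℕ) (k : G r) : IsLor r (ρ r k) := by
  obtain ⟨l, hl, he, hp, h⟩ := exists_vecProd r k
  obtain ⟨h1, h2, h3⟩ := reflProd_props r l hl
  rw [hp, mul_one] at h3
  rw [h]
  exact ⟨h1, by rw [h2, he.neg_one_pow], h3⟩

end SpinOrbit

namespace SpinOrbit

/-! ### The decomposition `MAN` -/

theorem nMat_mulVec (r : ℕ) (α : Coord r → ℝ) (u : Idx r → ℝ) :
    nMat r α *ᵥ u = Sum.elim ((u ∘ Sum.inl) + (u (Sum.inr 1) - u (Sum.inr 0)) • α) 0 +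
      (α ⬝ᵥ (u ∘ Sum.inl) + (α ⬝ᵥ α) / 2 * (u (Sum.inr 1) - u (Sum.inr 0))) • v₀ r +
      Sum.elim (0 : Coord r → ℝ) (u ∘ Sum.inr) := by
  have hu : u = Sum.elim (u ∘ Sum.inl) (u ∘ Sum.inr) := (Sum.elim_comp_inl_inr u).symm
  rw [nMat, fromBlocks_mulVec]
  ext i
  rcases i with i | i
  · simp [mulVec, dotProduct, v₀]; ring
  · fin_cases i <;> simp [mulVec, dotProduct, v₀] <;> ring

theorem mMat_mulVec (r : ℕ) (W : Matrix (Coord r) (Coord r) ℝ) (u : Idx r → ℝ) :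
    mMat r W *ᵥ u = Sum.elim (W *ᵥ (u ∘ Sum.inl)) (u ∘ Sum.inr) := by
  rw [mMat, fromBlocks_mulVec]
  simp

theorem nMat_mulVec_inl (r : ℕ) (α y : Coord r → ℝ) :
    nMat r α *ᵥ Sum.elim y 0 = Sum.elim y 0 + (α ⬝ᵥ y) • v₀ r := by
  rw [nMat_mulVec]
  ext i
  rcases i with i | i <;> simp [v₀]

theorem nMat_mulVec_v₀ (r : ℕ) (α : Coord r → ℝ) : nMat r α *ᵥ v₀ r = v₀ r := by
  rw [nMat_mulVec]
  ext i
  rcases i with i | i <;> simp [v₀]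

theorem aMat_mulVec_v₀ (r : ℕ) (s : ℝ) : aMat r s *ᵥ v₀ r = Real.exp s • v₀ r := by
  rw [aMat, v₀, fromBlocks_mulVec]
  ext i
  rcases i with i | i
  · simp
  · fin_cases i <;> simp [mulVec, dotProduct, Real.cosh_eq, Real.sinh_eq] <;> ring

theorem aMat_mulVec_inl (r : ℕ) (s : ℝ) (y : Coord r → ℝ) :
    aMat r s *ᵥ Sum.elim y 0 = Sum.elim y 0 := by
  rw [aMat, fromBlocks_mulVec]
  ext i
  rcases i with i | i <;> simp

theorem mMat_mulVec_inl (r : ℕ) (W : Matrix (Coord r) (Coord r) ℝ) (y : Coord r → ℝ) :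
    mMat r W *ᵥ Sum.elim y 0 = Sum.elim (W *ᵥ y) 0 := by
  rw [mMat_mulVec]; simp

theorem mMat_mulVec_v₀ (r : ℕ) (W : Matrix (Coord r) (Coord r) ℝ) :
    mMat r W *ᵥ v₀ r = v₀ r := by
  rw [mMat_mulVec]; simp [v₀]

theorem bil_v₀ (r : ℕ) (u : Idx r → ℝ) : bil r u (v₀ r) = u (Sum.inr 0) - u (Sum.inr 1) := by
  rw [bil_apply]
  have : v₀ r ∘ Sum.inl = 0 := by ext i; simp [v₀]
  rw [this]
  simp [v₀]

theorem bil_inl (r : ℕ) (u : Idx r → ℝ) (y : Coord r → ℝ) :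
    bil r u (Sum.elim y 0) = (u ∘ Sum.inl) ⬝ᵥ y := by
  rw [bil_apply]
  simp

theorem nMat_adj (r : ℕ) (α : Coord r → ℝ) : (nMat r α)ᵀ * J r * nMat r α = J r := by
  rw [transpose_J_eq_iff]
  intro u v
  rw [bil_apply, bil_apply, nMat_mulVec, nMat_mulVec]
  have e (w : Idx r → ℝ) (c d : ℝ) : (Sum.elim (w ∘ Sum.inl + c • α) 0 + d • v₀ r +
      Sum.elim (0 : Coord r → ℝ) (w ∘ Sum.inr)) ∘ Sum.inl = w ∘ Sum.inl + c • α := by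
    ext i; simp [v₀]
  rw [e, e]
  simp [v₀, dotProduct_comm _ α]
  ring

theorem aMat_adj (r : ℕ) (s : ℝ) : (aMat r s)ᵀ * J r * aMat r s = J r := by
  rw [transpose_J_eq_iff]
  intro u v
  have e (w : Idx r → ℝ) : (aMat r s *ᵥ w) ∘ Sum.inl = w ∘ Sum.inl := by
    rw [aMat, fromBlocks_mulVec]; simp
  have e0 (w : Idx r → ℝ) : (aMat r s *ᵥ w) (Sum.inr 0) =
      Real.cosh s * w (Sum.inr 0) + Real.sinh s * w (Sum.inr 1) := by
    rw [aMat, fromBlocks_mulVec]; simp [mulVec, dotProduct]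
  have e1 (w : Idx r → ℝ) : (aMat r s *ᵥ w) (Sum.inr 1) =
      Real.sinh s * w (Sum.inr 0) + Real.cosh s * w (Sum.inr 1) := by
    rw [aMat, fromBlocks_mulVec]; simp [mulVec, dotProduct]
  rw [bil_apply, bil_apply, e, e, e0, e0, e1, e1]
  linear_combination (u (Sum.inr 0) * v (Sum.inr 0) - u (Sum.inr 1) * v (Sum.inr 1)) * Real.cosh_sq_sub_sinh_sq s

theorem mMat_adj (r : ℕ) (W : Matrix (Coord r) (Coord r) ℝ) (hW : Wᵀ * W = 1) :
    (mMat r W)ᵀ * J r * mMat r W = J r := by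
  rw [transpose_J_eq_iff]
  intro u v
  rw [bil_apply, bil_apply, mMat_mulVec, mMat_mulVec]
  simp only [Sum.elim_comp_inl, Sum.elim_inr, Function.comp]
  rw [dotProduct_mulVec, vecMul_mulVec, hW, vecMul_one]

theorem det_nMat (r : ℕ) (α : Coord r → ℝ) : (nMat r α).det = 1 := by
  have hv0 : (α ᵥ* of fun i => ![-α i, α i]) 0 = -(α ⬝ᵥ α) := by simp [vecMul, dotProduct]
  have hv1 : (α ᵥ* of fun i => ![-α i, α i]) 1 = α ⬝ᵥ α := by simp [vecMul, dotProduct]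
  rw [nMat, det_fromBlocks_one₁₁, det_fin_two]
  simp [hv0, hv1]
  ring

theorem det_aMat (r : ℕ) (s : ℝ) : (aMat r s).det = 1 := by
  rw [aMat, det_fromBlocks_zero₁₂, det_fin_two, det_one]
  simp
  linear_combination Real.cosh_sq_sub_sinh_sq s

theorem det_mMat (r : ℕ) (W : Matrix (Coord r) (Coord r) ℝ) : (mMat r W).det = W.det := by
  rw [mMat, det_fromBlocks_zero₁₂, det_one, mul_one]

/-- The hyperplane orthogonal to v₀ is fixed pointwise; the image of the time vector is then forced
by its products with this hyperplane and its own norm. -/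
theorem eq_one_of_fix (r : ℕ) (A : Matrix (Idx r) (Idx r) ℝ) (hA : Aᵀ * J r * A = J r)
    (h0 : A *ᵥ v₀ r = v₀ r) (hy : ∀ y, A *ᵥ Sum.elim y 0 = Sum.elim y 0) : A = 1 := by
  have hb := (transpose_J_eq_iff r A).1 hA
  have hT : A *ᵥ eT r = eT r := by
    have h1 : (A *ᵥ eT r) ∘ Sum.inl = 0 := by
      rw [← dotProduct_self_eq_zero, ← bil_inl]
      conv_lhs => rw [← hy]
      rw [hb, bil_inl]
      have : eT r ∘ Sum.inl = 0 := by ext i; simp [eT]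
      rw [this, zero_dotProduct]
    have h2 := hb (eT r) (v₀ r)
    rw [h0, bil_v₀, bil_v₀] at h2
    have h3 := hb (eT r) (eT r)
    rw [bil_apply, h1, bil_eT_eT] at h3
    simp only [dotProduct_zero, zero_add] at h3
    have h2' : (A *ᵥ eT r) (Sum.inr 0) - (A *ᵥ eT r) (Sum.inr 1) = -1 := by rw [h2]; simp [eT]
    clear h2
    generalize (A *ᵥ eT r) = w at *
    have h4 : w (Sum.inr 0) = w (Sum.inr 1) - 1 := by linarith
    rw [h4] at h3
    have h5 : w (Sum.inr 1) = 1 := by linarith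
    rw [h5] at h4
    ext i
    rcases i with i | i
    · have := congrFun h1 i
      simpa [eT] using this
    · fin_cases i
      · simpa [eT] using h4
      · simpa [eT] using h5
  apply Matrix.ext_of_mulVec_single
  intro i
  rw [one_mulVec]
  rcases i with i | i
  · have : (Pi.single (Sum.inl i) 1 : Idx r → ℝ) = Sum.elim (Pi.single i 1) 0 := by
      ext j; rcases j with j | j <;> simp [Pi.single_apply]
    rw [this, hy]
  · fin_cases i
    · have : (Pi.single (Sum.inr 0) 1 : Idx r → ℝ) = v₀ r - eT r := by
        ext j
        rcases j with j | j
        · simp [v₀, eT]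
        · fin_cases j <;> simp [v₀, eT]
      change A *ᵥ Pi.single (Sum.inr 0) 1 = Pi.single (Sum.inr 0) 1
      rw [this, mulVec_sub, h0, hT]
    · exact hT

theorem transpose_J_nMat_mul (r : ℕ) (A : Matrix (Idx r) (Idx r) ℝ) (γ : Coord r → ℝ)
    (hA : Aᵀ * J r * A = J r) (h0 : A *ᵥ v₀ r = v₀ r)
    (hy : ∀ y, A *ᵥ Sum.elim y 0 = Sum.elim y 0 + (γ ⬝ᵥ y) • v₀ r) : A = nMat r γ := by
  have h1 : A * nMat r (-γ) = 1 := by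
    apply eq_one_of_fix r _ (transpose_J_mul r _ _ hA (nMat_adj r _))
    · rw [← mulVec_mulVec, nMat_mulVec_v₀, h0]
    · intro y
      rw [← mulVec_mulVec, nMat_mulVec_inl, mulVec_add, hy, mulVec_smul, h0]
      simp
  calc A = A * (nMat r (-γ) * nMat r γ) := by rw [nMat_mul, neg_add_cancel, nMat_zero, Matrix.mul_one]
    _ = _ := by rw [← Matrix.mul_assoc, h1, Matrix.one_mul]

/-- After removal of the dilation, v₀ is fixed. Its orthogonal complement, the first m coordinates
plus ℝv₀, is preserved, with an orthogonal action W modulo v₀; what remains is unipotent and lies in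
N. -/
theorem exists_man (r : ℕ) (A : Matrix (Idx r) (Idx r) ℝ) (hA : Aᵀ * J r * A = J r)
    (hdet : A.det = 1) (t : ℝ) (ht : 0 < t) (h0 : A *ᵥ v₀ r = t • v₀ r) :
    ∃ W ∈ specialOrthogonalGroup (Coord r) ℝ, ∃ α,
      A = mMat r W * aMat r (Real.log t) * nMat r α := by
  set B := aMat r (-Real.log t) * A with hB
  have hAB : A = aMat r (Real.log t) * B := by
    rw [hB, ← Matrix.mul_assoc, aMat_mul, add_neg_cancel, aMat_zero, Matrix.one_mul]
  have hBadj : Bᵀ * J r * B = J r := transpose_J_mul r _ _ (aMat_adj r _) hA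
  have hb := (transpose_J_eq_iff r B).1 hBadj
  have hB0 : B *ᵥ v₀ r = v₀ r := by
    rw [hB, ← mulVec_mulVec, h0, mulVec_smul, aMat_mulVec_v₀, smul_smul, Real.exp_neg,
      Real.exp_log ht, mul_inv_cancel₀ ht.ne', one_smul]
  set W := B.toBlocks₁₁ with hW
  set γ : Coord r → ℝ := fun i => B (Sum.inr 0) (Sum.inl i) with hγ
  have hBy (y : Coord r → ℝ) : B *ᵥ Sum.elim y 0 = Sum.elim (W *ᵥ y) 0 + (γ ⬝ᵥ y) • v₀ r := by
    have h := hb (Sum.elim y 0) (v₀ r)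
    rw [hB0, bil_v₀, bil_v₀] at h
    simp at h
    have e0 : (B *ᵥ Sum.elim y 0) (Sum.inr 0) = γ ⬝ᵥ y := by
      simp [mulVec, dotProduct, Fintype.sum_sum_type, hγ]
    ext i
    rcases i with i | i
    · simp [mulVec, dotProduct, Fintype.sum_sum_type, v₀, hW, toBlocks₁₁]
    · fin_cases i
      · simpa [v₀] using e0
      · simp [v₀]; rw [← e0]; linarith
  have key (z y : Coord r → ℝ) : (W *ᵥ z) ⬝ᵥ (W *ᵥ y) = z ⬝ᵥ y := by
    have h := hb (Sum.elim z 0) (Sum.elim y 0)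
    rw [hBy, hBy, bil_add_left, bil_add_right, bil_add_right, bil_smul_left, bil_smul_right,
      bil_smul_right, bil_v₀, bil_inl, bil_smul_left, bil_comm r (v₀ r), bil_v₀, bil_v₀, bil_inl] at h
    simpa [v₀] using h
  have hWW : Wᵀ * W = 1 := by
    apply Matrix.ext_of_mulVec_single
    intro i
    apply dotProduct_eq
    intro y
    rw [← mulVec_mulVec, mulVec_transpose, ← dotProduct_mulVec, one_mulVec, key]
  have hWW' : W * Wᵀ = 1 := mul_eq_one_comm.1 hWW
  have hN : mMat r Wᵀ * B = nMat r γ := by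
    apply transpose_J_nMat_mul
    · exact transpose_J_mul r _ _ (mMat_adj r _ (by rw [transpose_transpose, hWW'])) hBadj
    · rw [← mulVec_mulVec, hB0, mMat_mulVec_v₀]
    · intro y
      rw [← mulVec_mulVec, hBy, mulVec_add, mMat_mulVec_inl, mulVec_mulVec, hWW, one_mulVec,
        mulVec_smul, mMat_mulVec_v₀]
  have hBf : B = mMat r W * nMat r γ := by
    rw [← hN, ← Matrix.mul_assoc, mMat_mul, hWW', mMat_one, Matrix.one_mul]
  have hAf : A = mMat r W * aMat r (Real.log t) * nMat r γ := by
    rw [hAB, hBf, ← Matrix.mul_assoc, mMat_aMat]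
  refine ⟨W, ?_, γ, hAf⟩
  rw [mem_specialOrthogonalGroup_iff]
  refine ⟨(mem_orthogonalGroup_iff' _ _).2 hWW, ?_⟩
  rw [hAf, det_mul, det_mul, det_mMat, det_aMat, det_nMat, mul_one, mul_one] at hdet
  exact hdet

/-- The time coordinate of Au is −⟨u, A⁻¹e⟩ for the time vector e, and A⁻¹e is a future timelike
vector. -/
theorem ray_pos {r : ℕ} {A : Matrix (Idx r) (Idx r) ℝ} (hA : IsLor r A) (u : Idx r → ℝ)
    (hu : bil r u u ≤ 0) (hut : 0 < u (Sum.inr 1)) : 0 < (A *ᵥ u) (Sum.inr 1) := by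
  set C := J r * Aᵀ * J r with hC
  have hCA : C * A = 1 := by
    rw [hC, Matrix.mul_assoc, Matrix.mul_assoc, ← Matrix.mul_assoc Aᵀ, hA.adj, J_mul_J]
  have hAC : A * C = 1 := mul_eq_one_comm.1 hCA
  have hCt : C (Sum.inr 1) (Sum.inr 1) = A (Sum.inr 1) (Sum.inr 1) := by
    rw [apply_eT r C, apply_eT r A, ← hA.bil (C *ᵥ eT r), mulVec_mulVec, hAC, one_mulVec, bil_comm]
  have h := bil_neg_of_future r (C *ᵥ eT r) u
    (by rw [← hA.bil, mulVec_mulVec, hAC, one_mulVec, bil_eT_eT]; norm_num)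
    (by rw [mulVec_eT, hCt]; exact hA.pos) hu hut
  rw [← hA.bil, mulVec_mulVec, hAC, one_mulVec, bil_comm, bil_eT] at h
  linarith

theorem bil_v₀_v₀ (r : ℕ) : bil r (v₀ r) (v₀ r) = 0 := by rw [bil_v₀]; simp [v₀]

/-- The converse of `ρ_P_v₀`: the stabilizer of the isotropic line is all of P. Every later
membership in P is checked in this way. -/
theorem mem_P_of_ray (r : ℕ) (k : G r) (t : ℝ) (h : ρ r k *ᵥ v₀ r = t • v₀ r) : k ∈ P r := by
  have hL := isLor_ρ r k
  have ht : 0 < t := by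
    have := ray_pos hL (v₀ r) (bil_v₀_v₀ r).le (by simp [v₀])
    rw [h] at this
    simpa [v₀] using this
  obtain ⟨W, hW, α, e⟩ := exists_man r _ hL.adj hL.det t ht h
  exact ⟨W, hW, _, α, e⟩

end SpinOrbit

namespace SpinOrbit

/-! ### Lifting `SO_e(m+1,1)` to the spin group -/

/-- Consecutive reflections are paired into rotors. -/
theorem exists_lift_reflProd (r : ℕ) : ∀ l : List (Idx r → ℝ), (∀ d ∈ l, 0 < bil r d d) →
    Even l.length → ∃ k : G r, ρ r k = reflProd r l
  | [], _, _ => ⟨1, by simp [reflProd]⟩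
  | [_], _, h => by simp at h
  | d :: e :: l, hl, h => by
    obtain ⟨k, hk⟩ := exists_lift_reflProd r l
      (fun x hx => hl x (List.mem_cons_of_mem _ (List.mem_cons_of_mem _ hx)))
      (by
        rw [List.length_cons, List.length_cons] at h
        rw [Nat.even_iff] at h ⊢
        omega)
    obtain ⟨k', hk'⟩ := exists_rotor r d e (hl d (by simp)) (hl e (by simp))
    exact ⟨k' * k, by rw [map_mul, hk, hk']; simp [reflProd, Matrix.mul_assoc]⟩

theorem reflection_orthogonal_singleton_apply {E : Type*} [NormedAddCommGroup E]
    [InnerProductSpace ℝ E] (v w : E) :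
    (Submodule.span ℝ {v})ᗮ.reflection w = w - (2 * inner ℝ v w / ‖v‖ ^ 2) • v := by
  rw [Submodule.reflection_orthogonal_apply, Submodule.reflection_singleton_apply, neg_sub,
    ← Nat.cast_smul_eq_nsmul ℝ, smul_smul, mul_div_assoc]
  simp

/-- Transfers a Euclidean product of reflections to the Lorentz space. Zero vectors, whose
reflection is trivial, are dropped since `refl` needs an anisotropic vector. -/
theorem exists_reflections (r : ℕ) (l : List (EuclideanSpace ℝ (Coord r))) :
    ∃ l' : List (Idx r → ℝ), (∀ d ∈ l', 0 < bil r d d) ∧ ∀ u : Idx r → ℝ,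
      reflProd r l' *ᵥ u = Sum.elim
        (((l.map fun v => (Submodule.span ℝ {v})ᗮ.reflection).prod (WithLp.toLp 2 (u ∘ Sum.inl))).ofLp)
        (u ∘ Sum.inr) := by
  induction l with
  | nil => exact ⟨[], by simp, fun u => by simp [reflProd]⟩
  | cons v l ih =>
    obtain ⟨l', h1, h2⟩ := ih
    by_cases hv : v = 0
    · refine ⟨l', h1, fun u => ?_⟩
      rw [h2, List.map_cons, List.prod_cons, show ∀ (f g : EuclideanSpace ℝ (Coord r) ≃ₗᵢ[ℝ] EuclideanSpace ℝ (Coord r)) x, (f * g) x = f (g x) from fun _ _ _ => rfl,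
        reflection_orthogonal_singleton_apply, hv, smul_zero, sub_zero]
    · have hn : bil r (Sum.elim v.ofLp 0) (Sum.elim v.ofLp 0) = ‖v‖ ^ 2 := by
        rw [bil_inl, EuclideanSpace.norm_sq_eq, Sum.elim_comp_inl]
        simp [dotProduct, sq]
      refine ⟨Sum.elim v.ofLp 0 :: l', ?_, fun u => ?_⟩
      · intro d hd
        rcases List.mem_cons.1 hd with rfl | hd
        · rw [hn]
          have := norm_pos_iff.2 hv
          positivity
        · exact h1 d hd
      · have e : reflProd r (Sum.elim v.ofLp 0 :: l') = refl r (Sum.elim v.ofLp 0) * reflProd r l' := by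
          simp [reflProd]
        rw [e, ← mulVec_mulVec, h2, refl_mulVec, List.map_cons, List.prod_cons, hn]
        generalize hw : (l.map fun v => (Submodule.span ℝ {v})ᗮ.reflection).prod (WithLp.toLp 2 (u ∘ Sum.inl)) = w
        have hb : bil r (Sum.elim v.ofLp 0) (Sum.elim w.ofLp (u ∘ Sum.inr)) = inner ℝ v w := by
          rw [bil_comm, bil_inl, Sum.elim_comp_inl]
          simp [dotProduct, PiLp.inner_apply, mul_comm]
        rw [hb]
        generalize hw' : ((Submodule.span ℝ {v})ᗮ.reflection *
          (l.map fun v => (Submodule.span ℝ {v})ᗮ.reflection).prod) (WithLp.toLp 2 (u ∘ Sum.inl)) = w'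
        rw [show ∀ (f g : EuclideanSpace ℝ (Coord r) ≃ₗᵢ[ℝ] EuclideanSpace ℝ (Coord r)) x, (f * g) x = f (g x) from fun _ _ _ => rfl, hw, reflection_orthogonal_singleton_apply] at hw'
        rw [← hw']
        ext i
        rcases i with i | i
        · simp
        · simp

/-- Cartan–Dieudonné writes W as a product of Euclidean reflections; determinant 1 makes their
number even. -/
theorem exists_lift_mMat (r : ℕ) (W : Matrix (Coord r) (Coord r) ℝ)
    (hW : W ∈ specialOrthogonalGroup (Coord r) ℝ) : ∃ k : G r, ρ r k = mMat r W := by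
  rw [mem_specialOrthogonalGroup_iff] at hW
  have hO : Wᵀ * W = 1 := (mem_orthogonalGroup_iff' _ _).1 hW.1
  let f : EuclideanSpace ℝ (Coord r) →ₗᵢ[ℝ] EuclideanSpace ℝ (Coord r) :=
    ⟨toEuclideanLin W, fun v => by
      rw [EuclideanSpace.norm_eq, EuclideanSpace.norm_eq]
      congr 1
      have h : (W *ᵥ v.ofLp) ⬝ᵥ (W *ᵥ v.ofLp) = v.ofLp ⬝ᵥ v.ofLp := by
        rw [dotProduct_mulVec, vecMul_mulVec, hO, vecMul_one]
      simpa [dotProduct, sq] using h⟩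
  obtain ⟨l, -, hl⟩ := (f.toLinearIsometryEquiv rfl).reflections_generate_dim
  obtain ⟨l', h1, h2⟩ := exists_reflections r l
  have he : reflProd r l' = mMat r W := by
    apply Matrix.ext_of_mulVec_single
    intro i
    rw [h2, ← hl, mMat_mulVec]
    rfl
  obtain ⟨-, h3, -⟩ := reflProd_props r l' fun d hd => (h1 d hd).ne'
  rw [he, det_mMat, hW.2] at h3
  rw [← he]
  refine exists_lift_reflProd r l' h1 ?_
  by_contra hodd
  rw [Nat.not_even_iff_odd] at hodd
  rw [hodd.neg_one_pow] at h3
  norm_num at h3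

/-- A boost of rapidity s is the product of two reflections whose axes are at rapidity s/2, hence
the half arguments. -/
theorem exists_lift_aMat (r : ℕ) (s : ℝ) : ∃ k : G r, ρ r k = aMat r s := by
  set d : Idx r → ℝ := Sum.elim 0 ![1, 0] with hd
  set e : Idx r → ℝ := Sum.elim 0 ![Real.cosh (s / 2), Real.sinh (s / 2)] with he
  have hcs := Real.cosh_sq_sub_sinh_sq (s / 2)
  have b1 : bil r d d = 1 := by
    rw [bil_apply]
    simp [hd]
  have b2 : bil r e e = 1 := by
    rw [bil_apply]
    simp [he]
    linarith
  obtain ⟨k, hk⟩ := exists_rotor r e d (by rw [b2]; norm_num) (by rw [b1]; norm_num)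
  refine ⟨k, ?_⟩
  rw [hk]
  apply Matrix.ext_of_mulVec_single
  intro i
  generalize (Pi.single i 1 : Idx r → ℝ) = u
  have hc : Real.cosh s = Real.cosh (s / 2) ^ 2 + Real.sinh (s / 2) ^ 2 := by
    rw [← Real.cosh_two_mul]; congr 1; ring
  have hs : Real.sinh s = 2 * Real.sinh (s / 2) * Real.cosh (s / 2) := by
    rw [← Real.sinh_two_mul]; congr 1; ring
  rw [← mulVec_mulVec, refl_mulVec, refl_mulVec, b1, b2, aMat, fromBlocks_mulVec, hc, hs]
  have c1 : bil r d u = u (Sum.inr 0) := by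
    rw [bil_apply]
    have : d ∘ Sum.inl = 0 := by ext i; simp [hd]
    rw [this]
    simp [hd]
  have c2 : bil r e u = Real.cosh (s / 2) * u (Sum.inr 0) - Real.sinh (s / 2) * u (Sum.inr 1) := by
    rw [bil_apply]
    have : e ∘ Sum.inl = 0 := by ext i; simp [he]
    rw [this]
    simp [he]
  have c3 : bil r e d = Real.cosh (s / 2) := by
    rw [bil_apply]
    simp [he, hd]
  rw [bil_sub_right, bil_smul_right, c1, c2, c3]
  generalize Real.cosh (s / 2) = x at *
  generalize Real.sinh (s / 2) = y at *
  ext j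
  rcases j with j | j
  · simp [hd, he]
  · fin_cases j
    · simp [hd, he, mulVec, dotProduct]
      linear_combination (u (Sum.inr 0)) * hcs
    · simp [hd, he, mulVec, dotProduct]
      linear_combination (-u (Sum.inr 1)) * hcs

/-- The unipotent case: the two axes α and α + (|α|²/2)v₀ differ by an isotropic vector orthogonal
to both. -/
theorem exists_lift_nMat (r : ℕ) (α : Coord r → ℝ) : ∃ k : G r, ρ r k = nMat r α := by
  by_cases hα : α = 0
  · exact ⟨1, by rw [map_one, hα, nMat_zero]⟩
  have hN : 0 < α ⬝ᵥ α := lt_of_le_of_ne (dotProduct_self_nonneg' α)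
    fun h => hα (dotProduct_self_eq_zero.1 h.symm)
  set d : Idx r → ℝ := Sum.elim α 0 with hd
  set e : Idx r → ℝ := d + ((α ⬝ᵥ α) / 2) • v₀ r with he
  have b1 : bil r d d = α ⬝ᵥ α := by rw [hd, bil_inl]; simp
  have b3 : bil r d (v₀ r) = 0 := by rw [hd, bil_v₀]; simp
  have b2 : bil r e e = α ⬝ᵥ α := by
    rw [he, bil_add_left, bil_add_right, bil_add_right, bil_smul_left, bil_smul_left,
      bil_smul_right, bil_smul_right, bil_comm r (v₀ r) d, b3, bil_v₀_v₀, b1]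
    ring
  have b4 : bil r e (v₀ r) = 0 := by
    rw [he, bil_add_left, bil_smul_left, b3, bil_v₀_v₀]; ring
  obtain ⟨k, hk⟩ := exists_rotor r e d (by rwa [b2]) (by rwa [b1])
  refine ⟨k, ?_⟩
  apply transpose_J_nMat_mul _ _ _ (ρ_adj r k)
  · rw [hk, ← mulVec_mulVec, refl_mulVec r d, b3]
    simp [refl_mulVec, b4]
  · intro y
    have c1 : bil r d (Sum.elim y 0) = α ⬝ᵥ y := by rw [hd, bil_inl]; simp
    have c2 : bil r (v₀ r) (Sum.elim y 0) = 0 := by rw [bil_comm, bil_v₀]; simp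
    have c3 : bil r e (Sum.elim y 0) = α ⬝ᵥ y := by
      rw [he, bil_add_left, bil_smul_left, c1, c2]; ring
    have c4 : bil r e d = α ⬝ᵥ α := by
      rw [he, bil_add_left, bil_smul_left, b1, bil_comm, b3]; ring
    rw [hk, ← mulVec_mulVec, refl_mulVec, refl_mulVec, bil_sub_right, bil_smul_right, c1, c3, c4, b1, b2, he]
    have h0 := hN.ne'
    ext j
    simp only [Pi.add_apply, Pi.sub_apply, Pi.smul_apply, smul_eq_mul]
    field_simp
    ring

theorem eq_smul_v₀ (r : ℕ) (x : Idx r → ℝ) (hx : bil r x x = 0) (h : bil r x (v₀ r) = 0) :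
    x = x (Sum.inr 1) • v₀ r := by
  rw [bil_v₀] at h
  have h' : x (Sum.inr 0) = x (Sum.inr 1) := by linarith
  rw [bil_apply, h'] at hx
  have h1 : (x ∘ Sum.inl) ⬝ᵥ (x ∘ Sum.inl) = 0 := by linarith
  have h2 := dotProduct_self_eq_zero.1 h1
  ext i
  rcases i with i | i
  · simpa [v₀] using congrFun h2 i
  · fin_cases i
    · simpa [v₀] using h'
    · simp [v₀]

theorem bil_null_nonpos (r : ℕ) (x y : Idx r → ℝ) (hx : bil r x x = 0) (hxt : 0 < x (Sum.inr 1))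
    (hy : bil r y y = 0) (hyt : 0 < y (Sum.inr 1)) : bil r x y ≤ 0 := by
  rw [bil_spatial] at *
  have h := dotProduct_sq_le (spatial r x) (spatial r y)
  rw [sub_eq_zero.1 hx, sub_eq_zero.1 hy] at h
  have : |spatial r x ⬝ᵥ spatial r y| ≤ x (Sum.inr 1) * y (Sum.inr 1) :=
    abs_le_of_sq_le_sq (by linarith) (by positivity)
  linarith [le_abs_self (spatial r x ⬝ᵥ spatial r y)]

theorem refl_sub (r : ℕ) (x y : Idx r → ℝ) (h : bil r x x = bil r y y)
    (hd : bil r (x - y) (x - y) ≠ 0) : refl r (x - y) *ᵥ x = y := by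
  have h1 : 2 * bil r (x - y) x = bil r (x - y) (x - y) := by
    simp only [bil_sub_left, bil_sub_right, bil_comm r y x, h]
    ring
  rw [refl_mulVec, h1, div_self hd, one_smul, sub_sub_cancel]

theorem exists_move_to_v₀ (r : ℕ) (x : Idx r → ℝ) (hx : bil r x x = 0) (hxt : 0 < x (Sum.inr 1)) :
    ∃ k : G r, ∃ t : ℝ, 0 < t ∧ ρ r k *ᵥ x = t • v₀ r := by
  by_cases h : bil r x (v₀ r) = 0
  · exact ⟨1, _, hxt, by rw [map_one, one_mulVec]; exact eq_smul_v₀ r x hx h⟩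
  · have h1 := lt_of_le_of_ne (bil_null_nonpos r x (v₀ r) hx hxt (bil_v₀_v₀ r) (by simp [v₀])) h
    have hd : 0 < bil r (x - v₀ r) (x - v₀ r) := by
      simp only [bil_sub_left, bil_sub_right, bil_comm r (v₀ r) x, hx, bil_v₀_v₀]
      linarith
    -- The reflection in x − v₀ already sends x to v₀; a second reflection, in a spacelike vector
    -- orthogonal to v₀, makes the product even.
    set e : Idx r → ℝ := Sum.elim (Pi.single 0 1) 0 with he
    have h2 : bil r e e = 1 := by rw [he, bil_inl]; simp
    have h3 : bil r e (v₀ r) = 0 := by rw [he, bil_v₀]; simp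
    obtain ⟨k, hk⟩ := exists_rotor r e (x - v₀ r) (by rw [h2]; norm_num) hd
    refine ⟨k, 1, one_pos, ?_⟩
    rw [hk, ← mulVec_mulVec, refl_sub r x _ (by rw [hx, bil_v₀_v₀]) hd.ne', refl_mulVec, h3]
    simp

/-- The image of v₀ is brought back to its ray by the spin group; the rest is a product MAN whose
factors lift one by one. -/
theorem exists_lift (r : ℕ) (A : Matrix (Idx r) (Idx r) ℝ) (hA : IsLor r A) :
    ∃ k : G r, ρ r k = A := by
  obtain ⟨k, t, ht, hk⟩ := exists_move_to_v₀ r (A *ᵥ v₀ r) (by rw [hA.bil, bil_v₀_v₀])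
    (ray_pos hA _ (bil_v₀_v₀ r).le (by simp [v₀]))
  rw [mulVec_mulVec] at hk
  have hB := (isLor_ρ r k).mul hA
  obtain ⟨W, hW, α, e⟩ := exists_man r _ hB.adj hB.det t ht hk
  obtain ⟨k1, h1⟩ := exists_lift_mMat r W hW
  obtain ⟨k2, h2⟩ := exists_lift_aMat r (Real.log t)
  obtain ⟨k3, h3⟩ := exists_lift_nMat r α
  refine ⟨k⁻¹ * (k1 * k2 * k3), ?_⟩
  rw [map_mul, map_mul, map_mul, h1, h2, h3, ← e, ← Matrix.mul_assoc, ρ_inv_mul, Matrix.one_mul]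

end SpinOrbit

namespace SpinOrbit

/-! ### Elements of `𝔭^*` -/

theorem bil_skew {r : ℕ} {Z : Matrix (Idx r) (Idx r) ℝ} (hZ : Z ∈ 𝔤 r) (u v : Idx r → ℝ) :
    bil r (Z *ᵥ u) v = -bil r u (Z *ᵥ v) := by
  have h := (mem_𝔤 r Z).1 hZ
  rw [bil, ← vecMul_transpose, ← dotProduct_mulVec, mulVec_mulVec, h, bil, ← mulVec_mulVec,
    neg_mulVec, mulVec_neg, dotProduct_neg]

@[simp] theorem v₀_inl (r : ℕ) (i : Coord r) : v₀ r (Sum.inl i) = 0 := rfl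

@[simp] theorem v₀_inr (r : ℕ) (i : Fin 2) : v₀ r (Sum.inr i) = 1 := rfl

/-- The linear part `2β` of the functional `pr Z`. -/
def lin (r : ℕ) (Z : Matrix (Idx r) (Idx r) ℝ) : Coord r → ℝ := (Z *ᵥ v₀ r) ∘ Sum.inl

/-- The `𝔞`-component of the functional `pr Z`. -/
def tau (r : ℕ) (Z : Matrix (Idx r) (Idx r) ℝ) : ℝ := (Z *ᵥ v₀ r) (Sum.inr 0)

/-- By skewness Zv₀ is orthogonal to v₀, so `lin` and `tau` are its only components. -/
theorem mulVec_v₀ {r : ℕ} {Z : Matrix (Idx r) (Idx r) ℝ} (hZ : Z ∈ 𝔤 r) :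
    Z *ᵥ v₀ r = Sum.elim (lin r Z) 0 + tau r Z • v₀ r := by
  have h := bil_skew hZ (v₀ r) (v₀ r)
  rw [bil_comm r (v₀ r), bil_v₀] at h
  ext i
  rcases i with i | i
  · simp [lin]
  · fin_cases i
    · simp [tau]
    · simp [tau]
      linarith

theorem toBlocks₁₁_mulVec {r : ℕ} (Z : Matrix (Idx r) (Idx r) ℝ) (y : Coord r → ℝ) :
    Z.toBlocks₁₁ *ᵥ y = (Z *ᵥ Sum.elim y 0) ∘ Sum.inl := by
  ext i
  simp [mulVec, dotProduct, Fintype.sum_sum_type, toBlocks₁₁]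

theorem toBlocks₁₁_transpose {r : ℕ} {Z : Matrix (Idx r) (Idx r) ℝ} (hZ : Z ∈ 𝔤 r) :
    (Z.toBlocks₁₁)ᵀ = -Z.toBlocks₁₁ := by
  ext i j
  have := congrFun (congrFun ((mem_𝔤 r Z).1 hZ) (Sum.inl i)) (Sum.inl j)
  simpa [J, mul_diagonal, diagonal_mul, sign, toBlocks₁₁] using this

/-- The coordinates of the functional dual to 𝔪, 𝔞 and 𝔫 are the block, `tau` and `lin`. -/
theorem pairing {r : ℕ} {Z : Matrix (Idx r) (Idx r) ℝ} (hZ : Z ∈ 𝔤 r)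
    (Y : Matrix (Coord r) (Coord r) ℝ) (t : ℝ) (α : Coord r → ℝ) :
    1 / 2 * (Z * parMat r Y t α).trace =
      1 / 2 * (Z.toBlocks₁₁ * Y).trace + t * tau r Z + α ⬝ᵥ lin r Z := by
  have hs (i j) : Z j i * sign r j = -(sign r i * Z i j) := by
    have := congrFun (congrFun ((mem_𝔤 r Z).1 hZ) i) j
    simpa [J, mul_diagonal, diagonal_mul] using this
  have e00 := hs (Sum.inr 0) (Sum.inr 0)
  have e01 := hs (Sum.inr 0) (Sum.inr 1)
  have e11 := hs (Sum.inr 1) (Sum.inr 1)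
  have f0 (i : Coord r) : Z (Sum.inl i) (Sum.inr 0) = -Z (Sum.inr 0) (Sum.inl i) := by
    simpa [sign] using hs (Sum.inr 0) (Sum.inl i)
  have f1 (i : Coord r) : Z (Sum.inl i) (Sum.inr 1) = Z (Sum.inr 1) (Sum.inl i) := by
    simpa [sign] using hs (Sum.inr 1) (Sum.inl i)
  simp [sign] at e00 e01 e11
  have z00 : Z (Sum.inr 0) (Sum.inr 0) = 0 := by linarith
  have z11 : Z (Sum.inr 1) (Sum.inr 1) = 0 := by linarith
  conv_lhs => rw [← fromBlocks_toBlocks Z]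
  have tr (A : Matrix (Coord r) (Coord r) ℝ) (B : Matrix (Coord r) (Fin 2) ℝ) (C : Matrix (Fin 2) (Coord r) ℝ)
      (D : Matrix (Fin 2) (Fin 2) ℝ) : (fromBlocks A B C D).trace = A.trace + D.trace := by
    simp [trace, Fintype.sum_sum_type]
  rw [parMat, fromBlocks_multiply, tr, trace_add, trace_add]
  have t1 : (Z.toBlocks₁₂ * of ![α, α]).trace = ∑ i, (Z (Sum.inl i) (Sum.inr 0) + Z (Sum.inl i) (Sum.inr 1)) * α i := by
    simp [trace, Matrix.mul_apply, toBlocks₁₂, add_mul]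
  have t2 : (Z.toBlocks₂₁ * of fun i => ![-α i, α i]).trace =
      ∑ i, (Z (Sum.inl i) (Sum.inr 0) + Z (Sum.inl i) (Sum.inr 1)) * α i := by
    simp only [trace, Matrix.mul_apply, toBlocks₂₁, diag_apply, of_apply, Fin.sum_univ_two]
    rw [← Finset.sum_add_distrib]
    refine Finset.sum_congr rfl fun i _ => ?_
    rw [f0, f1]
    simp
    ring
  have t3 : (Z.toBlocks₂₂ * t • blockH).trace = 2 * t * tau r Z := by
    simp [trace, Matrix.mul_apply, toBlocks₂₂, blockH, tau, mulVec, dotProduct, v₀, Fintype.sum_sum_type]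
    rw [e01, z00]
    ring
  have t4 : α ⬝ᵥ lin r Z = ∑ i, (Z (Sum.inl i) (Sum.inr 0) + Z (Sum.inl i) (Sum.inr 1)) * α i := by
    simp [dotProduct, lin, mulVec, Fintype.sum_sum_type, mul_comm]
  rw [t1, t2, t3, t4]
  ring

theorem pr_apply (r : ℕ) (Z : 𝔤 r) (X : 𝔭 r) : pr r Z X = 1 / 2 * (Z.1 * X.1.1).trace := rfl

theorem parMat_mem (r : ℕ) (Y : Matrix (Coord r) (Coord r) ℝ) (hY : Yᵀ = -Y) (t : ℝ)
    (α : Coord r → ℝ) : parMat r Y t α ∈ 𝔤 r := by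
  rw [mem_𝔤]
  have hY' (i j) : Y j i = -Y i j := by have := congrFun (congrFun hY i) j; simpa using this
  ext i j
  rw [J, mul_diagonal, diagonal_mul]
  rcases i with i | i <;> rcases j with j | j
  · simp [parMat, sign, hY' i j]
  · fin_cases j <;> simp [parMat, sign]
  · fin_cases i <;> simp [parMat, sign]
  · fin_cases i <;> fin_cases j <;> simp [parMat, sign, blockH]

theorem oppMat_mem (r : ℕ) (Y : Matrix (Coord r) (Coord r) ℝ) (hY : Yᵀ = -Y) (β : Coord r → ℝ)
    (t : ℝ) : oppMat r Y β t ∈ 𝔤 r := by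
  rw [mem_𝔤]
  have hY' (i j) : Y j i = -Y i j := by have := congrFun (congrFun hY i) j; simpa using this
  ext i j
  rw [J, mul_diagonal, diagonal_mul]
  rcases i with i | i <;> rcases j with j | j
  · simp [oppMat, sign, hY' i j]
  · fin_cases j <;> simp [oppMat, sign]
  · fin_cases i <;> simp [oppMat, sign]
  · fin_cases i <;> fin_cases j <;> simp [oppMat, sign, blockH]

theorem lin_oppMat (r : ℕ) (Y : Matrix (Coord r) (Coord r) ℝ) (β : Coord r → ℝ) (t : ℝ) :
    lin r (oppMat r Y β t) = (2 : ℝ) • β := by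
  ext i
  simp [lin, oppMat, mulVec, dotProduct, v₀, Fintype.sum_sum_type]
  ring

theorem tau_oppMat (r : ℕ) (Y : Matrix (Coord r) (Coord r) ℝ) (β : Coord r → ℝ) (t : ℝ) :
    tau r (oppMat r Y β t) = t := by
  simp [tau, oppMat, mulVec, dotProduct, v₀, Fintype.sum_sum_type, blockH]

/-- The difference D of the two elements is paired with the element of 𝔭 built from the transposed
block and the components of D itself; the result is a positive combination of sums of squares. -/
theorem pr_eq_iff {r : ℕ} (Z Z' : 𝔤 r) : pr r Z = pr r Z' ↔
    Z.1.toBlocks₁₁ = Z'.1.toBlocks₁₁ ∧ lin r Z.1 = lin r Z'.1 ∧ tau r Z.1 = tau r Z'.1 := by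
  constructor
  · intro h
    set D : 𝔤 r := Z - Z' with hD
    have h1 := toBlocks₁₁_transpose D.2
    have hY : (-D.1.toBlocks₁₁)ᵀ = -(-D.1.toBlocks₁₁) := by rw [transpose_neg, h1]
    let X : 𝔭 r := ⟨⟨_, parMat_mem r _ hY (tau r D.1) (lin r D.1)⟩, ⟨_, _, _, rfl⟩⟩
    have h2 := congrArg (fun φ => φ X) h
    have h3 : 1 / 2 * (D.1 * parMat r (-D.1.toBlocks₁₁) (tau r D.1) (lin r D.1)).trace = 0 := by
      change pr r Z X = pr r Z' X at h2
      rw [pr_apply, pr_apply] at h2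
      have e : D.1 = Z.1 - Z'.1 := rfl
      rw [e, Matrix.sub_mul, trace_sub, mul_sub, sub_eq_zero]
      exact h2
    rw [pairing D.2, Matrix.mul_neg, ← Matrix.neg_mul, ← h1] at h3
    have h4 : (D.1.toBlocks₁₁ᵀ * D.1.toBlocks₁₁).trace = ∑ i, ∑ j, D.1.toBlocks₁₁ j i * D.1.toBlocks₁₁ j i := by
      simp [trace, Matrix.mul_apply]
    have h5 : 0 ≤ ∑ i, ∑ j, D.1.toBlocks₁₁ j i * D.1.toBlocks₁₁ j i :=
      Finset.sum_nonneg fun i _ => Finset.sum_nonneg fun j _ => mul_self_nonneg _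
    have h6 := dotProduct_self_nonneg' (lin r D.1)
    rw [h4] at h3
    have h7 : tau r D.1 * tau r D.1 = 0 := by nlinarith [mul_self_nonneg (tau r D.1)]
    have h8 : lin r D.1 ⬝ᵥ lin r D.1 = 0 := by nlinarith [mul_self_nonneg (tau r D.1)]
    have h9 : ∑ i, ∑ j, D.1.toBlocks₁₁ j i * D.1.toBlocks₁₁ j i = 0 := by
      nlinarith [mul_self_nonneg (tau r D.1)]
    have h10 := dotProduct_self_eq_zero.1 h8
    refine ⟨?_, ?_, ?_⟩
    · ext i j
      have h11 := (Finset.sum_eq_zero_iff_of_nonneg fun (k : Coord r) (_ : k ∈ Finset.univ) =>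
        Finset.sum_nonneg fun l (_ : l ∈ Finset.univ) => mul_self_nonneg (D.1.toBlocks₁₁ l k)).1 h9 j (Finset.mem_univ _)
      have h12 := (Finset.sum_eq_zero_iff_of_nonneg fun k _ =>
        mul_self_nonneg (D.1.toBlocks₁₁ k j)).1 h11 i (Finset.mem_univ _)
      have h13 := mul_self_eq_zero.1 h12
      exact sub_eq_zero.1 h13
    · ext i
      have := congrFun h10 i
      simp only [lin, hD, AddSubgroupClass.coe_sub, sub_mulVec] at this ⊢
      exact sub_eq_zero.1 this
    · have := mul_self_eq_zero.1 h7
      simp only [tau, hD, AddSubgroupClass.coe_sub, sub_mulVec] at this ⊢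
      exact sub_eq_zero.1 this
  · rintro ⟨h1, h2, h3⟩
    ext X
    obtain ⟨Y, t, α, h⟩ := X.2
    rw [pr_apply, pr_apply, h, pairing Z.2, pairing Z'.2, h1, h2, h3]

/-! ### Actions -/

theorem smul_iota (r : ℕ) (k : G r) (Z : 𝔤 r) : k • iota r Z = iota r (Ad r k Z) := by
  ext X
  change 1 / 2 * (Z.1 * (ρ r k⁻¹ * X.1 * ρ r k⁻¹⁻¹)).trace = 1 / 2 * ((ρ r k * Z.1 * ρ r k⁻¹) * X.1).trace
  rw [inv_inv, ← Matrix.mul_assoc, trace_mul_comm]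
  simp only [Matrix.mul_assoc]

theorem smul_pr (r : ℕ) (k : P r) (Z : 𝔤 r) : k • pr r Z = pr r (Ad r k Z) := by
  have h := smul_iota r (k : G r) Z
  ext X
  change (k • pr r Z) X = iota r (Ad r k Z) X.1
  rw [← h]
  rfl

theorem res_smul_iota (r : ℕ) (k : G r) (Z : 𝔤 r) : res r (k • iota r Z) = pr r (Ad r k Z) := by
  rw [smul_iota]; rfl

theorem Ad_coe (r : ℕ) (k : G r) (Z : 𝔤 r) : (Ad r k Z).1 = ρ r k * Z.1 * ρ r k⁻¹ := rfl

/-- The transpose of a difference D again lies in 𝔤, and pairing D with it gives half the sum of the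
squares of its entries. -/
theorem iota_injective (r : ℕ) : Function.Injective (iota r) := by
  intro Z Z' h
  set D : 𝔤 r := Z - Z' with hD
  have hJ := J_mul_J r
  have h0 := (mem_𝔤 r _).1 D.2
  have hT : D.1ᵀ ∈ 𝔤 r := by
    rw [mem_𝔤, transpose_transpose]
    have h1 := congrArg (fun X => J r * X * J r) h0
    simp only [Matrix.mul_assoc, hJ, Matrix.mul_one] at h1
    rw [← Matrix.mul_assoc (J r) (J r), hJ, Matrix.one_mul] at h1
    rw [Matrix.mul_neg, h1, Matrix.neg_mul, neg_neg]
  have h2 := congrArg (fun φ => φ ⟨_, hT⟩) h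
  change 1 / 2 * (Z.1 * D.1ᵀ).trace = 1 / 2 * (Z'.1 * D.1ᵀ).trace at h2
  have h3 : (D.1 * D.1ᵀ).trace = 0 := by
    have e : D.1 = Z.1 - Z'.1 := rfl
    rw [show D.1 * D.1ᵀ = Z.1 * D.1ᵀ - Z'.1 * D.1ᵀ by rw [← Matrix.sub_mul, ← e], trace_sub]
    linarith
  have h4 : D.1 = 0 := by
    have := (trace_mul_conjTranspose_self_eq_zero_iff (A := D.1)).1 (by simpa using h3)
    exact this
  exact sub_eq_zero.1 (Subtype.ext h4)

theorem pr_mem_𝔩Dual {r : ℕ} (Z : 𝔤 r) : pr r Z ∈ 𝔩Dual r ↔ lin r Z.1 = 0 := by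
  constructor
  · intro h
    let X : 𝔭 r := ⟨⟨_, parMat_mem r 0 (by simp) 0 (lin r Z.1)⟩, ⟨_, _, _, rfl⟩⟩
    have h1 := h X ⟨_, rfl⟩
    rw [pr_apply, pairing Z.2] at h1
    simpa using h1
  · rintro h X ⟨α, hX⟩
    rw [pr_apply, hX, pairing Z.2, h]
    simp

theorem lin_eq_zero_iff {r : ℕ} {Z : Matrix (Idx r) (Idx r) ℝ} (hZ : Z ∈ 𝔤 r) :
    lin r Z = 0 ↔ ∃ t : ℝ, Z *ᵥ v₀ r = t • v₀ r := by
  constructor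
  · intro h
    refine ⟨tau r Z, ?_⟩
    rw [mulVec_v₀ hZ, h]
    ext i; rcases i with i | i <;> simp
  · rintro ⟨t, h⟩
    ext i
    simp [lin, h]

theorem conj_mulVec {r : ℕ} (k : G r) (Z : 𝔤 r) (u : Idx r → ℝ) :
    (Ad r k Z).1 *ᵥ u = ρ r k *ᵥ (Z.1 *ᵥ (ρ r k⁻¹ *ᵥ u)) := by
  rw [Ad_coe, mulVec_mulVec, mulVec_mulVec, Matrix.mul_assoc]

theorem ρ_mulVec_eq_iff {r : ℕ} (k : G r) (u v : Idx r → ℝ) :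
    ρ r k *ᵥ u = v ↔ u = ρ r k⁻¹ *ᵥ v := by
  constructor
  · rintro rfl; rw [mulVec_mulVec, ρ_inv_mul, one_mulVec]
  · rintro rfl; rw [mulVec_mulVec, ρ_mul_inv, one_mulVec]

/-- The test for depth zero, transported from Ad(k)Z and v₀ to Z and the vector ρ(k)⁻¹v₀. -/
theorem lin_Ad_eq_zero_iff {r : ℕ} (k : G r) (Z : 𝔤 r) :
    lin r (Ad r k Z).1 = 0 ↔ ∃ t : ℝ, Z.1 *ᵥ (ρ r k⁻¹ *ᵥ v₀ r) = t • (ρ r k⁻¹ *ᵥ v₀ r) := by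
  rw [lin_eq_zero_iff (Ad r k Z).2]
  refine exists_congr fun t => ?_
  rw [conj_mulVec, ρ_mulVec_eq_iff, mulVec_smul]

theorem orbit_subset_𝔩Dual {r : ℕ} (Z : 𝔤 r) :
    MulAction.orbit (P r) (pr r Z) ⊆ 𝔩Dual r ↔ lin r Z.1 = 0 := by
  constructor
  · intro h
    exact (pr_mem_𝔩Dual Z).1 (h (MulAction.mem_orbit_self _))
  · rintro h _ ⟨k, rfl⟩
    change k • pr r Z ∈ 𝔩Dual r
    rw [smul_pr, pr_mem_𝔩Dual, lin_Ad_eq_zero_iff]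
    obtain ⟨s, hs⟩ := ρ_P_v₀ r (k : G r)⁻¹ ((P r).inv_mem k.2)
    obtain ⟨t, ht⟩ := (lin_eq_zero_iff Z.2).1 h
    exact ⟨t, by rw [hs, mulVec_smul, ht, smul_comm]⟩

/-! ### Action of `MAN` on the components of a functional -/

theorem ext_mulVec' {m n : Type*} [Fintype n] [DecidableEq n] {A B : Matrix m n ℝ}
    (h : ∀ y, A *ᵥ y = B *ᵥ y) : A = B := Matrix.ext_of_mulVec_single fun _ => h _

section
variable {r : ℕ} {Z : Matrix (Idx r) (Idx r) ℝ}

theorem nMat_conj_v₀ (hZ : Z ∈ 𝔤 r) (α : Coord r → ℝ) :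
    (nMat r α * Z * nMat r (-α)) *ᵥ v₀ r = Sum.elim (lin r Z) 0 + (tau r Z + α ⬝ᵥ lin r Z) • v₀ r := by
  rw [← mulVec_mulVec, ← mulVec_mulVec, nMat_mulVec_v₀, mulVec_v₀ hZ, mulVec_add, mulVec_smul,
    nMat_mulVec_v₀, nMat_mulVec_inl, add_assoc, ← add_smul, add_comm (tau r Z)]

theorem lin_of_mulVec_v₀ {b : Coord r → ℝ} {t : ℝ} (h : Z *ᵥ v₀ r = Sum.elim b 0 + t • v₀ r) :
    lin r Z = b ∧ tau r Z = t := by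
  constructor
  · ext i; simp [lin, h]
  · simp [tau, h]

/-- N changes the 𝔪-block by a skew matrix of rank at most two. This freedom serves to kill Yb, and
conversely lets α be read off from the change of the block. -/
theorem nMat_conj_toBlocks₁₁ (hZ : Z ∈ 𝔤 r) (α : Coord r → ℝ) :
    (nMat r α * Z * nMat r (-α)).toBlocks₁₁ =
      Z.toBlocks₁₁ - vecMulVec (lin r Z) α + vecMulVec α (lin r Z) := by
  apply ext_mulVec'
  intro y
  have h1 : bil r (Z *ᵥ Sum.elim y 0) (v₀ r) = -(lin r Z ⬝ᵥ y) := by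
    rw [bil_skew hZ, bil_comm, bil_inl]; rfl
  rw [bil_v₀] at h1
  rw [toBlocks₁₁_mulVec, ← mulVec_mulVec, ← mulVec_mulVec, nMat_mulVec_inl, mulVec_add, mulVec_smul,
    mulVec_v₀ hZ, mulVec_add, mulVec_smul, mulVec_add, mulVec_smul, nMat_mulVec_v₀, nMat_mulVec_inl,
    nMat_mulVec, add_mulVec, sub_mulVec, vecMulVec_mulVec, vecMulVec_mulVec, toBlocks₁₁_mulVec]
  ext i
  simp [v₀]
  have : (Z *ᵥ Sum.elim y 0) (Sum.inr 1) - (Z *ᵥ Sum.elim y 0) (Sum.inr 0) = lin r Z ⬝ᵥ y := by linarith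
  rw [this]
  ring

theorem aMat_conj_v₀ (hZ : Z ∈ 𝔤 r) (s : ℝ) :
    (aMat r s * Z * aMat r (-s)) *ᵥ v₀ r = Sum.elim (Real.exp (-s) • lin r Z) 0 + tau r Z • v₀ r := by
  rw [← mulVec_mulVec, ← mulVec_mulVec, aMat_mulVec_v₀, mulVec_smul, mulVec_v₀ hZ, mulVec_smul,
    mulVec_add, mulVec_smul, aMat_mulVec_v₀, aMat_mulVec_inl, smul_add, smul_smul, smul_smul]
  have : Real.exp (-s) * tau r Z * Real.exp s = tau r Z := by
    rw [mul_right_comm, ← Real.exp_add, neg_add_cancel, Real.exp_zero, one_mul]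
  rw [this]
  congr 1
  ext i; rcases i with i | i <;> simp

theorem aMat_conj_toBlocks₁₁ (s : ℝ) :
    (aMat r s * Z * aMat r (-s)).toBlocks₁₁ = Z.toBlocks₁₁ := by
  apply ext_mulVec'
  intro y
  rw [toBlocks₁₁_mulVec, ← mulVec_mulVec, ← mulVec_mulVec, aMat_mulVec_inl, toBlocks₁₁_mulVec]
  rw [aMat, fromBlocks_mulVec]
  simp

theorem mMat_conj_v₀ (hZ : Z ∈ 𝔤 r) (W : Matrix (Coord r) (Coord r) ℝ) :
    (mMat r W * Z * mMat r Wᵀ) *ᵥ v₀ r = Sum.elim (W *ᵥ lin r Z) 0 + tau r Z • v₀ r := by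
  rw [← mulVec_mulVec, ← mulVec_mulVec, mMat_mulVec_v₀, mulVec_v₀ hZ,
    mulVec_add, mulVec_smul, mMat_mulVec_v₀, mMat_mulVec_inl]

theorem mMat_conj_toBlocks₁₁ (W : Matrix (Coord r) (Coord r) ℝ) :
    (mMat r W * Z * mMat r Wᵀ).toBlocks₁₁ = W * Z.toBlocks₁₁ * Wᵀ := by
  apply ext_mulVec'
  intro y
  rw [toBlocks₁₁_mulVec, ← mulVec_mulVec, ← mulVec_mulVec, mMat_mulVec_inl, ← mulVec_mulVec, ← mulVec_mulVec,
    toBlocks₁₁_mulVec, mMat_mulVec]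
  simp

end

end SpinOrbit

namespace SpinOrbit

/-! ### Interlacing and partial fractions -/

section Interlacing
open Polynomial Filter Topology

variable {r : ℕ}

theorem monic_prod_X_add (y : Fin r → ℝ) : (∏ i, (X + C (y i))).Monic :=
  monic_prod_of_monic _ _ fun i _ => monic_X_add_C (y i)

theorem natDegree_prod_X_add (y : Fin r → ℝ) : (∏ i, (X + C (y i))).natDegree = r := by
  rw [natDegree_prod_of_monic _ _ fun i _ => monic_X_add_C (y i)]
  simp

theorem degree_prod_X_add (y : Fin r → ℝ) : (∏ i, (X + C (y i))).degree = (r : WithBot ℕ) := by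
  rw [degree_eq_natDegree (monic_prod_X_add y).ne_zero, natDegree_prod_X_add]

/-- No third node lies between two consecutive nodes, so the remaining factors have equal signs at
both. -/
theorem succAbove_sub_sign {A : Fin (r + 1) → ℝ} (hA : StrictAnti A) (i₀ i : Fin r) (hi : i ≠ i₀) :
    0 < (A (i₀.castSucc.succAbove i) - A i₀.castSucc) * (A (i₀.succ.succAbove i) - A i₀.succ) := by
  rcases lt_or_gt_of_ne hi with h | h
  · have h1 : i.castSucc < i₀.castSucc := h
    have h2 : i.castSucc < i₀.succ := h1.trans (Fin.castSucc_lt_succ)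
    rw [Fin.succAbove_of_castSucc_lt _ _ h1, Fin.succAbove_of_castSucc_lt _ _ h2]
    exact mul_pos (sub_pos.2 (hA h1)) (sub_pos.2 (hA h2))
  · have h1 : i₀.castSucc ≤ i.castSucc := le_of_lt h
    have h2 : i₀.succ ≤ i.castSucc := by
      rw [Fin.le_iff_val_le_val]; simp; exact h
    rw [Fin.succAbove_of_le_castSucc _ _ h1, Fin.succAbove_of_le_castSucc _ _ h2]
    have h3 : i₀.castSucc < i.succ := lt_of_le_of_lt h1 Fin.castSucc_lt_succ
    have h4 : i₀.succ < i.succ := lt_of_le_of_lt h2 Fin.castSucc_lt_succ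
    exact mul_pos_of_neg_of_neg (sub_neg.2 (hA h3)) (sub_neg.2 (hA h4))

theorem sum_mul_prod_neg (A w : Fin (r + 1) → ℝ) (k : Fin (r + 1)) :
    ∑ l, w l * ∏ i, (-A k + A (l.succAbove i)) = w k * ∏ i, (A (k.succAbove i) - A k) := by
  rw [Finset.sum_eq_single k]
  · congr 1
    exact Finset.prod_congr rfl fun i _ => by ring
  · intro l _ hl
    obtain ⟨i, hi⟩ := Fin.exists_succAbove_eq hl.symm
    rw [Finset.prod_eq_zero (Finset.mem_univ i) (by rw [hi]; ring), mul_zero]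
  · simp

/-- At μ = −A_k only the k-th summand survives, and its sign alternates with k. The intermediate
value theorem gives r distinct roots between consecutive nodes, and these determine a polynomial of
degree at most r up to its leading coefficient. -/
theorem exists_interlacing_strict {A w : Fin (r + 1) → ℝ} (hA : StrictAnti A) (hw : ∀ k, 0 < w k) :
    ∃ y : Fin r → ℝ, (∀ i, A i.succ ≤ y i ∧ y i ≤ A i.castSucc) ∧
      ∀ μ, ∑ k, w k * ∏ i, (μ + A (k.succAbove i)) = (∑ k, w k) * ∏ i, (μ + y i) := by
  set F : ℝ → ℝ := fun μ => ∑ k, w k * ∏ i, (μ + A (k.succAbove i)) with hF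
  have hFc : Continuous F := by fun_prop
  have hroot (i₀ : Fin r) : ∃ y, A i₀.succ < y ∧ y < A i₀.castSucc ∧ F (-y) = 0 := by
    have hlt : A i₀.succ < A i₀.castSucc := hA Fin.castSucc_lt_succ
    have hneg : F (-A i₀.castSucc) * F (-A i₀.succ) < 0 := by
      rw [hF]
      simp only [sum_mul_prod_neg]
      have h1 : (∏ i, (A (i₀.castSucc.succAbove i) - A i₀.castSucc)) *
          ∏ i, (A (i₀.succ.succAbove i) - A i₀.succ) < 0 := by
        rw [← Finset.prod_mul_distrib, ← Finset.mul_prod_erase _ _ (Finset.mem_univ i₀)]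
        refine mul_neg_of_neg_of_pos ?_ (Finset.prod_pos fun i hi =>
          succAbove_sub_sign hA i₀ i (Finset.ne_of_mem_erase hi))
        rw [Fin.succAbove_castSucc_self, Fin.succAbove_succ_self]
        nlinarith
      have h2 := mul_pos (hw i₀.castSucc) (hw i₀.succ)
      calc _ = (w i₀.castSucc * w i₀.succ) * ((∏ i, (A (i₀.castSucc.succAbove i) - A i₀.castSucc)) *
          ∏ i, (A (i₀.succ.succAbove i) - A i₀.succ)) := by ring
        _ < 0 := mul_neg_of_pos_of_neg h2 h1
    have hle : -A i₀.castSucc ≤ -A i₀.succ := by linarith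
    have : ∃ z ∈ Set.Icc (-A i₀.castSucc) (-A i₀.succ), F z = 0 := by
      rcases lt_or_ge (F (-A i₀.castSucc)) 0 with h | h
      · have h' : 0 ≤ F (-A i₀.succ) := by nlinarith
        exact intermediate_value_Icc hle hFc.continuousOn ⟨h.le, h'⟩
      · have h' : F (-A i₀.succ) ≤ 0 := by nlinarith
        exact intermediate_value_Icc' hle hFc.continuousOn ⟨h', h⟩
    obtain ⟨z, ⟨hz1, hz2⟩, hz⟩ := this
    refine ⟨-z, lt_of_le_of_ne (by linarith) ?_, lt_of_le_of_ne (by linarith) ?_, by rwa [neg_neg]⟩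
    · intro h
      rw [h, neg_neg, hz, mul_zero] at hneg
      exact lt_irrefl _ hneg
    · intro h
      rw [← h, neg_neg, hz, zero_mul] at hneg
      exact lt_irrefl _ hneg
  choose y hy1 hy2 hy3 using hroot
  refine ⟨y, fun i => ⟨(hy1 i).le, (hy2 i).le⟩, ?_⟩
  have hyanti : StrictAnti y := by
    intro i j hij
    have h1 : A j.castSucc ≤ A i.succ := hA.antitone (by rw [Fin.le_iff_val_le_val]; simp; exact hij)
    linarith [hy2 j, hy1 i]
  set Q : ℝ[X] := ∏ i, (X + C (y i)) with hQ
  -- A sum of differences of monic polynomials of degree r: its degree is below r, yet it has r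
  -- distinct roots.
  set R : ℝ[X] := ∑ k, C (w k) * (∏ i, (X + C (A (k.succAbove i))) - Q) with hR
  have hRe (μ : ℝ) : R.eval μ = F μ - (∑ k, w k) * ∏ i, (μ + y i) := by
    rw [hR, hF, hQ]
    simp [eval_finsetSum, eval_prod, mul_sub, Finset.sum_sub_distrib, Finset.sum_mul]
  have hR0 : R = 0 := by
    apply eq_zero_of_degree_lt_of_eval_finset_eq_zero (Finset.univ.image fun i => -y i)
    · rw [Finset.card_image_of_injective _ fun i j h => hyanti.injective (neg_injective h),
        Finset.card_univ, Fintype.card_fin]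
      rw [← mem_degreeLT]
      refine Submodule.sum_mem _ fun k _ => ?_
      rw [← smul_eq_C_mul]
      refine Submodule.smul_mem _ _ (mem_degreeLT.2 ?_)
      by_cases h0 : ∏ i, (X + C (A (k.succAbove i))) - Q = 0
      · rw [h0, degree_zero]; exact WithBot.bot_lt_coe r
      · have := degree_sub_lt_left (p := ∏ i, (X + C (A (k.succAbove i)))) (q := Q)
          (by rw [hQ, degree_prod_X_add, degree_prod_X_add]) (monic_prod_X_add _).ne_zero
          (by rw [(monic_prod_X_add _).leadingCoeff, (monic_prod_X_add _).leadingCoeff])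
        rwa [degree_prod_X_add] at this
    · intro z hz
      obtain ⟨i, -, rfl⟩ := Finset.mem_image.1 hz
      rw [hRe, hy3, Finset.prod_eq_zero (Finset.mem_univ i) (by ring)]
      ring
  intro μ
  have := hRe μ
  rw [hR0, eval_zero] at this
  change F μ = _
  linarith

/-- Lagrange interpolation at the r + 1 nodes −A_k. Interlacing gives every quotient in the weights
a nonnegative sign, and the leading coefficients show that the weights sum to 1. -/
theorem exists_weights_strict {A : Fin (r + 1) → ℝ} (hA : StrictAnti A) {y : Fin r → ℝ}
    (hy : ∀ i, A i.succ ≤ y i ∧ y i ≤ A i.castSucc) :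
    ∃ w : Fin (r + 1) → ℝ, (∀ k, 0 ≤ w k) ∧ ∑ k, w k = 1 ∧
      ∀ μ, ∑ k, w k * ∏ i, (μ + A (k.succAbove i)) = ∏ i, (μ + y i) := by
  set w : Fin (r + 1) → ℝ := fun k => ∏ i, (y i - A k) / (A (k.succAbove i) - A k) with hw
  have hne (k : Fin (r + 1)) (i : Fin r) : A (k.succAbove i) - A k ≠ 0 :=
    sub_ne_zero.2 (hA.injective.ne (Fin.succAbove_ne k i))
  set Q : ℝ[X] := ∏ i, (X + C (y i)) with hQ
  set R : ℝ[X] := ∑ k, C (w k) * ∏ i, (X + C (A (k.succAbove i))) with hR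
  have hRQ : R = Q := by
    apply eq_of_degrees_lt_of_eval_finset_eq (Finset.univ.image fun k => -A k)
    · rw [Finset.card_image_of_injective _ fun i j h => hA.injective (neg_injective h),
        Finset.card_univ, Fintype.card_fin]
      rw [← mem_degreeLT]
      refine Submodule.sum_mem _ fun k _ => ?_
      rw [← smul_eq_C_mul]
      refine Submodule.smul_mem _ _ (mem_degreeLT.2 ?_)
      rw [degree_prod_X_add]
      exact_mod_cast Nat.lt_succ_self r
    · rw [Finset.card_image_of_injective _ fun i j h => hA.injective (neg_injective h),
        Finset.card_univ, Fintype.card_fin, hQ, degree_prod_X_add]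
      exact_mod_cast Nat.lt_succ_self r
    · intro z hz
      obtain ⟨k, -, rfl⟩ := Finset.mem_image.1 hz
      have h1 : eval (-A k) R = ∑ l, w l * ∏ i, (-A k + A (l.succAbove i)) := by
        rw [hR]; simp [eval_finsetSum, eval_prod]
      rw [h1, sum_mul_prod_neg, hw, ← Finset.prod_mul_distrib, hQ, eval_prod]
      refine Finset.prod_congr rfl fun i _ => ?_
      rw [div_mul_cancel₀ _ (hne k i)]
      simp
      ring
  refine ⟨w, ?_, ?_, ?_⟩
  · intro k
    refine Finset.prod_nonneg fun i _ => ?_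
    by_cases h : i.castSucc < k
    · rw [Fin.succAbove_of_castSucc_lt _ _ h]
      have h1 : A k ≤ A i.succ := hA.antitone (by
        rw [Fin.le_iff_val_le_val]; rw [Fin.lt_def] at h; simp at h ⊢; omega)
      exact div_nonneg (by linarith [(hy i).1]) (by linarith [hA h])
    · rw [not_lt] at h
      rw [Fin.succAbove_of_le_castSucc _ _ h]
      have h1 := hA.antitone h
      have h2 : A i.succ < A k := hA (lt_of_le_of_lt h Fin.castSucc_lt_succ)
      exact div_nonneg_of_nonpos (by linarith [(hy i).2]) (by linarith)
  · have h1 := congrArg (fun p => coeff p r) hRQ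
    have h2 (y : Fin r → ℝ) : (∏ i, (X + C (y i))).coeff r = 1 := by
      have := (monic_prod_X_add y).coeff_natDegree
      rwa [natDegree_prod_X_add] at this
    simpa [hR, hQ, finsetSum_coeff, h2] using h1
  · intro μ
    have h1 := congrArg (fun p => eval μ p) hRQ
    simpa [hR, hQ, eval_finsetSum, eval_prod] using h1

theorem tendsto_eps : Tendsto (fun n : ℕ => (1 : ℝ) / ((n : ℝ) + 1)) atTop (𝓝 0) :=
  tendsto_one_div_add_atTop_nhds_zero_nat

/-- The strict case for perturbed nodes and weights, followed by a limit along a convergent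
subsequence; the roots stay in a box. -/
theorem exists_interlacing {A w : Fin (r + 1) → ℝ} (hA : Antitone A) (hw : ∀ k, 0 ≤ w k) :
    ∃ y : Fin r → ℝ, (∀ i, A i.succ ≤ y i ∧ y i ≤ A i.castSucc) ∧
      ∀ μ, ∑ k, w k * ∏ i, (μ + A (k.succAbove i)) = (∑ k, w k) * ∏ i, (μ + y i) := by
  set ε : ℕ → ℝ := fun n => 1 / ((n : ℝ) + 1) with hε
  have hε0 (n) : 0 < ε n := by positivity
  have hε1 (n) : ε n ≤ 1 := by
    rw [hε]; simp only; rw [div_le_one (by positivity)]; linarith [(Nat.cast_nonneg n : (0:ℝ) ≤ n)]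
  have hεt : Tendsto ε atTop (𝓝 0) := tendsto_eps
  set B : ℕ → Fin (r + 1) → ℝ := fun n k => A k - ε n * (k : ℕ) with hB
  set v : ℕ → Fin (r + 1) → ℝ := fun n k => w k + ε n with hv
  have hBs (n) : StrictAnti (B n) := by
    intro i j hij
    have h1 := hA hij.le
    have h2 : ((i : ℕ) : ℝ) < ((j : ℕ) : ℝ) := by exact_mod_cast hij
    simp only [hB]
    nlinarith [hε0 n]
  have key (n) := exists_interlacing_strict (hBs n) (w := v n) fun k => by
    simp only [hv]; linarith [hw k, hε0 n]
  choose y hy hye using key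
  have hbox (n) : y n ∈ Set.Icc (fun i : Fin r => A i.succ - (r + 1)) (fun i => A i.castSucc) := by
    constructor
    · intro i
      have h1 := (hy n i).1
      simp only [hB] at h1
      have h2 : ((i.succ : ℕ) : ℝ) ≤ r + 1 := by exact_mod_cast i.succ.2.le
      have h3 : ε n * ((i.succ : ℕ) : ℝ) ≤ r + 1 := by
        nlinarith [hε0 n, hε1 n, (Nat.cast_nonneg (i.succ : ℕ) : (0:ℝ) ≤ ((i.succ : ℕ) : ℝ))]
      linarith
    · intro i
      have h1 := (hy n i).2
      simp only [hB] at h1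
      have : 0 ≤ ε n * ((i.castSucc : ℕ) : ℝ) := mul_nonneg (hε0 n).le (Nat.cast_nonneg _)
      linarith
  obtain ⟨z, -, φ, hφ, hz⟩ := isCompact_Icc.tendsto_subseq hbox
  have hzi (i) : Tendsto (fun n => y (φ n) i) atTop (𝓝 (z i)) := tendsto_pi_nhds.1 hz i
  have hεφ : Tendsto (fun n => ε (φ n)) atTop (𝓝 0) := hεt.comp hφ.tendsto_atTop
  have hBt (k) : Tendsto (fun n => B (φ n) k) atTop (𝓝 (A k)) := by
    simpa [hB] using tendsto_const_nhds.sub (hεφ.mul_const _)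
  have hvt (k) : Tendsto (fun n => v (φ n) k) atTop (𝓝 (w k)) := by
    simpa [hv] using tendsto_const_nhds.add hεφ
  refine ⟨z, fun i => ⟨le_of_tendsto_of_tendsto' (hBt _) (hzi i) fun n => (hy _ i).1,
    le_of_tendsto_of_tendsto' (hzi i) (hBt _) fun n => (hy _ i).2⟩, fun μ => ?_⟩
  have h1 : Tendsto (fun n => ∑ k, v (φ n) k * ∏ i, (μ + B (φ n) (k.succAbove i))) atTop
      (𝓝 (∑ k, w k * ∏ i, (μ + A (k.succAbove i)))) :=
    tendsto_finsetSum _ fun k _ => (hvt k).mul (tendsto_finsetProd _ fun i _ =>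
      tendsto_const_nhds.add (hBt _))
  have h2 : Tendsto (fun n => (∑ k, v (φ n) k) * ∏ i, (μ + y (φ n) i)) atTop
      (𝓝 ((∑ k, w k) * ∏ i, (μ + z i))) :=
    (tendsto_finsetSum _ fun k _ => hvt k).mul (tendsto_finsetProd _ fun i _ =>
      tendsto_const_nhds.add (hzi i))
  exact tendsto_nhds_unique h1 (h2.congr fun n => (hye (φ n) μ).symm)

theorem exists_weights {A : Fin (r + 1) → ℝ} (hA : Antitone A) {y : Fin r → ℝ}
    (hy : ∀ i, A i.succ ≤ y i ∧ y i ≤ A i.castSucc) :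
    ∃ w : Fin (r + 1) → ℝ, (∀ k, 0 ≤ w k) ∧ ∑ k, w k = 1 ∧
      ∀ μ, ∑ k, w k * ∏ i, (μ + A (k.succAbove i)) = ∏ i, (μ + y i) := by
  set ε : ℕ → ℝ := fun n => 1 / ((n : ℝ) + 1) with hε
  have hε0 (n) : 0 < ε n := by positivity
  have hεt : Tendsto ε atTop (𝓝 0) := tendsto_eps
  set B : ℕ → Fin (r + 1) → ℝ := fun n k => A k - ε n * (k : ℕ) with hB
  -- The shift i + 1/2 lies between the shifts i and i + 1 of the neighbouring nodes, so interlacing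
  -- survives the perturbation.
  set x : ℕ → Fin r → ℝ := fun n i => y i - ε n * ((i : ℕ) + 1 / 2) with hx
  have hBs (n) : StrictAnti (B n) := by
    intro i j hij
    have h1 := hA hij.le
    have h2 : ((i : ℕ) : ℝ) < ((j : ℕ) : ℝ) := by exact_mod_cast hij
    simp only [hB]
    nlinarith [hε0 n]
  have key (n) := exists_weights_strict (hBs n) (y := x n) fun i => by
    have h1 := hy i
    have h2 := hε0 n
    simp only [hB, hx, Fin.val_succ, Fin.val_castSucc]
    push_cast
    constructor <;> nlinarith
  choose w hw hws hwe using key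
  have hbox (n) : w n ∈ Set.Icc (fun _ : Fin (r + 1) => (0 : ℝ)) (fun _ => 1) :=
    ⟨hw n, fun k => by
      have := Finset.single_le_sum (f := w n) (fun k _ => hw n k) (Finset.mem_univ k)
      rwa [hws] at this⟩
  obtain ⟨z, hz0, φ, hφ, hz⟩ := isCompact_Icc.tendsto_subseq hbox
  have hzi (i) : Tendsto (fun n => w (φ n) i) atTop (𝓝 (z i)) := tendsto_pi_nhds.1 hz i
  have hεφ : Tendsto (fun n => ε (φ n)) atTop (𝓝 0) := hεt.comp hφ.tendsto_atTop
  have hBt (k) : Tendsto (fun n => B (φ n) k) atTop (𝓝 (A k)) := by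
    simpa [hB] using tendsto_const_nhds.sub (hεφ.mul_const _)
  have hxt (k) : Tendsto (fun n => x (φ n) k) atTop (𝓝 (y k)) := by
    simpa [hx] using tendsto_const_nhds.sub (hεφ.mul_const _)
  refine ⟨z, hz0.1, ?_, fun μ => ?_⟩
  · have h1 : Tendsto (fun n => ∑ k, w (φ n) k) atTop (𝓝 (∑ k, z k)) :=
      tendsto_finsetSum _ fun k _ => hzi k
    exact tendsto_nhds_unique h1 (by simp [hws])
  · have h1 : Tendsto (fun n => ∑ k, w (φ n) k * ∏ i, (μ + B (φ n) (k.succAbove i))) atTop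
        (𝓝 (∑ k, z k * ∏ i, (μ + A (k.succAbove i)))) :=
      tendsto_finsetSum _ fun k _ => (hzi k).mul (tendsto_finsetProd _ fun i _ =>
        tendsto_const_nhds.add (hBt _))
    have h2 : Tendsto (fun n => ∏ i, (μ + x (φ n) i)) atTop (𝓝 (∏ i, (μ + y i))) :=
      tendsto_finsetProd _ fun i _ => tendsto_const_nhds.add (hxt i)
    exact tendsto_nhds_unique h1 (h2.congr fun n => (hwe (φ n) μ).symm)

/-- Clearing denominators gives a polynomial with infinitely many roots; its value at κ is `N κ`
times a nonzero factor. -/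
theorem eq_zero_of_sum_div_eq_zero (K : Finset ℝ) (N : ℝ → ℝ) (c : ℝ)
    (h : ∀ μ, c < μ → ∑ κ ∈ K, N κ / (μ - κ) = 0) : ∀ κ ∈ K, N κ = 0 := by
  classical
  set R : ℝ[X] := ∑ κ ∈ K, C (N κ) * ∏ κ' ∈ K.erase κ, (X - C κ') with hR
  have hR0 : R = 0 := by
    apply eq_zero_of_infinite_isRoot
    obtain ⟨M, hM⟩ := (K.finite_toSet.bddAbove)
    refine (Set.Ioi_infinite (max c M)).mono ?_
    intro μ hμ
    have h1 : c < μ := lt_of_le_of_lt (le_max_left _ _) hμ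
    have h2 : M < μ := lt_of_le_of_lt (le_max_right _ _) hμ
    have h3 (κ) (hκ : κ ∈ K) : μ - κ ≠ 0 := by
      have := hM hκ
      intro h0
      linarith
    change R.eval μ = 0
    rw [hR, eval_finsetSum]
    have h4 : ∑ κ ∈ K, eval μ (C (N κ) * ∏ κ' ∈ K.erase κ, (X - C κ')) =
        (∏ κ ∈ K, (μ - κ)) * ∑ κ ∈ K, N κ / (μ - κ) := by
      rw [Finset.mul_sum]
      refine Finset.sum_congr rfl fun κ hκ => ?_
      rw [← Finset.mul_prod_erase K _ hκ]
      have := h3 κ hκ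
      simp [eval_prod]
      field_simp
    rw [h4, h μ h1, mul_zero]
  intro κ hκ
  have h1 : R.eval κ = N κ * ∏ κ' ∈ K.erase κ, (κ - κ') := by
    rw [hR, eval_finsetSum, Finset.sum_eq_single κ]
    · simp [eval_prod]
    · intro κ' hκ' hne
      rw [eval_mul, eval_prod, Finset.prod_eq_zero (Finset.mem_erase.2 ⟨hne.symm, hκ⟩) (by simp), mul_zero]
    · exact fun h => absurd hκ h
  rw [hR0, eval_zero] at h1
  rcases mul_eq_zero.1 h1.symm with h2 | h2
  · exact h2
  · obtain ⟨κ', hκ', h3⟩ := Finset.prod_eq_zero_iff.1 h2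
    exact absurd (sub_eq_zero.1 h3).symm (Finset.ne_of_mem_erase hκ')

end Interlacing

end SpinOrbit

namespace SpinOrbit

/-! ### Orthogonal conjugacy of skew-symmetric matrices -/

section Skew
variable {n : Type*} [Fintype n]

theorem skew_dotProduct {Y : Matrix n n ℝ} (hY : Yᵀ = -Y) (u v : n → ℝ) :
    (Y *ᵥ u) ⬝ᵥ v = -(u ⬝ᵥ (Y *ᵥ v)) := by
  rw [← vecMul_transpose, hY, ← dotProduct_mulVec, neg_mulVec, dotProduct_neg]

theorem skew_dotProduct_self {Y : Matrix n n ℝ} (hY : Yᵀ = -Y) (u : n → ℝ) :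
    u ⬝ᵥ (Y *ᵥ u) = 0 := by
  have := skew_dotProduct hY u u
  rw [dotProduct_comm] at this
  linarith

variable [DecidableEq n]

/-- Equal characteristic polynomials give equal eigenvalue functions, so the two diagonalizing
matrices can be composed. -/
theorem exists_orthogonal_conj_of_charpoly_eq {S S' : Matrix n n ℝ} (hS : Sᵀ = S) (hS' : S'ᵀ = S')
    (h : S.charpoly = S'.charpoly) : ∃ O : Matrix n n ℝ, Oᵀ * O = 1 ∧ O * S * Oᵀ = S' := by
  have hA : S.IsHermitian := by rwa [IsHermitian, conjTranspose_eq_transpose_of_trivial]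
  have hB : S'.IsHermitian := by rwa [IsHermitian, conjTranspose_eq_transpose_of_trivial]
  have he := (IsHermitian.eigenvalues_eq_eigenvalues_iff hA hB).2 h
  set U : Matrix n n ℝ := hA.eigenvectorUnitary.1 with hU
  set V : Matrix n n ℝ := hB.eigenvectorUnitary.1 with hV
  have hUU : Uᵀ * U = 1 := (mem_orthogonalGroup_iff' _ _).1 hA.eigenvectorUnitary.2
  have hVV : Vᵀ * V = 1 := (mem_orthogonalGroup_iff' _ _).1 hB.eigenvectorUnitary.2
  have hUU' : U * Uᵀ = 1 := mul_eq_one_comm.1 hUU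
  have hVV' : V * Vᵀ = 1 := mul_eq_one_comm.1 hVV
  have sA : S = U * diagonal hA.eigenvalues * Uᵀ := by
    conv_lhs => rw [hA.spectral_theorem]
    rw [Unitary.conjStarAlgAut_apply]
    rfl
  have sB : S' = V * diagonal hB.eigenvalues * Vᵀ := by
    conv_lhs => rw [hB.spectral_theorem]
    rw [Unitary.conjStarAlgAut_apply]
    rfl
  refine ⟨V * Uᵀ, ?_, ?_⟩
  · rw [transpose_mul, transpose_transpose, Matrix.mul_assoc, ← Matrix.mul_assoc Vᵀ, hVV,
      Matrix.one_mul, hUU']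
  · rw [transpose_mul, transpose_transpose]
    conv_lhs => rw [sA]
    rw [sB, ← he]
    calc V * Uᵀ * (U * diagonal hA.eigenvalues * Uᵀ) * (U * Vᵀ)
        = V * (Uᵀ * U) * diagonal hA.eigenvalues * (Uᵀ * U) * Vᵀ := by simp only [Matrix.mul_assoc]
      _ = _ := by rw [hUU, Matrix.mul_one, Matrix.mul_one]

theorem det_one_add_vecMulVec (u v : n → ℝ) : (1 + vecMulVec u v).det = 1 + v ⬝ᵥ u := by
  have : vecMulVec u v = replicateCol Unit u * replicateRow Unit v := by
    ext i j; simp [vecMulVec_apply, Matrix.mul_apply]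
  rw [this, det_one_add_replicateCol_mul_replicateRow]

theorem charpoly_eq_of_eval {A B : Matrix n n ℝ} {c : ℝ}
    (h : ∀ t, c < t → (scalar n t - A).det = (scalar n t - B).det) : A.charpoly = B.charpoly := by
  apply Polynomial.eq_of_infinite_eval_eq
  refine (Set.Ioi_infinite c).mono fun t ht => ?_
  change Polynomial.eval t _ = Polynomial.eval t _
  rw [eval_charpoly, eval_charpoly, h t ht]

/-- As Sb = 0, the matrix factors as (t − S)(1 + (c/t)bbᵗ). -/
theorem det_sub_rank_one {S : Matrix n n ℝ} {b : n → ℝ} (hb : S *ᵥ b = 0) (c t : ℝ) (ht : t ≠ 0) :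
    (scalar n t - (S - c • vecMulVec b b)).det = (scalar n t - S).det * (1 + c / t * (b ⬝ᵥ b)) := by
  have h : scalar n t - (S - c • vecMulVec b b) = (scalar n t - S) * (1 + vecMulVec ((c / t) • b) b) := by
    rw [Matrix.mul_add, Matrix.mul_one, mul_vecMulVec, sub_mulVec, mulVec_smul, mulVec_smul, hb]
    have e : scalar n t *ᵥ b = t • b := by
      ext i; simp [scalar_apply, mulVec_diagonal]
    rw [e, smul_zero, sub_zero, smul_smul, div_mul_cancel₀ _ ht, smul_vecMulVec]
    abel
  rw [h, det_mul, det_one_add_vecMulVec, dotProduct_smul, smul_eq_mul]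

/-- The Euclidean reflection in the hyperplane orthogonal to `d`. -/
noncomputable def eucRefl (d : n → ℝ) : Matrix n n ℝ := 1 - (2 / (d ⬝ᵥ d)) • vecMulVec d d

theorem eucRefl_mulVec (d u : n → ℝ) :
    eucRefl d *ᵥ u = u - (2 * (d ⬝ᵥ u) / (d ⬝ᵥ d)) • d := by
  rw [eucRefl, sub_mulVec, one_mulVec, smul_mulVec, vecMulVec_mulVec]
  simp only [op_smul_eq_smul, smul_smul]
  congr 2
  ring

theorem eucRefl_transpose (d : n → ℝ) : (eucRefl d)ᵀ = eucRefl d := by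
  rw [eucRefl, transpose_sub, transpose_smul, transpose_vecMulVec, transpose_one]

theorem eucRefl_mul_self (d : n → ℝ) (hd : d ≠ 0) : eucRefl d * eucRefl d = 1 := by
  have h0 : d ⬝ᵥ d ≠ 0 := fun h => hd (dotProduct_self_eq_zero.1 h)
  apply ext_mulVec'
  intro u
  rw [← mulVec_mulVec, one_mulVec, eucRefl_mulVec, eucRefl_mulVec, dotProduct_sub, dotProduct_smul,
    sub_sub, ← add_smul, sub_eq_self]
  convert zero_smul ℝ d
  rw [smul_eq_mul]
  field_simp
  ring

theorem det_eucRefl (d : n → ℝ) (hd : d ≠ 0) : (eucRefl d).det = -1 := by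
  have h0 : d ⬝ᵥ d ≠ 0 := fun h => hd (dotProduct_self_eq_zero.1 h)
  have : eucRefl d = 1 + vecMulVec (-(2 / (d ⬝ᵥ d)) • d) d := by
    rw [eucRefl, neg_smul, neg_vecMulVec, smul_vecMulVec, sub_eq_add_neg]
  rw [this, det_one_add_vecMulVec, dotProduct_smul, smul_eq_mul]
  field_simp
  norm_num

/-- Two skew-symmetric matrices with the same square are conjugate by an orthogonal matrix which
fixes a given common kernel vector. -/
theorem exists_orthogonal_conj_of_sq_eq {Y' : Matrix n n ℝ} (hY' : Y'ᵀ = -Y') (b : n → ℝ)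
    (hb' : Y' *ᵥ b = 0) : ∀ (N : ℕ) (Y : Matrix n n ℝ), Yᵀ = -Y → Y *ᵥ b = 0 → Y * Y = Y' * Y' →
    Fintype.card n ≤ N + Module.finrank ℝ (LinearMap.ker (Y - Y').mulVecLin) →
    ∃ O : Matrix n n ℝ, Oᵀ * O = 1 ∧ O * Y * Oᵀ = Y' ∧ O *ᵥ b = b := by
  -- Induction on a bound N for the codimension of ker(Y − Y'). Conjugation by one reflection
  -- strictly enlarges this kernel.
  intro N
  induction N with
  | zero =>
    intro Y hY hb hYY hN
    have h1 : LinearMap.ker (Y - Y').mulVecLin = ⊤ := by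
      apply Submodule.eq_top_of_finrank_eq
      refine le_antisymm (Submodule.finrank_le _) ?_
      rw [Module.finrank_fintype_fun_eq_card]
      omega
    have h2 : Y = Y' := by
      apply ext_mulVec'
      intro y
      have : y ∈ LinearMap.ker (Y - Y').mulVecLin := by rw [h1]; trivial
      rw [LinearMap.mem_ker, mulVecLin_apply, sub_mulVec] at this
      exact sub_eq_zero.1 this
    exact ⟨1, by simp, by simp [h2], by simp⟩
  | succ N ih =>
    intro Y hY hb hYY hN
    by_cases hEq : Y = Y'
    · exact ⟨1, by simp, by simp [hEq], by simp⟩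
    set S := Y' * Y' with hS
    have hSs : S.IsHermitian := by
      rw [IsHermitian, conjTranspose_eq_transpose_of_trivial, hS, transpose_mul, hY', neg_mul_neg]
    -- an eigenvector of `S` on which `Y` and `Y'` differ
    obtain ⟨v, κ, hv, hD⟩ : ∃ (v : n → ℝ) (κ : ℝ), S *ᵥ v = κ • v ∧ (Y - Y') *ᵥ v ≠ 0 := by
      by_contra! hcon
      apply hEq
      have h0 : (Y - Y') = 0 := by
        have h1 : (Y - Y').mulVecLin ∘ₗ (WithLp.linearEquiv 2 ℝ (n → ℝ)).toLinearMap = 0 := by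
          apply hSs.eigenvectorBasis.toBasis.ext
          intro i
          rw [OrthonormalBasis.coe_toBasis, LinearMap.comp_apply, mulVecLin_apply]
          exact hcon _ (hSs.eigenvalues i) (hSs.mulVec_eigenvectorBasis i)
        apply ext_mulVec'
        intro y
        have := LinearMap.congr_fun h1 (WithLp.toLp 2 y)
        simpa [sub_mulVec] using this
      exact sub_eq_zero.1 h0
    set d := (Y - Y') *ᵥ v with hd
    have hDs : (Y - Y')ᵀ = -(Y - Y') := by rw [transpose_sub, hY, hY']; abel
    have hdv : d ⬝ᵥ v = 0 := by rw [dotProduct_comm, hd, skew_dotProduct_self hDs]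
    -- This reflection fixes v, b and ker(Y − Y') and sends Yv to Y'v. It commutes with S because d,
    -- like v, is an eigenvector of S.
    set R := eucRefl d with hR
    have hRR : R * R = 1 := eucRefl_mul_self d hD
    have hRt : Rᵀ = R := eucRefl_transpose d
    have hRv : R *ᵥ v = v := by rw [hR, eucRefl_mulVec, hdv]; simp
    have hnorm : (Y *ᵥ v) ⬝ᵥ (Y *ᵥ v) = (Y' *ᵥ v) ⬝ᵥ (Y' *ᵥ v) := by
      rw [skew_dotProduct hY, skew_dotProduct hY', mulVec_mulVec, mulVec_mulVec, hYY]
    have hRY : R *ᵥ (Y *ᵥ v) = Y' *ᵥ v := by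
      have h1 : 2 * (d ⬝ᵥ (Y *ᵥ v)) = d ⬝ᵥ d := by
        rw [hd, sub_mulVec, sub_dotProduct, dotProduct_sub, sub_dotProduct, sub_dotProduct,
          dotProduct_comm (Y' *ᵥ v) (Y *ᵥ v), hnorm]
        ring
      rw [hR, eucRefl_mulVec, h1, div_self fun h => hD (dotProduct_self_eq_zero.1 h), one_smul, hd,
        sub_mulVec, sub_sub_cancel]
    have hSd : S *ᵥ d = κ • d := by
      have hc : S * (Y - Y') = (Y - Y') * S := by
        rw [Matrix.mul_sub, Matrix.sub_mul, ← hYY, Matrix.mul_assoc, hYY, hS, Matrix.mul_assoc]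
      rw [hd, mulVec_mulVec, hc, ← mulVec_mulVec, hv, mulVec_smul]
    have hSR : S * R = R * S := by
      have hSt : Sᵀ = S := by rwa [IsHermitian, conjTranspose_eq_transpose_of_trivial] at hSs
      rw [hR, eucRefl, Matrix.mul_sub, Matrix.sub_mul, Matrix.mul_one, Matrix.one_mul, Matrix.mul_smul,
        Matrix.smul_mul, mul_vecMulVec, vecMulVec_mul, hSd, ← mulVec_transpose, hSt, hSd,
        smul_vecMulVec, vecMulVec_smul]
    have hRb : R *ᵥ b = b := by
      have : d ⬝ᵥ b = 0 := by
        rw [hd, skew_dotProduct hDs, sub_mulVec, hb, hb']; simp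
      rw [hR, eucRefl_mulVec, this]; simp
    set Y₁ := R * Y * R with hY₁
    have h1 : Y₁ᵀ = -Y₁ := by
      rw [hY₁, transpose_mul, transpose_mul, hRt, hY]; simp [Matrix.mul_assoc]
    have h2 : Y₁ *ᵥ b = 0 := by
      rw [hY₁, ← mulVec_mulVec, ← mulVec_mulVec, hRb, hb, mulVec_zero]
    have h3 : Y₁ * Y₁ = S := by
      calc Y₁ * Y₁ = R * Y * (R * R) * Y * R := by rw [hY₁]; simp only [Matrix.mul_assoc]
        _ = R * (Y * Y) * R := by rw [hRR, Matrix.mul_one]; simp only [Matrix.mul_assoc]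
        _ = S := by rw [hYY, ← hSR, Matrix.mul_assoc, hRR, Matrix.mul_one]
    have hlt : LinearMap.ker (Y - Y').mulVecLin < LinearMap.ker (Y₁ - Y').mulVecLin := by
      refine lt_of_le_of_ne ?_ ?_
      · intro u hu
        rw [LinearMap.mem_ker, mulVecLin_apply] at hu ⊢
        have hRK (u : n → ℝ) (hu : (Y - Y') *ᵥ u = 0) : R *ᵥ u = u := by
          have : d ⬝ᵥ u = 0 := by rw [hd, skew_dotProduct hDs, hu]; simp
          rw [hR, eucRefl_mulVec, this]; simp
        have e : Y *ᵥ u = Y' *ᵥ u := by rw [sub_mulVec] at hu; exact sub_eq_zero.1 hu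
        have h4 : (Y - Y') *ᵥ (Y *ᵥ u) = 0 := by
          rw [sub_mulVec, mulVec_mulVec, hYY, e, mulVec_mulVec, sub_self]
        rw [sub_mulVec, hY₁, ← mulVec_mulVec, ← mulVec_mulVec, hRK u hu, hRK _ h4, e, sub_self]
      · intro h
        have : v ∈ LinearMap.ker (Y₁ - Y').mulVecLin := by
          rw [LinearMap.mem_ker, mulVecLin_apply, sub_mulVec, hY₁, ← mulVec_mulVec, ← mulVec_mulVec, hRv,
            hRY, sub_self]
        rw [← h, LinearMap.mem_ker, mulVecLin_apply] at this
        exact hD this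
    have hfin := Submodule.finrank_lt_finrank_of_lt hlt
    obtain ⟨O, hO1, hO2, hO3⟩ := ih Y₁ h1 h2 h3 (by omega)
    refine ⟨O * R, ?_, ?_, ?_⟩
    · rw [transpose_mul, hRt, Matrix.mul_assoc, ← Matrix.mul_assoc Oᵀ, hO1, Matrix.one_mul, hRR]
    · rw [transpose_mul, hRt, ← hO2, hY₁]
      simp only [Matrix.mul_assoc]
    · rw [← mulVec_mulVec, hRb, hO3]

theorem exists_specialOrthogonal_conj (hn : Even (Fintype.card n)) {Y Y' : Matrix n n ℝ}
    (hY : Yᵀ = -Y) (hY' : Y'ᵀ = -Y') {b b' : n → ℝ} (hb0 : b ≠ 0) (hbb : b ⬝ᵥ b = b' ⬝ᵥ b')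
    (hb : Y *ᵥ b = 0) (hb' : Y' *ᵥ b' = 0) (h : (Yᵀ * Y).charpoly = (Y'ᵀ * Y').charpoly) :
    ∃ W ∈ specialOrthogonalGroup n ℝ, W * Y * Wᵀ = Y' ∧ W *ᵥ b = b' := by
  have hB : b ⬝ᵥ b ≠ 0 := fun h => hb0 (dotProduct_self_eq_zero.1 h)
  have hB' : b' ⬝ᵥ b' ≠ 0 := by rwa [← hbb]
  have hb0' : b' ≠ 0 := by rintro rfl; simp at hB'
  -- With this constant b becomes an eigenvector of YᵗY − c bbᵗ of eigenvalue −1, isolated from the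
  -- nonnegative rest of the spectrum. A conjugating matrix must therefore send b to ±b'.
  set c := 1 / (b ⬝ᵥ b) with hc
  have hST (Y : Matrix n n ℝ) (b : n → ℝ) : (Yᵀ * Y - c • vecMulVec b b)ᵀ = Yᵀ * Y - c • vecMulVec b b := by
    rw [transpose_sub, transpose_mul, transpose_transpose, transpose_smul, transpose_vecMulVec]
  have hSb : (Yᵀ * Y) *ᵥ b = 0 := by rw [← mulVec_mulVec, hb, mulVec_zero]
  have hSb' : (Y'ᵀ * Y') *ᵥ b' = 0 := by rw [← mulVec_mulVec, hb', mulVec_zero]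
  have hchar : (Yᵀ * Y - c • vecMulVec b b).charpoly = (Y'ᵀ * Y' - c • vecMulVec b' b').charpoly := by
    apply charpoly_eq_of_eval (c := 0)
    intro t ht
    rw [det_sub_rank_one hSb _ _ ht.ne', det_sub_rank_one hSb' _ _ ht.ne', hbb, ← eval_charpoly,
      ← eval_charpoly, h]
  obtain ⟨O, hO1, hO2⟩ := exists_orthogonal_conj_of_charpoly_eq (hST Y b) (hST Y' b') hchar
  have hO1' : O * Oᵀ = 1 := mul_eq_one_comm.1 hO1
  -- `O b` is an eigenvector with eigenvalue `-1`
  have hOb : ∃ s : ℝ, s * s = 1 ∧ O *ᵥ b = s • b' := by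
    set u := O *ᵥ b with hu
    have h1 : (Y'ᵀ * Y' - c • vecMulVec b' b') *ᵥ u = -u := by
      rw [← hO2, hu, mulVec_mulVec, Matrix.mul_assoc, hO1, Matrix.mul_one, ← mulVec_mulVec, sub_mulVec,
        hSb, smul_mulVec, vecMulVec_mulVec, zero_sub, op_smul_eq_smul, smul_smul, hc,
        one_div_mul_cancel hB, one_smul, mulVec_neg]
    rw [sub_mulVec, smul_mulVec, vecMulVec_mulVec, op_smul_eq_smul, smul_smul] at h1
    set s := c * (b' ⬝ᵥ u) with hs
    have h2 : (Y'ᵀ * Y') *ᵥ (u - s • b') = -(u - s • b') := by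
      rw [mulVec_sub, mulVec_smul, hSb', smul_zero, sub_zero, neg_sub, sub_eq_iff_eq_add.1 h1]
      abel
    have h3 : u - s • b' = 0 := by
      have h4 := congrArg (fun w => (u - s • b') ⬝ᵥ w) h2
      rw [← mulVec_mulVec, dotProduct_mulVec, vecMul_transpose, dotProduct_neg] at h4
      have h5 := dotProduct_self_nonneg' (Y' *ᵥ (u - s • b'))
      have h6 := dotProduct_self_nonneg' (u - s • b')
      exact dotProduct_self_eq_zero.1 (by linarith)
    have h7 : u = s • b' := sub_eq_zero.1 h3
    refine ⟨s, ?_, h7⟩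
    have h8 : u ⬝ᵥ u = b ⬝ᵥ b := by
      rw [hu, dotProduct_mulVec, vecMul_mulVec, hO1, vecMul_one]
    rw [h7, smul_dotProduct, dotProduct_smul, hbb, smul_eq_mul, smul_eq_mul, ← mul_assoc] at h8
    exact mul_right_cancel₀ hB' (by rw [h8, one_mul])
  obtain ⟨s, hss, hOb⟩ := hOb
  -- normalize the sign
  set Q := s • O with hQ
  have hQ1 : Qᵀ * Q = 1 := by
    rw [hQ, transpose_smul, Matrix.smul_mul, Matrix.mul_smul, hO1, smul_smul, hss, one_smul]
  have hQb : Q *ᵥ b = b' := by rw [hQ, smul_mulVec, hOb, smul_smul, hss, one_smul]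
  have hQS : Q * (Yᵀ * Y) * Qᵀ = Y'ᵀ * Y' := by
    have e1 : Q * (Yᵀ * Y) * Qᵀ = O * (Yᵀ * Y) * Oᵀ := by
      rw [hQ, transpose_smul, Matrix.smul_mul, Matrix.smul_mul, Matrix.mul_smul, smul_smul, hss, one_smul]
    have e2 : O * vecMulVec b b * Oᵀ = vecMulVec b' b' := by
      rw [mul_vecMulVec, vecMulVec_mul, vecMul_transpose, hOb, smul_vecMulVec, vecMulVec_smul, smul_smul,
        hss, one_smul]
    rw [Matrix.mul_sub, Matrix.sub_mul, Matrix.mul_smul, Matrix.smul_mul, e2] at hO2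
    rw [e1]
    exact sub_left_inj.1 hO2
  set Y₁ := Q * Y * Qᵀ with hY₁
  have h1 : Y₁ᵀ = -Y₁ := by
    rw [hY₁, transpose_mul, transpose_mul, transpose_transpose, hY]; simp [Matrix.mul_assoc]
  have hQt : Qᵀ *ᵥ b' = b := by rw [← hQb, mulVec_mulVec, hQ1, one_mulVec]
  have h2 : Y₁ *ᵥ b' = 0 := by
    rw [hY₁, ← mulVec_mulVec, ← mulVec_mulVec, hQt, hb, mulVec_zero]
  have h3 : Y₁ * Y₁ = Y' * Y' := by
    have e1 : Y₁ * Y₁ = Q * (Y * (Qᵀ * Q) * Y) * Qᵀ := by rw [hY₁]; simp only [Matrix.mul_assoc]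
    rw [e1, hQ1, Matrix.mul_one]
    rw [hY, hY', Matrix.neg_mul, Matrix.neg_mul, Matrix.mul_neg, Matrix.neg_mul, neg_inj] at hQS
    exact hQS
  obtain ⟨V, hV1, hV2, hV3⟩ := exists_orthogonal_conj_of_sq_eq hY' b' hb' (Fintype.card n) Y₁ h1 h2 h3
    (Nat.le_add_right _ _)
  set W := V * Q with hW
  have hW1 : Wᵀ * W = 1 := by
    rw [hW, transpose_mul, Matrix.mul_assoc, ← Matrix.mul_assoc Vᵀ, hV1, Matrix.one_mul, hQ1]
  have hW2 : W * Y * Wᵀ = Y' := by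
    rw [hW, transpose_mul, ← hV2, hY₁]; simp only [Matrix.mul_assoc]
  have hW3 : W *ᵥ b = b' := by rw [hW, ← mulVec_mulVec, hQb, hV3]
  have hdet : W.det = 1 ∨ W.det = -1 := by
    have := congrArg det hW1
    rw [det_mul, det_transpose, det_one] at this
    exact mul_self_eq_one_iff.1 this
  rcases hdet with hdet | hdet
  · exact ⟨W, mem_specialOrthogonalGroup_iff.2 ⟨(mem_orthogonalGroup_iff' _ _).2 hW1, hdet⟩, hW2, hW3⟩
  -- Determinant correction: F fixes b' and commutes with Y', since Y'b' = 0, and det F = −1 because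
  -- the dimension is even.
  · set F := -eucRefl b' with hF
    have hFt : Fᵀ = F := by rw [hF, transpose_neg, eucRefl_transpose]
    have hFF : F * F = 1 := by rw [hF, neg_mul_neg, eucRefl_mul_self b' hb0']
    have hFb : F *ᵥ b' = b' := by
      rw [hF, neg_mulVec, eucRefl_mulVec, mul_div_assoc, div_self hB', mul_one, two_smul]
      simp
    have hFY : F * Y' * F = Y' := by
      have e1 : eucRefl b' * Y' = Y' := by
        have : b' ᵥ* Y' = 0 := by
          rw [← mulVec_transpose, hY', neg_mulVec, hb', neg_zero]
        rw [eucRefl, Matrix.sub_mul, Matrix.one_mul, Matrix.smul_mul, vecMulVec_mul, this]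
        simp
      have e2 : Y' * eucRefl b' = Y' := by
        rw [eucRefl, Matrix.mul_sub, Matrix.mul_one, Matrix.mul_smul, mul_vecMulVec, hb']
        simp
      rw [hF, Matrix.neg_mul, neg_mul_neg, e1, e2]
    refine ⟨F * W, mem_specialOrthogonalGroup_iff.2 ⟨(mem_orthogonalGroup_iff' _ _).2 ?_, ?_⟩, ?_, ?_⟩
    · change (F * W)ᵀ * (F * W) = 1
      rw [transpose_mul, hFt, Matrix.mul_assoc, ← Matrix.mul_assoc F, hFF, Matrix.one_mul, hW1]
    · rw [det_mul, hdet, hF, det_neg, hn.neg_one_pow, det_eucRefl b' hb0']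
      norm_num
    · rw [transpose_mul, hFt]
      calc F * W * Y * (Wᵀ * F) = F * (W * Y * Wᵀ) * F := by simp only [Matrix.mul_assoc]
        _ = Y' := by rw [hW2, hFY]
    · rw [← mulVec_mulVec, hW3, hFb]

end Skew

end SpinOrbit

namespace SpinOrbit

/-! ### The resolvent of an orbit element at an isotropic vector -/

theorem fromBlocks_sub_fromBlocks {l m n o : Type*} (A A' : Matrix n l ℝ) (B B' : Matrix n m ℝ)
    (C C' : Matrix o l ℝ) (D D' : Matrix o m ℝ) :
    fromBlocks A B C D - fromBlocks A' B' C' D' = fromBlocks (A - A') (B - B') (C - C') (D - D') := by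
  simp only [sub_eq_add_neg, fromBlocks_neg, fromBlocks_add]

theorem isUnit_det_sub_skew {n : Type*} [Fintype n] [DecidableEq n] {Y : Matrix n n ℝ}
    (hY : Yᵀ = -Y) {t : ℝ} (ht : t ≠ 0) : IsUnit (scalar n t - Y).det := by
  rw [isUnit_iff_ne_zero]
  intro h
  obtain ⟨v, hv, h0⟩ := exists_mulVec_eq_zero_iff.2 h
  have h1 := congrArg (fun w => v ⬝ᵥ w) h0
  have e : scalar n t *ᵥ v = t • v := by ext i; simp [scalar_apply, mulVec_diagonal]
  simp only [sub_mulVec, dotProduct_sub, skew_dotProduct_self hY, e, dotProduct_smul, dotProduct_zero,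
    sub_zero, smul_eq_mul] at h1
  exact hv (dotProduct_self_eq_zero.1 ((mul_eq_zero.1 h1).resolve_left ht))

/-- The rank one term lives in the last two coordinates, so the Schur complement of the invertible
block t − Y reduces the claim to a 2×2 determinant. -/
theorem det_sub_add_rank_one {r : ℕ} {Z : Matrix (Idx r) (Idx r) ℝ} (hZ : Z ∈ 𝔤 r) {t : ℝ}
    (ht : t ≠ 0) (s : ℝ) :
    (scalar (Idx r) t - Z + s • vecMulVec (v₀ r) (J r *ᵥ v₀ r)).det =
      (scalar (Idx r) t - Z).det - s * ((scalar (Coord r) t - Z.toBlocks₁₁).det *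
        (lin r Z ⬝ᵥ ((scalar (Coord r) t - Z.toBlocks₁₁)⁻¹ *ᵥ lin r Z))) := by
  have hu := isUnit_det_sub_skew (toBlocks₁₁_transpose hZ) ht
  set A := scalar (Coord r) t - Z.toBlocks₁₁ with hA
  let _ : Invertible A := A.invertibleOfIsUnitDet hu
  have hK : vecMulVec (v₀ r) (J r *ᵥ v₀ r) = fromBlocks 0 0 0 !![1, -1; 1, -1] := by
    ext i j
    rcases i with i | i <;> rcases j with j | j
    · simp [vecMulVec_apply]
    · simp [vecMulVec_apply]
    · simp [vecMulVec_apply, J, mulVec_diagonal]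
    · fin_cases i <;> fin_cases j <;> simp [vecMulVec_apply, J, mulVec_diagonal, sign]
  have hM : scalar (Idx r) t - Z = fromBlocks A (-Z.toBlocks₁₂) (-Z.toBlocks₂₁)
      (scalar (Fin 2) t - Z.toBlocks₂₂) := by
    conv_lhs => rw [← fromBlocks_toBlocks Z]
    have : scalar (Idx r) t = fromBlocks (scalar (Coord r) t) 0 0 (scalar (Fin 2) t) := by
      rw [scalar_apply, scalar_apply, scalar_apply, fromBlocks_diagonal]
      congr 1
      ext i; rcases i with i | i <;> rfl
    rw [this, fromBlocks_sub_fromBlocks, zero_sub, zero_sub]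
  have hM' : scalar (Idx r) t - Z + s • vecMulVec (v₀ r) (J r *ᵥ v₀ r) =
      fromBlocks A (-Z.toBlocks₁₂) (-Z.toBlocks₂₁)
      (scalar (Fin 2) t - Z.toBlocks₂₂ + s • !![1, -1; 1, -1]) := by
    rw [hM, hK, fromBlocks_smul, fromBlocks_add]
    simp
  rw [hM', hM, det_fromBlocks₁₁, det_fromBlocks₁₁, invOf_eq_nonsing_inv]
  set F := -Z.toBlocks₂₁ * A⁻¹ * -Z.toBlocks₁₂ with hF
  have hs (i j) : Z j i * sign r j = -(sign r i * Z i j) := by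
    have := congrFun (congrFun ((mem_𝔤 r Z).1 hZ) i) j
    simpa [J, mul_diagonal, diagonal_mul] using this
  have z00 : Z (Sum.inr 0) (Sum.inr 0) = 0 := by
    have := hs (Sum.inr 0) (Sum.inr 0); simp [sign] at this; linarith
  have z11 : Z (Sum.inr 1) (Sum.inr 1) = 0 := by
    have := hs (Sum.inr 1) (Sum.inr 1); simp [sign] at this; linarith
  have z01 : Z (Sum.inr 1) (Sum.inr 0) = Z (Sum.inr 0) (Sum.inr 1) := by
    have := hs (Sum.inr 0) (Sum.inr 1); simpa [sign] using this
  have hB : Z.toBlocks₁₂ *ᵥ 1 = lin r Z := by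
    ext i
    simp [mulVec, dotProduct, lin, Fintype.sum_sum_type, toBlocks₁₂]
  have hC : ![-1, 1] ᵥ* Z.toBlocks₂₁ = lin r Z := by
    ext i
    have f0 := hs (Sum.inr 0) (Sum.inl i)
    have f1 := hs (Sum.inr 1) (Sum.inl i)
    simp [sign] at f0 f1
    simp [vecMul, mulVec, dotProduct, lin, Fintype.sum_sum_type, toBlocks₂₁, f0, f1]
  have hFb : F 1 0 + F 1 1 - F 0 0 - F 0 1 = lin r Z ⬝ᵥ (A⁻¹ *ᵥ lin r Z) := by
    have e1 : ![-1, 1] ⬝ᵥ (F *ᵥ 1) = lin r Z ⬝ᵥ (A⁻¹ *ᵥ lin r Z) := by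
      rw [hF, ← mulVec_mulVec, ← mulVec_mulVec, neg_mulVec, neg_mulVec, hB, mulVec_neg, mulVec_neg, neg_neg,
        dotProduct_mulVec, hC]
    rw [← e1]
    simp [dotProduct, mulVec]
    ring
  rw [← hFb, det_fin_two, det_fin_two]
  simp [toBlocks₂₂, scalar_apply, z00, z11, z01]
  ring

/-! ### The matrix `t'_a` -/

/-- The diagonal of the square of `t'_a`. -/
def kap (r : ℕ) (a : Fin (r + 1) → ℝ) (c : ℝ) : Idx r → ℝ :=
  Sum.elim (fun i => -a i.2 ^ 2) (fun _ => c ^ 2)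

section
variable (r : ℕ) (a : Fin (r + 1) → ℝ) (c : ℝ)

theorem tMat_mulVec (u : Idx r → ℝ) : tMat r a c *ᵥ u = Sum.elim
    (fun i => if i.1 = 0 then a i.2 * u (Sum.inl (1, i.2)) else -(a i.2 * u (Sum.inl (0, i.2))))
    ![c * u (Sum.inr 1), c * u (Sum.inr 0)] := by
  ext i
  rcases i with ⟨s, i⟩ | i
  · have (j : Fin (r + 1)) (s' : Fin 2) : blockDiagonal (fun i => a i • blockH') (s, i) (s', j) =
        if i = j then a i * blockH' s s' else 0 := by
      simp [blockDiagonal_apply]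
    simp only [tMat, mulVec, dotProduct, Fintype.sum_sum_type, Fintype.sum_prod_type, fromBlocks_apply₁₁,
      fromBlocks_apply₁₂, this, Matrix.zero_apply, zero_mul, Finset.sum_const_zero, add_zero, ite_mul,
      Finset.sum_ite_eq, Finset.mem_univ, if_true, Fin.sum_univ_two]
    fin_cases s <;> simp [blockH']
  · fin_cases i <;> simp [tMat, mulVec, dotProduct, Fintype.sum_sum_type, blockH]

theorem tMat_mul_self : tMat r a c * tMat r a c = diagonal (kap r a c) := by
  apply ext_mulVec'
  intro u
  rw [← mulVec_mulVec, tMat_mulVec, tMat_mulVec]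
  ext i
  rw [mulVec_diagonal]
  rcases i with ⟨s, i⟩ | i
  · fin_cases s <;> simp [kap] <;> ring
  · fin_cases i <;> simp [kap] <;> ring

theorem tMat_sq_mulVec (u : Idx r → ℝ) :
    tMat r a c *ᵥ (tMat r a c *ᵥ u) = fun k => kap r a c k * u k := by
  rw [mulVec_mulVec, tMat_mul_self]
  ext k
  rw [mulVec_diagonal]

theorem det_sub_tMat (t : ℝ) : (scalar (Idx r) t - tMat r a c).det =
    (t ^ 2 - c ^ 2) * ∏ i, (t ^ 2 + a i ^ 2) := by
  have h : scalar (Idx r) t - tMat r a c = fromBlocks (blockDiagonal fun i => scalar (Fin 2) t - a i • blockH')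
      0 0 (scalar (Fin 2) t - c • blockH) := by
    have : scalar (Idx r) t = fromBlocks (scalar (Coord r) t) 0 0 (scalar (Fin 2) t) := by
      rw [scalar_apply, scalar_apply, scalar_apply, fromBlocks_diagonal]
      congr 1
      ext i; rcases i with i | i <;> rfl
    rw [this, tMat, fromBlocks_sub_fromBlocks, sub_zero, sub_zero]
    congr 1
    have h2 : scalar (Coord r) t = blockDiagonal fun _ : Fin (r + 1) => scalar (Fin 2) t := by
      simp only [scalar_apply]
      rw [blockDiagonal_diagonal]
    rw [h2, ← blockDiagonal_sub]
    rfl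
  rw [h, det_fromBlocks_zero₁₂, det_blockDiagonal, mul_comm]
  congr 1
  · rw [det_fin_two]
    simp [scalar_apply, blockH]
    ring
  · refine Finset.prod_congr rfl fun i _ => ?_
    rw [det_fin_two]
    simp [scalar_apply, blockH']
    ring

theorem kap_le (k : Idx r) : kap r a c k ≤ c ^ 2 := by
  rcases k with k | k
  · simp only [kap, Sum.elim_inl]; nlinarith [sq_nonneg (a k.2), sq_nonneg c]
  · simp [kap]

/-- Factor out t − T; the correction is a rank one perturbation of the identity governed by ⟨x, (t −
T)⁻¹x⟩. -/
theorem det_sub_tMat_add_rank_one {t : ℝ} (ht : c ^ 2 < t ^ 2) (x : Idx r → ℝ) (s : ℝ) :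
    (scalar (Idx r) t - tMat r a c + s • vecMulVec x (J r *ᵥ x)).det =
      (scalar (Idx r) t - tMat r a c).det *
        (1 + s * (t * ∑ k, sign r k * x k ^ 2 / (t ^ 2 - kap r a c k))) := by
  have h0 (k) : t ^ 2 - kap r a c k ≠ 0 := by have := kap_le r a c k; linarith
  -- Here w = (t² − T²)⁻¹x and z = (t + T)w = (t − T)⁻¹x. The part Tw is orthogonal to x by
  -- skewness.
  set w : Idx r → ℝ := fun k => x k / (t ^ 2 - kap r a c k) with hw
  set T := tMat r a c with hT
  set z := t • w + T *ᵥ w with hz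
  have hsc (v : Idx r → ℝ) : scalar (Idx r) t *ᵥ v = t • v := by
    ext i; simp [scalar_apply, mulVec_diagonal]
  have h1 : (scalar (Idx r) t - T) *ᵥ z = x := by
    rw [sub_mulVec, hsc, hz, mulVec_add, mulVec_smul, hT, tMat_sq_mulVec]
    ext k
    have := h0 k
    simp [hw]
    field_simp
    ring
  have h2 : scalar (Idx r) t - T + s • vecMulVec x (J r *ᵥ x) =
      (scalar (Idx r) t - T) * (1 + vecMulVec (s • z) (J r *ᵥ x)) := by
    rw [Matrix.mul_add, Matrix.mul_one, mul_vecMulVec, mulVec_smul, h1, smul_vecMulVec]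
  have h3 : (J r *ᵥ x) ⬝ᵥ z = bil r z x := by rw [bil, dotProduct_comm]
  have h4 : bil r (T *ᵥ w) x = 0 := by
    have e : bil r (T *ᵥ w) x = bil r (T *ᵥ x) w := by
      rw [bil_eq_sum, bil_eq_sum]
      refine Finset.sum_congr rfl fun k _ => ?_
      rw [hT, tMat_mulVec, tMat_mulVec]
      rcases k with ⟨s, i⟩ | i
      · fin_cases s <;> simp [hw, kap] <;> left <;> ring
      · fin_cases i <;> simp [hw, kap] <;> left <;> ring
    have e2 := bil_skew (tMat_mem r a c) w x
    rw [e, bil_comm] at e2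
    rw [e, bil_comm]
    linarith
  rw [h2, det_mul, det_one_add_vecMulVec, dotProduct_smul, h3, hz, bil_add_left, h4, bil_smul_left,
    bil_eq_sum, smul_eq_mul, add_zero]
  congr 4
  refine Finset.sum_congr rfl fun k _ => ?_
  simp [hw]
  ring

/-- The element `t'_a` of `𝔤`. -/
def tElt : 𝔤 r := ⟨tMat r a c, tMat_mem r a c⟩

/-- Conjugation by ρ(k) carries v₀ to ρ(k)⁻¹v₀ and Ad(k)T to T without changing the determinant; the
coefficients of s in the two evaluations agree. -/
theorem resolvent_eq (k : G r) {t : ℝ} (ht0 : t ≠ 0) (ht : c ^ 2 < t ^ 2) :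
    (scalar (Idx r) t - tMat r a c).det *
      (t * ∑ i, sign r i * (ρ r k⁻¹ *ᵥ v₀ r) i ^ 2 / (t ^ 2 - kap r a c i)) =
    -((scalar (Coord r) t - (Ad r k (tElt r a c)).1.toBlocks₁₁).det *
      (lin r (Ad r k (tElt r a c)).1 ⬝ᵥ
        ((scalar (Coord r) t - (Ad r k (tElt r a c)).1.toBlocks₁₁)⁻¹ *ᵥ lin r (Ad r k (tElt r a c)).1))) := by
  have h (s : ℝ) : (scalar (Idx r) t - (Ad r k (tElt r a c)).1 + s • vecMulVec (v₀ r) (J r *ᵥ v₀ r)).det =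
      (scalar (Idx r) t - tMat r a c + s • vecMulVec (ρ r k⁻¹ *ᵥ v₀ r) (J r *ᵥ (ρ r k⁻¹ *ᵥ v₀ r))).det := by
    have e : scalar (Idx r) t - (Ad r k (tElt r a c)).1 + s • vecMulVec (v₀ r) (J r *ᵥ v₀ r) =
        ρ r k * (scalar (Idx r) t - tMat r a c + s • vecMulVec (ρ r k⁻¹ *ᵥ v₀ r) (J r *ᵥ (ρ r k⁻¹ *ᵥ v₀ r)))
          * ρ r k⁻¹ := by
      have e1 := ρ_transpose_mul_J r k⁻¹
      rw [inv_inv] at e1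
      rw [Matrix.mul_add, Matrix.add_mul, Matrix.mul_sub, Matrix.sub_mul, Matrix.mul_smul, Matrix.smul_mul,
        mul_vecMulVec, vecMulVec_mul, ← mulVec_transpose, mulVec_mulVec, mulVec_mulVec, mulVec_mulVec, e1,
        ρ_mul_inv, one_mulVec, Matrix.mul_assoc (J r), ρ_mul_inv, Matrix.mul_one, Ad_coe,
        (scalar_commute t (fun _ => mul_comm _ _) (ρ r k)).symm.eq, Matrix.mul_assoc (scalar _ _), ρ_mul_inv, Matrix.mul_one]
      rfl
    have hd : (ρ r k).det * (ρ r k⁻¹).det = 1 := by rw [← det_mul, ρ_mul_inv, det_one]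
    rw [e, det_mul, det_mul, mul_right_comm, hd, one_mul]
  have h1 := h 1
  have h0 := h 0
  rw [det_sub_add_rank_one (Ad r k _).2 ht0, det_sub_tMat_add_rank_one r a c ht] at h1 h0
  linarith

end

end SpinOrbit

namespace SpinOrbit

/-! ### Weights of an isotropic vector and singular values of the corresponding orbit -/

section
variable {r : ℕ} (a : Fin (r + 1) → ℝ) (c : ℝ)

/-- The weights which an isotropic vector puts on the invariant planes of `t'_a`. -/
def wt (x : Idx r → ℝ) (i : Fin (r + 1)) : ℝ :=
  (x (Sum.inl (0, i)) ^ 2 + x (Sum.inl (1, i)) ^ 2) * (a i ^ 2 + c ^ 2)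

theorem wt_nonneg (x : Idx r → ℝ) (i : Fin (r + 1)) : 0 ≤ wt a c x i := by
  unfold wt; positivity

theorem null_eq {x : Idx r → ℝ} (hx : bil r x x = 0) :
    x (Sum.inr 0) ^ 2 - x (Sum.inr 1) ^ 2 =
      -∑ i, (x (Sum.inl (0, i)) ^ 2 + x (Sum.inl (1, i)) ^ 2) := by
  rw [bil_apply] at hx
  simp only [dotProduct, Fintype.sum_prod_type, Fin.sum_univ_two, Function.comp] at hx
  rw [Finset.sum_add_distrib]
  simp only [sq]
  linarith

/-- Isotropy eliminates the last two coordinates, and 1/(t² + a²) − 1/(t² − c²) has numerator −(a² +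
c²). This is the source of that factor in `wt`. -/
theorem resolvent_null {x : Idx r → ℝ} (hx : bil r x x = 0) {t : ℝ} (ht : c ^ 2 < t ^ 2) :
    (scalar (Idx r) t - tMat r a c).det * (t * ∑ i, sign r i * x i ^ 2 / (t ^ 2 - kap r a c i)) =
      -(t * ∑ k, wt a c x k * ∏ i, (t ^ 2 + a (k.succAbove i) ^ 2)) := by
  have hc : t ^ 2 - c ^ 2 ≠ 0 := by linarith
  have ha (i) : t ^ 2 + a i ^ 2 ≠ 0 := by nlinarith [sq_nonneg (a i), sq_nonneg c]
  have h1 : ∑ i, sign r i * x i ^ 2 / (t ^ 2 - kap r a c i) =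
      ∑ i, (x (Sum.inl (0, i)) ^ 2 + x (Sum.inl (1, i)) ^ 2) / (t ^ 2 + a i ^ 2) +
        (x (Sum.inr 0) ^ 2 - x (Sum.inr 1) ^ 2) / (t ^ 2 - c ^ 2) := by
    rw [Fintype.sum_sum_type, Fintype.sum_prod_type, Fin.sum_univ_two, Fin.sum_univ_two,
      ← Finset.sum_add_distrib]
    simp [sign, kap, add_div, sub_div]
    ring
  rw [det_sub_tMat, h1, null_eq hx, neg_div, Finset.sum_div, ← sub_eq_add_neg, ← Finset.sum_sub_distrib,
    Finset.mul_sum, Finset.mul_sum, Finset.mul_sum, ← Finset.sum_neg_distrib]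
  refine Finset.sum_congr rfl fun k _ => ?_
  rw [Fin.prod_univ_succAbove _ k, wt]
  have := ha k
  field_simp
  ring

theorem lin_dotProduct_lin {Z : Matrix (Idx r) (Idx r) ℝ} (hZ : Z ∈ 𝔤 r) :
    lin r Z ⬝ᵥ lin r Z = bil r (Z *ᵥ v₀ r) (Z *ᵥ v₀ r) := by
  rw [mulVec_v₀ hZ, bil_add_left, bil_add_right, bil_add_right, bil_smul_left, bil_smul_left,
    bil_smul_right, bil_smul_right, bil_v₀_v₀, bil_comm r (v₀ r), bil_v₀, bil_inl]
  simp

/-- Both sides equal ⟨Tx, Tx⟩ = −⟨x, T²x⟩ for the isotropic vector x = ρ(k)⁻¹v₀. -/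
theorem lin_sq (k : G r) :
    lin r (Ad r k (tElt r a c)).1 ⬝ᵥ lin r (Ad r k (tElt r a c)).1 = ∑ i, wt a c (ρ r k⁻¹ *ᵥ v₀ r) i := by
  have hx : bil r (ρ r k⁻¹ *ᵥ v₀ r) (ρ r k⁻¹ *ᵥ v₀ r) = 0 := by rw [bil_ρ, bil_v₀_v₀]
  rw [lin_dotProduct_lin (Ad r k _).2, conj_mulVec, bil_ρ]
  generalize ρ r k⁻¹ *ᵥ v₀ r = x at *
  change bil r (tMat r a c *ᵥ x) (tMat r a c *ᵥ x) = _
  have h := null_eq hx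
  rw [bil_skew (tMat_mem r a c), tMat_sq_mulVec, bil_apply]
  simp only [dotProduct, Fintype.sum_prod_type, Fin.sum_univ_two, Function.comp, kap, Sum.elim_inl,
    Sum.elim_inr]
  have e : -(∑ i, x (Sum.inl (0, i)) * (-a i ^ 2 * x (Sum.inl (0, i))) +
      ∑ i, x (Sum.inl (1, i)) * (-a i ^ 2 * x (Sum.inl (1, i))) +
      x (Sum.inr 0) * (c ^ 2 * x (Sum.inr 0)) - x (Sum.inr 1) * (c ^ 2 * x (Sum.inr 1))) =
      ∑ i, (x (Sum.inl (0, i)) ^ 2 + x (Sum.inl (1, i)) ^ 2) * a i ^ 2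
        - c ^ 2 * (x (Sum.inr 0) ^ 2 - x (Sum.inr 1) ^ 2) := by
    rw [← Finset.sum_add_distrib, neg_sub, sub_add_eq_sub_sub, sub_eq_add_neg (x (Sum.inr 1) * _)]
    rw [← Finset.sum_neg_distrib, mul_sub]
    have : ∑ i, -(x (Sum.inl (0, i)) * (-a i ^ 2 * x (Sum.inl (0, i))) +
        x (Sum.inl (1, i)) * (-a i ^ 2 * x (Sum.inl (1, i)))) =
        ∑ i, (x (Sum.inl (0, i)) ^ 2 + x (Sum.inl (1, i)) ^ 2) * a i ^ 2 :=
      Finset.sum_congr rfl fun i _ => by ring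
    rw [this]
    ring
  rw [e, h, mul_neg, sub_neg_eq_add, Finset.mul_sum, ← Finset.sum_add_distrib]
  exact Finset.sum_congr rfl fun i _ => by rw [wt]; ring

/-- Every functional which does not vanish on `𝔫` is conjugate under `N` to some `pr X_{Y,β,0}` with
`Y β = 0`. -/
theorem exists_normalize (Z : 𝔤 r) (hb : lin r Z.1 ≠ 0) : ∃ p : P r, ∃ α : Coord r → ℝ,
    ρ r p = nMat r α ∧ lin r (Ad r p Z).1 = lin r Z.1 ∧ tau r (Ad r p Z).1 = 0 ∧
      (Ad r p Z).1.toBlocks₁₁ *ᵥ lin r Z.1 = 0 := by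
  have hB : lin r Z.1 ⬝ᵥ lin r Z.1 ≠ 0 := fun h => hb (dotProduct_self_eq_zero.1 h)
  set b := lin r Z.1 with hbdef
  set Y := Z.1.toBlocks₁₁ with hY
  -- The solution of Yb − (α·b)b + |b|²α = 0 with α·b = −τ. The two conditions are compatible
  -- because b·Yb = 0.
  set α : Coord r → ℝ := (-(1 / (b ⬝ᵥ b))) • (Y *ᵥ b + tau r Z.1 • b) with hα
  obtain ⟨k, hk⟩ := exists_lift_nMat r α
  have hk' : ρ r k⁻¹ = nMat r (-α) := by
    have h1 : ρ r k⁻¹ * (ρ r k * nMat r (-α)) = ρ r k⁻¹ := by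
      rw [hk, nMat_mul, add_neg_cancel, nMat_zero, Matrix.mul_one]
    rw [← h1, ← Matrix.mul_assoc, ρ_inv_mul, Matrix.one_mul]
  have hkP : k ∈ P r := mem_P_of_ray r k 1 (by rw [hk, nMat_mulVec_v₀, one_smul])
  have hYb : b ⬝ᵥ (Y *ᵥ b) = 0 := skew_dotProduct_self (toBlocks₁₁_transpose Z.2) b
  have hαb : α ⬝ᵥ b = -tau r Z.1 := by
    rw [hα, smul_dotProduct, add_dotProduct, dotProduct_comm (Y *ᵥ b) b, hYb, smul_dotProduct]
    simp only [smul_eq_mul]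
    field_simp
    ring
  have e : (Ad r k Z).1 = nMat r α * Z.1 * nMat r (-α) := by rw [Ad_coe, hk, hk']
  have h1 := lin_of_mulVec_v₀ (nMat_conj_v₀ Z.2 α)
  rw [← e] at h1
  refine ⟨⟨k, hkP⟩, α, hk, h1.1, ?_, ?_⟩
  · change tau r (Ad r k Z).1 = 0
    rw [h1.2, hαb, add_neg_cancel]
  · change (Ad r k Z).1.toBlocks₁₁ *ᵥ b = 0
    rw [e, nMat_conj_toBlocks₁₁ Z.2, add_mulVec, sub_mulVec, vecMulVec_mulVec, vecMulVec_mulVec, hαb]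
    simp only [op_smul_eq_smul]
    change Y *ᵥ b - _ • b + (b ⬝ᵥ b) • α = 0
    rw [hα, smul_smul, mul_neg, mul_one_div_cancel hB]
    simp
    abel

-- When Yb = 0 the resolvent acts on b as 1/t, so `resolvent_eq` computes det(t − Y). Then (t − Y)(t
-- − Y)ᵗ = t² + YᵗY gives the characteristic polynomial at −t².
open Polynomial in
theorem charpoly_transpose_mul_self (k : G r)
    (hb : lin r (Ad r k (tElt r a c)).1 ≠ 0)
    (hYb : (Ad r k (tElt r a c)).1.toBlocks₁₁ *ᵥ lin r (Ad r k (tElt r a c)).1 = 0)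
    (y : Fin r → ℝ) (hy : ∀ μ, ∑ l, wt a c (ρ r k⁻¹ *ᵥ v₀ r) l * ∏ i, (μ + a (l.succAbove i) ^ 2) =
      (∑ l, wt a c (ρ r k⁻¹ *ᵥ v₀ r) l) * ∏ i, (μ + y i)) :
    ((Ad r k (tElt r a c)).1.toBlocks₁₁ᵀ * (Ad r k (tElt r a c)).1.toBlocks₁₁).charpoly =
      X ^ 2 * ∏ i, (X - C (y i)) ^ 2 := by
  have hx : bil r (ρ r k⁻¹ *ᵥ v₀ r) (ρ r k⁻¹ *ᵥ v₀ r) = 0 := by rw [bil_ρ, bil_v₀_v₀]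
  have hB : lin r (Ad r k (tElt r a c)).1 ⬝ᵥ lin r (Ad r k (tElt r a c)).1 ≠ 0 :=
    fun h => hb (dotProduct_self_eq_zero.1 h)
  have hYt := toBlocks₁₁_transpose (Ad r k (tElt r a c)).2
  have hsq := lin_sq a c k
  have hres := fun t ht0 ht => resolvent_eq r a c k (t := t) ht0 ht
  generalize (Ad r k (tElt r a c)).1.toBlocks₁₁ = Y at *
  generalize lin r (Ad r k (tElt r a c)).1 = b at *
  have hdet (t : ℝ) (ht : |c| < t) : (scalar (Coord r) t - Y).det = t ^ 2 * ∏ i, (t ^ 2 + y i) := by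
    have ht0 : 0 < t := lt_of_le_of_lt (abs_nonneg c) ht
    have ht2 : c ^ 2 < t ^ 2 := sq_lt_sq' (by linarith [neg_abs_le c]) (by linarith [le_abs_self c])
    have h1 := hres t ht0.ne' ht2
    have hu := isUnit_det_sub_skew hYt ht0.ne'
    have h2 : (scalar (Coord r) t - Y)⁻¹ *ᵥ b = t⁻¹ • b := by
      have e : (scalar (Coord r) t - Y) *ᵥ (t⁻¹ • b) = b := by
        have e1 : scalar (Coord r) t *ᵥ b = t • b := by ext i; simp [scalar_apply, mulVec_diagonal]
        rw [mulVec_smul, sub_mulVec, hYb, sub_zero, e1, smul_smul, inv_mul_cancel₀ ht0.ne', one_smul]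
      conv_lhs => rw [← e]
      rw [mulVec_mulVec, nonsing_inv_mul _ hu, one_mulVec]
    rw [resolvent_null a c hx ht2, hy, ← hsq, h2, dotProduct_smul, smul_eq_mul] at h1
    have h3 : t * ((b ⬝ᵥ b) * ∏ i, (t ^ 2 + y i)) = (scalar (Coord r) t - Y).det * (t⁻¹ * (b ⬝ᵥ b)) := by
      linarith
    field_simp at h3
    linarith
  have hcard : Even (Fintype.card (Coord r)) := by simp
  apply Polynomial.eq_of_infinite_eval_eq
  refine Set.Infinite.mono (s := (fun t : ℝ => -t ^ 2) '' Set.Ioi |c|) ?_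
    ((Set.Ioi_infinite |c|).image ?_)
  · rintro _ ⟨t, ht, rfl⟩
    have ht0 : 0 < t := lt_of_le_of_lt (abs_nonneg c) ht
    change eval _ _ = eval _ _
    rw [eval_charpoly]
    have h1 : scalar (Coord r) (-t ^ 2) - Yᵀ * Y = -((scalar (Coord r) t - Y) * (scalar (Coord r) t - Y)ᵀ) := by
      have e : (scalar (Coord r) t)ᵀ = scalar (Coord r) t := by rw [scalar_apply, diagonal_transpose]
      have e2 : scalar (Coord r) (-t ^ 2) = -(scalar (Coord r) t * scalar (Coord r) t) := by
        rw [← map_mul, ← map_neg, sq]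
      have e3 : scalar (Coord r) t * Y = Y * scalar (Coord r) t := (scalar_commute t (fun _ => mul_comm _ _) Y).eq
      rw [transpose_sub, e, hYt, e2, sub_neg_eq_add, Matrix.sub_mul, Matrix.mul_add, Matrix.mul_add, e3]
      simp only [Matrix.neg_mul]
      abel
    rw [h1, det_neg, hcard.neg_one_pow, det_mul, det_transpose, hdet t ht]
    simp only [eval_mul, eval_pow, eval_X, eval_prod, eval_sub, eval_C]
    have h2 : ∏ i, (-t ^ 2 - y i) ^ 2 = (∏ i, (t ^ 2 + y i)) * ∏ i, (t ^ 2 + y i) := by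
      rw [← Finset.prod_mul_distrib]
      exact Finset.prod_congr rfl fun i _ => by ring
    rw [h2]
    ring
  · intro s hs t ht h
    have hs0 : 0 < s := lt_of_le_of_lt (abs_nonneg c) hs
    have ht0 : 0 < t := lt_of_le_of_lt (abs_nonneg c) ht
    have : s ^ 2 = t ^ 2 := by simpa using h
    exact (sq_eq_sq₀ hs0.le ht0.le).1 this

theorem Ad_Ad (k l : G r) (Z : 𝔤 r) : Ad r k (Ad r l Z) = Ad r (k * l) Z := by
  apply Subtype.ext
  rw [Ad_coe, Ad_coe, Ad_coe, _root_.mul_inv_rev, map_mul, map_mul]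
  simp only [Matrix.mul_assoc]

/-- The normalization takes place inside N, which fixes v₀, so the weights are unaffected. The
factor 1/2 compensates `lin_oppMat`. -/
theorem hasSingularValues_orbit (k : G r) (hb : lin r (Ad r k (tElt r a c)).1 ≠ 0)
    (x : Fin r → ℝ) (hanti : Antitone x) (hx0 : ∀ i, 0 ≤ x i)
    (hy : ∀ μ, ∑ l, wt a c (ρ r k⁻¹ *ᵥ v₀ r) l * ∏ i, (μ + a (l.succAbove i) ^ 2) =
      (∑ l, wt a c (ρ r k⁻¹ *ᵥ v₀ r) l) * ∏ i, (μ + x i ^ 2)) :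
    HasSingularValues r (MulAction.orbit (P r) (pr r (Ad r k (tElt r a c)))) x := by
  obtain ⟨p, α, hp, h1, h2, h3⟩ := exists_normalize (Ad r k (tElt r a c)) hb
  rw [Ad_Ad] at h1 h2 h3
  rw [← h1] at h3
  have hk : ρ r (p * k : G r)⁻¹ *ᵥ v₀ r = ρ r k⁻¹ *ᵥ v₀ r := by
    rw [_root_.mul_inv_rev, map_mul, ← mulVec_mulVec]
    congr 1
    have : ρ r (p : G r) *ᵥ v₀ r = v₀ r := by rw [hp, nMat_mulVec_v₀]
    rw [ρ_mulVec_eq_iff] at this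
    exact this.symm
  have hb' : lin r (Ad r (p * k) (tElt r a c)).1 ≠ 0 := by rwa [h1]
  have hchar := charpoly_transpose_mul_self a c (p * k) hb' h3 (fun i => x i ^ 2) (by rw [hk]; exact hy)
  set Z := Ad r (p * k) (tElt r a c) with hZ
  refine ⟨hanti, hx0, Z.1.toBlocks₁₁, (1 / 2 : ℝ) • lin r Z.1,
    ⟨_, oppMat_mem r _ (toBlocks₁₁_transpose Z.2) ((1 / 2 : ℝ) • lin r Z.1) 0⟩, rfl, ?_, ?_, ?_, hchar⟩
  · exact smul_ne_zero (by norm_num) hb'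
  · rw [mulVec_smul, h3, smul_zero]
  · refine ⟨p, ?_⟩
    change p • pr r _ = _
    rw [smul_pr, Ad_Ad, pr_eq_iff]
    refine ⟨?_, ?_, ?_⟩
    · simp [oppMat, hZ]
    · rw [lin_oppMat, smul_smul]
      norm_num
      rfl
    · rw [tau_oppMat]; exact h2

end

end SpinOrbit

namespace SpinOrbit

/-! ### Interlacing numbers in the degenerate case -/

section
variable {r : ℕ} {A w : Fin (r + 1) → ℝ} {y : Fin r → ℝ}

/-- Partial fraction form of the interlacing identity; y_i is paired with A_{i+1} so that
interlacing makes every quotient at least 1. -/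
theorem sum_div_eq (hA : ∀ k, 0 ≤ A k)
    (h : ∀ μ, ∑ k, w k * ∏ i, (μ + A (k.succAbove i)) = (∑ k, w k) * ∏ i, (μ + y i))
    {μ : ℝ} (hμ : 0 < μ) :
    ∑ k, w k / (μ + A k) = (∑ k, w k) / (μ + A 0) * ∏ i, (μ + y i) / (μ + A i.succ) := by
  have h0 (k) : μ + A k ≠ 0 := by have := hA k; positivity
  have hP : ∏ k, (μ + A k) ≠ 0 := Finset.prod_ne_zero_iff.2 fun k _ => h0 k
  have e : ∑ k, w k / (μ + A k) = (∑ k, w k * ∏ i, (μ + A (k.succAbove i))) / ∏ k, (μ + A k) := by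
    rw [Finset.sum_div]
    refine Finset.sum_congr rfl fun k _ => ?_
    have hk : ∏ i, (μ + A (k.succAbove i)) ≠ 0 := Finset.prod_ne_zero_iff.2 fun i _ => h0 _
    rw [Fin.prod_univ_succAbove _ k, mul_div_mul_right _ _ hk]
  rw [e, h, Fin.prod_univ_succ, Finset.prod_div_distrib, div_mul_div_comm]

theorem eq_zero_of_forall_le_mul {x C : ℝ} (hx : 0 ≤ x) (h : ∀ μ : ℝ, 0 < μ → μ ≤ 1 → x ≤ C * μ) : x = 0 := by
  by_contra hne
  have hx' : 0 < x := lt_of_le_of_ne hx (Ne.symm hne)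
  have h1 := h 1 one_pos le_rfl
  have hC : 0 < C := by linarith
  have h2 := h (min 1 (x / (2 * C))) (lt_min one_pos (by positivity)) (min_le_left _ _)
  have h3 : C * min 1 (x / (2 * C)) ≤ C * (x / (2 * C)) :=
    mul_le_mul_of_nonneg_left (min_le_right _ _) hC.le
  have h4 : C * (x / (2 * C)) = x / 2 := by field_simp
  linarith

/-- As μ → 0⁺ the sum of w_k/(μ + A_k) stays bounded, whereas y_i > 0 over A_{i+1} = 0 would make
the product grow like 1/μ. -/
theorem interlacing_eq_zero (hA : ∀ k, 0 ≤ A k) (hw : ∀ k, 0 ≤ w k) (hS : 0 < ∑ k, w k)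
    (hy : ∀ i, A i.succ ≤ y i)
    (h : ∀ μ, ∑ k, w k * ∏ i, (μ + A (k.succAbove i)) = (∑ k, w k) * ∏ i, (μ + y i))
    (h0 : ∀ k, A k = 0 → w k = 0) (i : Fin r) (hi : A i.succ = 0) : y i = 0 := by
  have hyi : 0 ≤ y i := hi ▸ hy i
  set S := ∑ k, w k with hSdef
  -- Terms with A k = 0 count as zero here, in agreement with their vanishing weight.
  set C := ∑ k, w k / A k with hC
  have hC0 : 0 ≤ C := Finset.sum_nonneg fun k _ => div_nonneg (hw k) (hA k)
  refine eq_zero_of_forall_le_mul (C := C * (1 + A 0) / S) hyi fun μ hμ hμ1 => ?_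
  have h1 := sum_div_eq hA h hμ
  have h2 : ∑ k, w k / (μ + A k) ≤ C := by
    refine Finset.sum_le_sum fun k _ => ?_
    rcases (hA k).eq_or_lt with hk | hk
    · rw [h0 k hk.symm]; simp
    · exact div_le_div_of_nonneg_left (hw k) hk (by linarith)
  have hA0 := hA 0
  have h3 : (μ + y i) / (μ + A i.succ) ≤ ∏ i, (μ + y i) / (μ + A i.succ) := by
    have hone (j) : 1 ≤ (μ + y j) / (μ + A j.succ) := by
      rw [one_le_div (by have := hA j.succ; positivity)]
      linarith [hy j]
    rw [← Finset.mul_prod_erase Finset.univ _ (Finset.mem_univ i)]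
    refine le_mul_of_one_le_right (by have := hone i; linarith) ?_
    exact Finset.prod_induction _ (fun x => 1 ≤ x) (fun _ _ => one_le_mul_of_one_le_of_one_le) le_rfl
      (fun j _ => hone j)
  rw [hi, add_zero] at h3
  have h4 : S / (μ + A 0) * ((μ + y i) / μ) ≤ C :=
    (mul_le_mul_of_nonneg_left h3 (by positivity)).trans (h1 ▸ h2)
  rw [div_mul_div_comm, div_le_iff₀ (by positivity)] at h4
  rw [div_mul_eq_mul_div, le_div_iff₀ hS]
  have h5 : C * ((μ + A 0) * μ) ≤ C * ((1 + A 0) * μ) := by gcongr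
  nlinarith

/-- The same comparison read backwards: now the product stays bounded as μ → 0⁺, so w_k/μ is
bounded. -/
theorem weight_eq_zero (hA : ∀ k, 0 ≤ A k) (hA0 : 0 < A 0) (hw : ∀ k, 0 ≤ w k)
    (hy : ∀ i, A i.succ ≤ y i)
    (h : ∀ μ, ∑ k, w k * ∏ i, (μ + A (k.succAbove i)) = (∑ k, w k) * ∏ i, (μ + y i))
    (h0 : ∀ i : Fin r, A i.succ = 0 → y i = 0) (k : Fin (r + 1)) (hk : A k = 0) : w k = 0 := by
  have hS : 0 ≤ ∑ k, w k := Finset.sum_nonneg fun k _ => hw k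
  refine eq_zero_of_forall_le_mul (C := (∑ k, w k) / A 0 *
    ∏ i : Fin r, if A i.succ = 0 then 1 else y i / A i.succ) (hw k) fun μ hμ _ => ?_
  have h1 := sum_div_eq hA h hμ
  have h2 : w k / μ ≤ ∑ k, w k / (μ + A k) := by
    have := Finset.single_le_sum (f := fun k => w k / (μ + A k))
      (fun k _ => div_nonneg (hw k) (by have := hA k; positivity)) (Finset.mem_univ k)
    simpa [hk] using this
  have h3 : ∏ i, (μ + y i) / (μ + A i.succ) ≤
      ∏ i : Fin r, if A i.succ = 0 then 1 else y i / A i.succ := by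
    refine Finset.prod_le_prod (fun i _ => ?_) fun i _ => ?_
    · have := hA i.succ
      have := hy i
      have : 0 ≤ y i := by linarith
      positivity
    · split_ifs with hi
      · rw [h0 i hi, hi, div_self (by linarith)]
      · have hpos : 0 < A i.succ := lt_of_le_of_ne (hA _) (Ne.symm hi)
        rw [div_le_div_iff₀ (by positivity) hpos]
        nlinarith [hy i]
  have h4 : (∑ k, w k) / (μ + A 0) ≤ (∑ k, w k) / A 0 :=
    div_le_div_of_nonneg_left hS hA0 (by linarith)
  have h5 : 0 ≤ ∏ i, (μ + y i) / (μ + A i.succ) := Finset.prod_nonneg fun i _ => by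
    have := hA i.succ
    have := hy i
    have : 0 ≤ y i := by linarith
    positivity
  have h6 := h2.trans_eq h1
  rw [← div_le_iff₀ hμ]
  refine h6.trans (mul_le_mul h4 h3 h5 (by positivity))

end

end SpinOrbit

namespace SpinOrbit

/-! ### The centralizer of `t'_a` -/

theorem refl_conj_mulVec {r : ℕ} {Z : Matrix (Idx r) (Idx r) ℝ} (hZ : Z ∈ 𝔤 r) (d u : Idx r → ℝ) :
    refl r d *ᵥ (Z *ᵥ (refl r d *ᵥ u)) =
      Z *ᵥ u - (2 / bil r d d) • (bil r d u • (Z *ᵥ d) - bil r (Z *ᵥ d) u • d) := by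
  have h1 : bil r d (Z *ᵥ u) = -bil r (Z *ᵥ d) u := by rw [bil_skew hZ, neg_neg]
  have h2 : bil r d (Z *ᵥ d) = 0 := by
    have := bil_skew hZ d d
    rw [bil_comm] at this
    linarith
  simp only [refl_mulVec, mulVec_sub, mulVec_smul, bil_sub_right, bil_smul_right, h1, h2]
  ext i
  simp
  ring

/-- By `refl_conj_mulVec` the hypothesis says that both reflections conjugate Z to the same matrix,
so their product commutes with Z. -/
theorem exists_commuting_rotor {r : ℕ} {Z : Matrix (Idx r) (Idx r) ℝ} (hZ : Z ∈ 𝔤 r) {d e : Idx r → ℝ}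
    (hd : 0 < bil r d d) (he : 0 < bil r e e)
    (h : ∀ u, (2 / bil r d d) • (bil r d u • (Z *ᵥ d) - bil r (Z *ᵥ d) u • d) =
      (2 / bil r e e) • (bil r e u • (Z *ᵥ e) - bil r (Z *ᵥ e) u • e)) :
    ∃ k : G r, ρ r k = refl r e * refl r d ∧ ρ r k * Z = Z * ρ r k := by
  obtain ⟨k, hk⟩ := exists_rotor r e d he hd
  refine ⟨k, hk, ?_⟩
  have e1 : refl r d * Z * refl r d = refl r e * Z * refl r e := by
    apply ext_mulVec'
    intro u
    rw [← mulVec_mulVec, ← mulVec_mulVec, ← mulVec_mulVec, ← mulVec_mulVec, refl_conj_mulVec hZ,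
      refl_conj_mulVec hZ, h]
  have hd2 := refl_mul_self r d hd.ne'
  have he2 := refl_mul_self r e he.ne'
  calc ρ r k * Z = refl r e * (refl r d * Z * refl r d) * refl r d := by
        rw [hk]; simp only [Matrix.mul_assoc]; rw [hd2, Matrix.mul_one]
    _ = (refl r e * refl r e) * Z * refl r e * refl r d := by rw [e1]; simp only [Matrix.mul_assoc]
    _ = Z * ρ r k := by rw [he2, hk, Matrix.one_mul, Matrix.mul_assoc]

theorem exists_commuting_rotor_of_kernel {r : ℕ} {Z : Matrix (Idx r) (Idx r) ℝ} (hZ : Z ∈ 𝔤 r)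
    {d e : Idx r → ℝ} (hd : 0 < bil r d d) (he : 0 < bil r e e) (hd0 : Z *ᵥ d = 0) (he0 : Z *ᵥ e = 0) :
    ∃ k : G r, ρ r k = refl r e * refl r d ∧ ρ r k * Z = Z * ρ r k := by
  refine exists_commuting_rotor hZ hd he fun u => ?_
  simp [hd0, he0]

/-- The span of d and Zd is Z-invariant, and the normalized skew form d ∧ Zd takes the same value
for any anisotropic e in it. -/
theorem exists_commuting_rotor_of_sq {r : ℕ} {Z : Matrix (Idx r) (Idx r) ℝ} (hZ : Z ∈ 𝔤 r)
    {d e : Idx r → ℝ} (hd : 0 < bil r d d) (he : 0 < bil r e e) (κ p s : ℝ) (hκ : Z *ᵥ (Z *ᵥ d) = κ • d)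
    (hed : e = p • d + s • (Z *ᵥ d)) :
    ∃ k : G r, ρ r k = refl r e * refl r d ∧ ρ r k * Z = Z * ρ r k := by
  refine exists_commuting_rotor hZ hd he fun u => ?_
  have h2 : bil r d (Z *ᵥ d) = 0 := by
    have := bil_skew hZ d d
    rw [bil_comm] at this
    linarith
  have h3 : bil r (Z *ᵥ d) (Z *ᵥ d) = -κ * bil r d d := by
    rw [bil_skew hZ, hκ, bil_smul_right, neg_mul]
  have hN : bil r e e = (p ^ 2 - κ * s ^ 2) * bil r d d := by
    rw [hed]
    simp only [bil_add_left, bil_add_right, bil_smul_left, bil_smul_right, h2, bil_comm r (Z *ᵥ d) d, h3]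
    ring
  have hc : p ^ 2 - κ * s ^ 2 ≠ 0 := by
    intro h0; rw [h0, zero_mul] at hN; exact he.ne' hN
  have hd' := hd.ne'
  have hZe : Z *ᵥ e = p • (Z *ᵥ d) + (s * κ) • d := by
    rw [hed, mulVec_add, mulVec_smul, mulVec_smul, hκ, smul_smul]
  rw [hN, hZe]
  ext i
  rw [hed]
  simp only [bil_add_left, bil_smul_left, Pi.smul_apply, Pi.sub_apply, Pi.add_apply, smul_eq_mul]
  field_simp
  ring

section
variable {r : ℕ} {a : Fin (r + 1) → ℝ} {c : ℝ}

theorem bil_eq_zero_of_support {κ : ℝ} {y u : Idx r → ℝ} (hy : ∀ k, kap r a c k ≠ κ → y k = 0)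
    (hu : ∀ k, kap r a c k = κ → u k = 0) : bil r y u = 0 := by
  rw [bil_eq_sum]
  refine Finset.sum_eq_zero fun k _ => ?_
  by_cases hk : kap r a c k = κ
  · rw [hu k hk]; simp
  · rw [hy k hk]; simp

theorem tMat_sq_of_support {κ : ℝ} {y : Idx r → ℝ} (hy : ∀ k, kap r a c k ≠ κ → y k = 0) :
    tMat r a c *ᵥ (tMat r a c *ᵥ y) = κ • y := by
  rw [tMat_sq_mulVec]
  ext k
  by_cases hk : kap r a c k = κ
  · simp [hk]
  · simp [hy k hk]

theorem tMat_of_support_zero {y : Idx r → ℝ} (hy : ∀ k, kap r a c k ≠ 0 → y k = 0) :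
    tMat r a c *ᵥ y = 0 := by
  rw [tMat_mulVec]
  ext k
  rcases k with ⟨s, i⟩ | k
  · by_cases h : a i = 0
    · simp [h]
    · have h0 := hy (Sum.inl (0, i)) (by simpa [kap] using h)
      have h1 := hy (Sum.inl (1, i)) (by simpa [kap] using h)
      simp [h0, h1]
  · by_cases h : c = 0
    · fin_cases k <;> simp [h]
    · have h0 := hy (Sum.inr 0) (by simpa [kap] using h)
      have h1 := hy (Sum.inr 1) (by simpa [kap] using h)
      fin_cases k <;> simp [h0, h1]

theorem bil_self_nonneg_of_support {κ : ℝ} (hκ : κ ≠ c ^ 2) {y : Idx r → ℝ}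
    (hy : ∀ k, kap r a c k ≠ κ → y k = 0) : 0 ≤ bil r y y ∧ (bil r y y = 0 → y = 0) := by
  have h0 : y (Sum.inr 0) = 0 := hy _ (by simpa [kap] using hκ.symm)
  have h1 : y (Sum.inr 1) = 0 := hy _ (by simpa [kap] using hκ.symm)
  rw [bil_apply, h0, h1]
  simp only [mul_zero, add_zero, sub_zero]
  refine ⟨dotProduct_self_nonneg' _, fun h => ?_⟩
  have := dotProduct_self_eq_zero.1 h
  ext k
  rcases k with k | k
  · exact congrFun this k
  · fin_cases k
    · exact h0
    · exact h1

theorem two_mul_bil_sub {y y' : Idx r → ℝ} (hN : bil r y y = bil r y' y') :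
    2 * bil r (y - y') y' = -bil r (y - y') (y - y') := by
  simp only [bil_sub_left, bil_sub_right, bil_comm r y' y, hN]
  ring

/-- Two vectors of the same length in an eigenspace of the square of `t'_a` are conjugate under the
centralizer of `t'_a`. -/
theorem exists_centralizer_swap (κ : ℝ) {y y' : Idx r → ℝ} (hy : ∀ k, kap r a c k ≠ κ → y k = 0)
    (hy' : ∀ k, kap r a c k ≠ κ → y' k = 0) (hN : bil r y y = bil r y' y')
    (hpos : κ = c ^ 2 → bil r y y < 0 ∧ 0 < y (Sum.inr 1) ∧ 0 < y' (Sum.inr 1)) :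
    ∃ h : G r, ρ r h * tMat r a c = tMat r a c * ρ r h ∧ ρ r h *ᵥ y = y' ∧
      ∀ u, (∀ k, kap r a c k = κ → u k = 0) → ρ r h *ᵥ u = u := by
  by_cases hyy : y = y'
  · exact ⟨1, by simp, by simp [hyy], by simp⟩
  have hT := tMat_mem r a c
  have hd' : y - y' ≠ 0 := sub_ne_zero.2 hyy
  have hds : ∀ k, kap r a c k ≠ κ → (y - y') k = 0 := fun k hk => by simp [hy k hk, hy' k hk]
  have h2 := two_mul_bil_sub hN
  have key (d e : Idx r → ℝ) (hd : 0 < bil r d d) (he : 0 < bil r e e) (hdd : d = y - y')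
      (hes : ∀ k, kap r a c k ≠ κ → e k = 0) (hey : bil r e y' = 0)
      (hk : ∃ k : G r, ρ r k = refl r e * refl r d ∧ ρ r k * tMat r a c = tMat r a c * ρ r k) :
      ∃ h : G r, ρ r h * tMat r a c = tMat r a c * ρ r h ∧ ρ r h *ᵥ y = y' ∧
      ∀ u, (∀ k, kap r a c k = κ → u k = 0) → ρ r h *ᵥ u = u := by
    obtain ⟨k, hk1, hk2⟩ := hk
    refine ⟨k, hk2, ?_, fun u hu => ?_⟩
    · rw [hk1, ← mulVec_mulVec, hdd, refl_sub r y y' hN (hdd ▸ hd.ne'), refl_mulVec, hey]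
      simp
    · have h1 : refl r d *ᵥ u = u := by
        rw [refl_mulVec, bil_eq_zero_of_support (hdd ▸ hds) hu]
        simp
      rw [hk1, ← mulVec_mulVec, h1, refl_mulVec, bil_eq_zero_of_support hes hu]
      simp
  by_cases hκ : κ = c ^ 2
  · obtain ⟨hneg, hyt, hyt'⟩ := hpos hκ
    have hneg' : bil r y' y' < 0 := hN ▸ hneg
    by_cases hc : c = 0
    · have hκ0 : κ = 0 := by rw [hκ, hc]; ring
      have hsum : bil r (y + y') (y + y') < 0 := by
        have := bil_neg_of_future r y y' hneg hyt hneg'.le hyt'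
        simp only [bil_add_left, bil_add_right, bil_comm r y' y]
        linarith
      have hd : 0 < bil r (y - y') (y - y') := by
        refine bil_pos_of_orthogonal r (y + y') _ hsum ?_ hd'
        simp only [bil_add_left, bil_sub_right, bil_comm r y' y]
        linarith
      -- Exchanging the last two coordinates gives a vector orthogonal to y', spacelike because y'
      -- is timelike.
      set e : Idx r → ℝ := Sum.elim 0 ![y' (Sum.inr 1), y' (Sum.inr 0)] with he
      have he0 : e ∘ Sum.inl = 0 := by ext i; simp [he]
      have hes : ∀ k, kap r a c k ≠ κ → e k = 0 := by
        intro k hk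
        rcases k with k | k
        · simp [he]
        · exact absurd (by simp [kap, hκ]) hk
      have hee : 0 < bil r e e := by
        rw [bil_apply] at hneg' ⊢
        have := dotProduct_self_nonneg' (y' ∘ Sum.inl)
        rw [he0]
        simp [he]
        linarith
      refine key _ e hd hee rfl hes ?_ (exists_commuting_rotor_of_kernel hT hd hee
        (tMat_of_support_zero (by rwa [hκ0] at hds)) (tMat_of_support_zero (by rwa [hκ0] at hes)))
      rw [bil_apply, he0]
      simp [he]
      ring
    · have hsupp (z : Idx r → ℝ) (hz : ∀ k, kap r a c k ≠ κ → z k = 0) :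
          z = Sum.elim (0 : Coord r → ℝ) ![z (Sum.inr 0), z (Sum.inr 1)] := by
        ext k
        rcases k with k | k
        · rw [hz]
          · simp
          · have : 0 < c ^ 2 := by positivity
            simp only [kap, Sum.elim_inl, hκ]
            nlinarith [sq_nonneg (a k.2)]
        · fin_cases k <;> simp
      have hNe (z : Idx r → ℝ) (hz : ∀ k, kap r a c k ≠ κ → z k = 0) :
          bil r z z = z (Sum.inr 0) ^ 2 - z (Sum.inr 1) ^ 2 := by
        rw [hsupp z hz, bil_apply]
        have : (Sum.elim (0 : Coord r → ℝ) ![z (Sum.inr 0), z (Sum.inr 1)]) ∘ Sum.inl = 0 := by ext; simp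
        rw [this]
        simp
        ring
      rw [hNe y hy, hNe y' hy'] at hN
      rw [hNe y hy] at hneg
      rw [hNe y' hy'] at hneg'
      have hpos1 (p q : ℝ) (h : p ^ 2 - q ^ 2 < 0) (hq : 0 < q) : 0 < p + q ∧ 0 < q - p := by
        constructor <;> nlinarith
      obtain ⟨p1, p2⟩ := hpos1 _ _ hneg hyt
      obtain ⟨p1', p2'⟩ := hpos1 _ _ hneg' hyt'
      -- For c ≠ 0 the eigenspace is the Lorentzian plane of the last two coordinates; the boost
      -- matches the lightcone coordinates, whose products agree.
      set s := Real.log ((y' (Sum.inr 0) + y' (Sum.inr 1)) / (y (Sum.inr 0) + y (Sum.inr 1))) with hs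
      have es : Real.exp s = (y' (Sum.inr 0) + y' (Sum.inr 1)) / (y (Sum.inr 0) + y (Sum.inr 1)) :=
        Real.exp_log (by positivity)
      have es' : Real.exp (-s) = (y' (Sum.inr 1) - y' (Sum.inr 0)) / (y (Sum.inr 1) - y (Sum.inr 0)) := by
        rw [Real.exp_neg, es, inv_div, div_eq_div_iff p1'.ne' p2.ne']
        linarith
      obtain ⟨k, hk⟩ := exists_lift_aMat r s
      refine ⟨k, ?_, ?_, fun u hu => ?_⟩
      · rw [hk, aMat, tMat, fromBlocks_multiply, fromBlocks_multiply]
        congr 1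
        · simp
        · simp
        · simp
        · ext i j; fin_cases i <;> fin_cases j <;> simp [blockH, mul_comm]
      · rw [hk, aMat, hsupp y hy, hsupp y' hy', fromBlocks_mulVec]
        have c1 := Real.cosh_eq s
        have c2 := Real.sinh_eq s
        ext i
        rcases i with i | i
        · simp
        · fin_cases i
          · simp [mulVec, dotProduct]
            rw [c1, c2, es, es']
            field_simp
            ring
          · simp [mulVec, dotProduct]
            rw [c1, c2, es, es']
            field_simp
            ring
      · have hu' : u = Sum.elim (u ∘ Sum.inl) 0 := by
          ext i
          rcases i with i | i
          · simp
          · simpa using hu _ (by simp [kap, hκ])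
        rw [hu', hk, aMat_mulVec_inl]
  · have hdef := bil_self_nonneg_of_support hκ hds
    have hd : 0 < bil r (y - y') (y - y') :=
      lt_of_le_of_ne hdef.1 fun h => hd' (hdef.2 h.symm)
    by_cases hκ0 : κ = 0
    · subst hκ0
      -- A quarter turn of y' in every coordinate plane: same length, orthogonal to y', still in the
      -- kernel of T.
      set e : Idx r → ℝ := Sum.elim
        (fun i => if i.1 = 0 then y' (Sum.inl (1, i.2)) else -y' (Sum.inl (0, i.2))) 0 with he
      have hes : ∀ k, kap r a c k ≠ 0 → e k = 0 := by
        rintro (⟨s, i⟩ | k) hk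
        · have h0 := hy' (Sum.inl (0, i)) (by simpa [kap] using hk)
          have h1 := hy' (Sum.inl (1, i)) (by simpa [kap] using hk)
          simp [he, h0, h1]
        · simp [he]
      have hy0 : y' (Sum.inr 0) = 0 := hy' _ (by simpa [kap] using hκ ∘ Eq.symm)
      have hy1 : y' (Sum.inr 1) = 0 := hy' _ (by simpa [kap] using hκ ∘ Eq.symm)
      have hee : bil r e e = bil r y' y' := by
        rw [bil_apply, bil_apply, hy0, hy1]
        simp [dotProduct, Fintype.sum_prod_type, he, add_comm]
      have hy'pos := bil_self_nonneg_of_support hκ hy'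
      have hypos := bil_self_nonneg_of_support hκ hy
      have hpos' : 0 < bil r e e := by
        rw [hee]
        refine lt_of_le_of_ne hy'pos.1 fun h => hyy ?_
        rw [hy'pos.2 h.symm, hypos.2 (hN.trans h.symm)]
      refine key _ e hd hpos' rfl hes ?_ (exists_commuting_rotor_of_kernel hT hd hpos'
        (tMat_of_support_zero hds) (tMat_of_support_zero hes))
      rw [bil_apply]
      simp only [dotProduct, Fintype.sum_prod_type, he, Fin.sum_univ_two]
      simp
      exact add_neg_eq_zero.2 (Finset.sum_congr rfl fun i _ => mul_comm _ _)
    · have hlt : κ < 0 := by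
        by_contra hge
        apply hyy
        have : ∀ k, kap r a c k ≠ κ := by
          rintro (k | k) hk
          · simp only [kap, Sum.elim_inl] at hk
            have := sq_nonneg (a k.2)
            exact hκ0 (le_antisymm (by linarith) (not_lt.1 hge))
          · simp only [kap, Sum.elim_inr] at hk
            exact hκ hk.symm
        ext k
        rw [hy k (this k), hy' k (this k)]
      set d := y - y' with hdd
      -- The coefficients p and s are chosen so that p d + s Td is orthogonal to y'; s is half the
      -- squared length of d.
      set p := bil r (tMat r a c *ᵥ d) y' with hp
      set s := -bil r d y' with hs
      have hsq := tMat_sq_of_support hds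
      have hs0 : 0 < s := by rw [hs]; linarith
      have hTd : ∀ k, kap r a c k ≠ κ → (tMat r a c *ᵥ d) k = 0 := by
        rintro (⟨t, i⟩ | k) hk
        · have h0 := hds (Sum.inl (0, i)) (by simpa [kap] using hk)
          have h1 := hds (Sum.inl (1, i)) (by simpa [kap] using hk)
          rw [tMat_mulVec]
          simp [h0, h1]
        · have h0 := hds (Sum.inr 0) (by simpa [kap] using hk)
          have h1 := hds (Sum.inr 1) (by simpa [kap] using hk)
          rw [tMat_mulVec]
          fin_cases k <;> simp [h0, h1]
      have hd2 : bil r d (tMat r a c *ᵥ d) = 0 := by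
        have := bil_skew hT d d
        rw [bil_comm] at this
        linarith
      have hd3 : bil r (tMat r a c *ᵥ d) (tMat r a c *ᵥ d) = -κ * bil r d d := by
        rw [bil_skew hT, hsq, bil_smul_right, neg_mul]
      have hee : 0 < bil r (p • d + s • (tMat r a c *ᵥ d)) (p • d + s • (tMat r a c *ᵥ d)) := by
        simp only [bil_add_left, bil_add_right, bil_smul_left, bil_smul_right, hd2,
          bil_comm r (tMat r a c *ᵥ d) d, hd3]
        have : 0 < s * (s * (-κ * bil r d d)) := by
          have : 0 < -κ := by linarith
          positivity
        nlinarith [mul_nonneg (sq_nonneg p) hd.le]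
      refine key d _ hd hee rfl (fun k hk => ?_) ?_
        (exists_commuting_rotor_of_sq hT hd hee κ p s hsq rfl)
      · simp [hds k hk, hTd k hk]
      · rw [bil_add_left, bil_smul_left, bil_smul_left, hp, hs]
        ring

end

end SpinOrbit

namespace SpinOrbit

/-! ### Eigencomponents of isotropic vectors and the fibres of depth one -/

section
variable {r : ℕ} (a : Fin (r + 1) → ℝ) (c : ℝ)

/-- The component of a vector in an eigenspace of the square of `t'_a`. -/
noncomputable def comp (κ : ℝ) (x : Idx r → ℝ) : Idx r → ℝ :=
  fun k => if kap r a c k = κ then x k else 0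

variable {a c}

theorem comp_support (κ : ℝ) (x : Idx r → ℝ) (k : Idx r) (hk : kap r a c k ≠ κ) : comp a c κ x k = 0 := by
  simp [comp, hk]

theorem bil_comp (κ : ℝ) (x : Idx r → ℝ) : bil r (comp a c κ x) (comp a c κ x) =
    ∑ i with kap r a c i = κ, sign r i * x i ^ 2 := by
  rw [bil_eq_sum, Finset.sum_filter]
  refine Finset.sum_congr rfl fun i _ => ?_
  by_cases h : kap r a c i = κ <;> simp [comp, h, sq]

/-- All other eigencomponents are spacelike and the total is zero. If this one were not timelike,
the others would vanish and with them all the weights. -/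
theorem bil_comp_neg {x : Idx r → ℝ} (hx : bil r x x = 0) (hw : ∑ i, wt a c x i ≠ 0) :
    bil r (comp a c (c ^ 2) x) (comp a c (c ^ 2) x) < 0 := by
  have h1 : ∑ i with kap r a c i = c ^ 2, sign r i * x i ^ 2 +
      ∑ i with ¬kap r a c i = c ^ 2, sign r i * x i ^ 2 = 0 := by
    rw [Finset.sum_filter_add_sum_filter_not, ← hx, bil_eq_sum]
    exact Finset.sum_congr rfl fun i _ => by rw [sq]
  have hs : ∀ i, kap r a c i ≠ c ^ 2 → sign r i = 1 := by
    rintro (i | i) hi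
    · rfl
    · exact absurd rfl hi
  have h2 : ∀ i ∈ Finset.univ.filter (fun i => ¬kap r a c i = c ^ 2), 0 ≤ sign r i * x i ^ 2 := by
    intro i hi
    rw [hs i (Finset.mem_filter.1 hi).2]
    positivity
  rw [bil_comp]
  by_contra hge
  apply hw
  have h3 := Finset.sum_nonneg h2
  have h4 := (Finset.sum_eq_zero_iff_of_nonneg h2).1 (by linarith)
  have h5 : ∀ i, kap r a c i ≠ c ^ 2 → x i = 0 := by
    intro i hi
    have := h4 i (by simpa using hi)
    rw [hs i hi, one_mul] at this
    exact pow_eq_zero_iff (two_ne_zero) |>.1 this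
  refine Finset.sum_eq_zero fun i _ => ?_
  rw [wt]
  by_cases hi : a i ^ 2 + c ^ 2 = 0
  · rw [hi, mul_zero]
  · have hi' : -a i ^ 2 ≠ c ^ 2 := fun h => hi (by linarith)
    rw [h5 (Sum.inl (0, i)) hi', h5 (Sum.inl (1, i)) hi']
    simp

/-- The eigencomponents are moved one at a time, each move fixing the complementary coordinates. -/
theorem exists_centralizer_move {x x' : Idx r → ℝ}
    (hN : ∀ κ, bil r (comp a c κ x) (comp a c κ x) = bil r (comp a c κ x') (comp a c κ x'))
    (hneg : bil r (comp a c (c ^ 2) x) (comp a c (c ^ 2) x) < 0) (hx : 0 < x (Sum.inr 1))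
    (hx' : 0 < x' (Sum.inr 1)) :
    ∃ h : G r, ρ r h * tMat r a c = tMat r a c * ρ r h ∧ ρ r h *ᵥ x = x' := by
  have key (S : Finset ℝ) : ∃ h : G r, ρ r h * tMat r a c = tMat r a c * ρ r h ∧
      ∀ k, (ρ r h *ᵥ x) k = if kap r a c k ∈ S then x' k else x k := by
    induction S using Finset.induction_on with
    | empty => exact ⟨1, by simp, by simp⟩
    | insert κ S hκ ih =>
      obtain ⟨h, h1, h2⟩ := ih
      obtain ⟨l, l1, l2, l3⟩ := exists_centralizer_swap (a := a) (c := c) κ (comp_support κ x)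
        (comp_support κ x') (hN κ) (by
          rintro rfl
          exact ⟨hneg, by simpa [comp, kap] using hx, by simpa [comp, kap] using hx'⟩)
      refine ⟨l * h, ?_, fun k => ?_⟩
      · rw [map_mul, Matrix.mul_assoc, h1, ← Matrix.mul_assoc, l1, Matrix.mul_assoc]
      · have e : ρ r h *ᵥ x = comp a c κ x + (ρ r h *ᵥ x - comp a c κ x) := by abel
        rw [map_mul, ← mulVec_mulVec, e, mulVec_add, l2, l3]
        · simp only [Pi.add_apply, Pi.sub_apply, h2, comp, Finset.mem_insert]
          by_cases hk : kap r a c k = κ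
          · simp [hk, hκ]
          · simp [hk]
        · intro k hk
          simp [h2, comp, hk, hκ]
  obtain ⟨h, h1, h2⟩ := key (Finset.univ.image (kap r a c))
  refine ⟨h, h1, ?_⟩
  ext k
  rw [h2, if_pos (Finset.mem_image_of_mem _ (Finset.mem_univ k))]

theorem det_sub_tMat_ne_zero {t : ℝ} (ht : c ^ 2 < t ^ 2) : (scalar (Idx r) t - tMat r a c).det ≠ 0 := by
  rw [det_sub_tMat]
  refine mul_ne_zero (by linarith) (Finset.prod_ne_zero_iff.2 fun i _ => ?_)
  nlinarith [sq_nonneg (a i), sq_nonneg c]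

/-- The restriction to `𝔭` of the functional determines the lengths of the components of the
isotropic vector. -/
theorem bil_comp_eq {k k' : G r} (h : pr r (Ad r k (tElt r a c)) = pr r (Ad r k' (tElt r a c))) (κ : ℝ) :
    bil r (comp a c κ (ρ r k⁻¹ *ᵥ v₀ r)) (comp a c κ (ρ r k⁻¹ *ᵥ v₀ r)) =
      bil r (comp a c κ (ρ r k'⁻¹ *ᵥ v₀ r)) (comp a c κ (ρ r k'⁻¹ *ᵥ v₀ r)) := by
  obtain ⟨hY, hb, -⟩ := (pr_eq_iff _ _).1 h
  set x := ρ r k⁻¹ *ᵥ v₀ r with hx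
  set x' := ρ r k'⁻¹ *ᵥ v₀ r with hx'
  -- The right side of `resolvent_eq` depends only on the restriction, so the two partial fraction
  -- sums agree for large μ = t²; `D κ` below is the difference of their residues.
  have h1 (μ : ℝ) (hμ : c ^ 2 < μ) : ∑ i, sign r i * (x i ^ 2 - x' i ^ 2) / (μ - kap r a c i) = 0 := by
    have hμ0 : 0 < μ := lt_of_le_of_lt (sq_nonneg c) hμ
    have hs : √μ ^ 2 = μ := Real.sq_sqrt hμ0.le
    have ht0 : √μ ≠ 0 := (Real.sqrt_pos.2 hμ0).ne'
    have r1 := resolvent_eq r a c k ht0 (hs.symm ▸ hμ)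
    have r2 := resolvent_eq r a c k' ht0 (hs.symm ▸ hμ)
    rw [hY, hb, ← r2] at r1
    have r3 := mul_left_cancel₀ ht0 (mul_left_cancel₀ (det_sub_tMat_ne_zero (hs.symm ▸ hμ)) r1)
    rw [hs] at r3
    simp only [mul_sub, sub_div, Finset.sum_sub_distrib]
    exact sub_eq_zero.2 r3
  set D : ℝ → ℝ := fun κ => ∑ i with kap r a c i = κ, sign r i * (x i ^ 2 - x' i ^ 2) with hD
  have h2 (μ : ℝ) (hμ : c ^ 2 < μ) : ∑ κ ∈ Finset.univ.image (kap r a c), D κ / (μ - κ) = 0 := by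
    rw [← h1 μ hμ, ← Finset.sum_fiberwise_of_maps_to
      (fun i _ => Finset.mem_image_of_mem (kap r a c) (Finset.mem_univ i))]
    refine Finset.sum_congr rfl fun κ _ => ?_
    rw [hD, Finset.sum_div]
    refine Finset.sum_congr rfl fun i hi => ?_
    rw [(Finset.mem_filter.1 hi).2]
  have h3 : D κ = 0 := by
    by_cases hκ : κ ∈ Finset.univ.image (kap r a c)
    · exact eq_zero_of_sum_div_eq_zero _ D (c ^ 2) h2 κ hκ
    · refine Finset.sum_eq_zero fun i hi => absurd ?_ hκ
      rw [← (Finset.mem_filter.1 hi).2]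
      exact Finset.mem_image_of_mem _ (Finset.mem_univ i)
  rw [bil_comp, bil_comp, ← sub_eq_zero, ← Finset.sum_sub_distrib, ← h3, hD]
  exact Finset.sum_congr rfl fun i _ => by rw [mul_sub]

theorem smul_semisimpleElt_eq_iff (k : G r) :
    k • semisimpleElt r a c = semisimpleElt r a c ↔ ρ r k * tMat r a c = tMat r a c * ρ r k := by
  change k • iota r (tElt r a c) = iota r (tElt r a c) ↔ _
  rw [smul_iota, (iota_injective r).eq_iff, Subtype.ext_iff, Ad_coe]
  change ρ r k * tMat r a c * ρ r k⁻¹ = tMat r a c ↔ _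
  constructor
  · intro h
    rw [← h, Matrix.mul_assoc (_ * _), ρ_inv_mul, Matrix.mul_one, h]
  · intro h
    rw [h, Matrix.mul_assoc, ρ_mul_inv, Matrix.mul_one]

theorem v₀_future (k : G r) : 0 < (ρ r k *ᵥ v₀ r) (Sum.inr 1) :=
  ray_pos (isLor_ρ r k) (v₀ r) (bil_v₀_v₀ r).le (by simp [v₀])

/-- Points of the orbit of `f` whose restrictions to `𝔭` agree and have depth one are conjugate
under `P`. -/
theorem exists_smul_eq_of_res_eq {k k' : G r}
    (h : res r (k • semisimpleElt r a c) = res r (k' • semisimpleElt r a c))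
    (hb : lin r (Ad r k (tElt r a c)).1 ≠ 0) :
    ∃ p : P r, (p : G r) • k • semisimpleElt r a c = k' • semisimpleElt r a c := by
  have h' : pr r (Ad r k (tElt r a c)) = pr r (Ad r k' (tElt r a c)) := by
    rw [← res_smul_iota, ← res_smul_iota]; exact h
  have hw : ∑ i, wt a c (ρ r k⁻¹ *ᵥ v₀ r) i ≠ 0 := by
    rw [← lin_sq]; exact fun h0 => hb (dotProduct_self_eq_zero.1 h0)
  obtain ⟨l, l1, l2⟩ := exists_centralizer_move (bil_comp_eq h')
    (bil_comp_neg (by rw [bil_ρ, bil_v₀_v₀]) hw) (v₀_future _) (v₀_future _)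
  have hp : k' * l * k⁻¹ ∈ P r := by
    refine mem_P_of_ray r _ 1 ?_
    rw [map_mul, map_mul, ← mulVec_mulVec, ← mulVec_mulVec, l2, one_smul, mulVec_mulVec, ρ_mul_inv,
      one_mulVec]
  refine ⟨⟨_, hp⟩, ?_⟩
  change (k' * l * k⁻¹) • k • semisimpleElt r a c = _
  rw [smul_smul, inv_mul_cancel_right, mul_smul, (smul_semisimpleElt_eq_iff l).2 l1]

end

end SpinOrbit

namespace SpinOrbit

/-! ### Matrices which commute with a complex structure -/

/-- Over ℂ the block matrix becomes triangular with diagonal blocks A − iB and its conjugate, so the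
determinant is |det(A − iB)|². -/
theorem det_fromBlocks_neg_nonneg {n : Type*} [Fintype n] [DecidableEq n] (A B : Matrix n n ℝ) :
    0 ≤ (fromBlocks A B (-B) A).det := by
  set A' := A.map (algebraMap ℝ ℂ) with hA
  set B' := B.map (algebraMap ℝ ℂ) with hB
  have h1 : ((fromBlocks A B (-B) A).det : ℂ) = (fromBlocks A' B' (-B') A').det := by
    have := RingHom.map_det (algebraMap ℝ ℂ) (fromBlocks A B (-B) A)
    rw [RingHom.mapMatrix_apply, fromBlocks_map] at this
    have e : (-B).map (algebraMap ℝ ℂ) = -B' := by ext; simp [hB]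
    rw [e] at this
    exact this
  have h2 : fromBlocks 1 (Complex.I • 1) 0 1 * fromBlocks A' B' (-B') A' * fromBlocks 1 (-Complex.I • 1) 0 1 =
      fromBlocks (A' - Complex.I • B') 0 (-B') (A' + Complex.I • B') := by
    rw [fromBlocks_multiply, fromBlocks_multiply]
    congr 1
    · simp [sub_eq_add_neg]
    · ext i j
      simp only [neg_smul, Matrix.one_mul, smul_mul, Matrix.mul_neg, Matrix.mul_one, Matrix.mul_smul, smul_neg,
        Matrix.add_apply, Matrix.neg_apply, Matrix.smul_apply, smul_eq_mul, Matrix.zero_apply]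
      have := Complex.I_mul_I
      linear_combination B' i j * this
    · simp
    · simp [add_comm]
  have h3 : (fromBlocks A' B' (-B') A').det = (A' - Complex.I • B').det * (A' + Complex.I • B').det := by
    have := congrArg det h2
    rwa [det_mul, det_mul, det_fromBlocks_zero₂₁, det_fromBlocks_zero₂₁, det_fromBlocks_zero₁₂, det_one, one_mul,
      one_mul, mul_one] at this
  have h4 : (A' + Complex.I • B').det = starRingEnd ℂ (A' - Complex.I • B').det := by
    rw [RingHom.map_det]
    congr 1
    ext i j
    simp [hA, hB, RingHom.mapMatrix_apply]
  rw [h4, Complex.mul_conj] at h3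
  rw [h3] at h1
  have h5 := Complex.ofReal_injective h1
  rw [h5]
  exact Complex.normSq_nonneg _

/-- Up to the signs of the a_i, V commutes with a complex structure. The sign matrix S enters twice,
so it does not affect the sign of the determinant. -/
theorem det_nonneg_of_commute {n : Type*} [Fintype n] [DecidableEq n] {a : n → ℝ} (ha : ∀ i, a i ≠ 0)
    {V : Matrix (Fin 2 × n) (Fin 2 × n) ℝ}
    (h : V * blockDiagonal (fun i => a i • blockH') = blockDiagonal (fun i => a i • blockH') * V) :
    0 ≤ V.det := by
  have hl (s i t j) : (V * blockDiagonal (fun i => a i • blockH')) (s, i) (t, j) =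
      V (s, i) (0, j) * (a j * blockH' 0 t) + V (s, i) (1, j) * (a j * blockH' 1 t) := by
    rw [Matrix.mul_apply, Fintype.sum_prod_type, Fin.sum_univ_two]
    simp [blockDiagonal_apply]
  have hr (s i t j) : (blockDiagonal (fun i => a i • blockH') * V) (s, i) (t, j) =
      (a i * blockH' s 0) * V (0, i) (t, j) + (a i * blockH' s 1) * V (1, i) (t, j) := by
    rw [Matrix.mul_apply, Fintype.sum_prod_type, Fin.sum_univ_two]
    simp [blockDiagonal_apply]
  have e (s i t j) := (hl s i t j).symm.trans ((congrFun (congrFun h (s, i)) (t, j)).trans (hr s i t j))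
  have hs (i) : a i / |a i| * (a i / |a i|) = 1 := by
    rw [div_mul_div_comm, abs_mul_abs_self, div_self (mul_self_ne_zero.2 (ha i))]
  -- Entries of V can be nonzero only between planes with |a_i| = |a_j|.
  have habs {i j : n} {p q : ℝ} (h1 : p * a j = a i * q) (h2 : q * a j = a i * p) :
      q = a i / |a i| * p * (a j / |a j|) := by
    by_cases hp : p = 0
    · rw [hp, zero_mul] at h1
      rw [(mul_eq_zero.1 h1.symm).resolve_left (ha i), hp]
      simp
    · have h3 : a j ^ 2 = a i ^ 2 := by
        apply mul_left_cancel₀ hp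
        linear_combination a j * h1 + a i * h2
      have h4 := (sq_eq_sq_iff_abs_eq_abs _ _).1 h3
      have h5 : a i / |a i| * p * (a j / |a j|) = (p * a j) * (a i / |a i| ^ 2) := by
        rw [h4]; ring
      rw [h5, h1, sq_abs]
      have := ha i
      field_simp
  set A : Matrix n n ℝ := of fun i j => V (0, i) (0, j) with hA
  set B : Matrix n n ℝ := of fun i j => V (0, i) (1, j) with hB
  set S : Matrix n n ℝ := diagonal fun i => a i / |a i| with hS
  have hSS : S * S = 1 := by
    rw [hS, diagonal_mul_diagonal, ← diagonal_one]
    congr 1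
    ext i
    exact hs i
  have hD (i j) : V (1, i) (1, j) = a i / |a i| * V (0, i) (0, j) * (a j / |a j|) := by
    have h1 := e 0 i 1 j
    have h2 := e 1 i 0 j
    simp [blockH'] at h1 h2
    exact habs h1 h2
  have hC (i j) : V (1, i) (0, j) = -(a i / |a i| * V (0, i) (1, j) * (a j / |a j|)) := by
    have h1 := e 0 i 0 j
    have h2 := e 1 i 1 j
    simp [blockH'] at h1 h2
    have := habs (p := V (0, i) (1, j)) (q := -V (1, i) (0, j)) (i := i) (j := j)
      (by linarith) (by linarith)
    linarith
  let σ : n ⊕ n ≃ Fin 2 × n :=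
    { toFun := Sum.elim (fun i => (0, i)) (fun i => (1, i))
      invFun := fun p => if p.1 = 0 then Sum.inl p.2 else Sum.inr p.2
      left_inv := by rintro (i | i) <;> simp
      right_inv := by rintro ⟨s, i⟩; fin_cases s <;> simp }
  have h1 : V.submatrix σ σ = fromBlocks 1 0 0 S * fromBlocks A (B * S) (-(B * S)) A * fromBlocks 1 0 0 S := by
    rw [fromBlocks_multiply, fromBlocks_multiply]
    have : B * S * S = B := by rw [Matrix.mul_assoc, hSS, Matrix.mul_one]
    simp only [Matrix.one_mul, Matrix.zero_mul, Matrix.mul_one, Matrix.mul_zero, add_zero, zero_add, this]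
    ext i j
    rcases i with i | i <;> rcases j with j | j
    · rfl
    · rfl
    · simp [σ, hC, hS, hB, diagonal_mul, mul_diagonal, mul_assoc]
    · simp [σ, hD, hS, hA, diagonal_mul, mul_diagonal]
  rw [← det_submatrix_equiv_self σ V, h1, det_mul, det_mul, mul_right_comm]
  exact mul_nonneg (mul_self_nonneg _) (det_fromBlocks_neg_nonneg _ _)

/-! ### Functionals of depth zero -/

section
variable {r : ℕ} {a : Fin (r + 1) → ℝ} {c : ℝ}

theorem ρ_gInf_inv_v₀ : ρ r (gInf r)⁻¹ *ᵥ v₀ r = Sum.elim (0 : Coord r → ℝ) ![-1, 1] := by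
  symm
  rw [← ρ_mulVec_eq_iff, ρ_gInf]
  ext i
  rw [mulVec_diagonal]
  rcases i with i | i
  · simp
  · fin_cases i <;> simp

theorem tMat_mulVec_v₀ : tMat r a c *ᵥ v₀ r = c • v₀ r := by
  rw [tMat_mulVec]
  ext i
  rcases i with i | i
  · simp
  · fin_cases i <;> simp

theorem tMat_mulVec_gInf : tMat r a c *ᵥ (ρ r (gInf r)⁻¹ *ᵥ v₀ r) = -c • (ρ r (gInf r)⁻¹ *ᵥ v₀ r) := by
  rw [tMat_mulVec, ρ_gInf_inv_v₀]
  ext i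
  rcases i with i | i
  · simp
  · fin_cases i <;> simp

theorem lin_tElt : lin r (tElt r a c).1 = 0 ∧ tau r (tElt r a c).1 = c :=
  lin_of_mulVec_v₀ (tMat_mulVec_v₀.trans (by simp))

theorem lin_Ad_gInf : lin r (Ad r (gInf r) (tElt r a c)).1 = 0 ∧
    tau r (Ad r (gInf r) (tElt r a c)).1 = -c := by
  apply lin_of_mulVec_v₀
  have h : (tElt r a c).1 *ᵥ (ρ r (gInf r)⁻¹ *ᵥ v₀ r) = -c • (ρ r (gInf r)⁻¹ *ᵥ v₀ r) := tMat_mulVec_gInf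
  rw [conj_mulVec, h, mulVec_smul, mulVec_mulVec, ρ_mul_inv, one_mulVec]
  simp

theorem mem_P_of_ray_inv {k l : G r} {t : ℝ} (ht : t ≠ 0)
    (h : ρ r k⁻¹ *ᵥ v₀ r = t • (ρ r l⁻¹ *ᵥ v₀ r)) : k * l⁻¹ ∈ P r := by
  refine mem_P_of_ray r _ t⁻¹ ?_
  have h1 : ρ r l⁻¹ *ᵥ v₀ r = t⁻¹ • (ρ r k⁻¹ *ᵥ v₀ r) := by
    rw [h, smul_smul, inv_mul_cancel₀ ht, one_smul]
  rw [map_mul, ← mulVec_mulVec, h1, mulVec_smul, mulVec_mulVec, ρ_mul_inv, one_mulVec]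

theorem mem_orbit_of_mul_inv_mem {k l : G r} (h : k * l⁻¹ ∈ P r) (f : 𝔤Dual r) :
    k • f ∈ MulAction.orbit (P r) (l • f) := by
  refine ⟨⟨_, h⟩, ?_⟩
  change (k * l⁻¹) • l • f = _
  rw [smul_smul, inv_mul_cancel_right]

/-- Here x is an isotropic eigenvector of T. Without components in the first m coordinates it lies
on one of two rays. A nonzero such component forces its a_i, the eigenvalue and c to vanish, and
then x can be moved to v₀ by a rotor built on the kernel of T. -/
theorem mem_orbit_of_lin_eq_zero (k : G r) (h : lin r (Ad r k (tElt r a c)).1 = 0) :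
    k • semisimpleElt r a c ∈ MulAction.orbit (P r) (semisimpleElt r a c) ∪
      MulAction.orbit (P r) (gInf r • semisimpleElt r a c) := by
  obtain ⟨t, ht⟩ := (lin_Ad_eq_zero_iff k _).1 h
  change tMat r a c *ᵥ _ = _ at ht
  have hx : bil r (ρ r k⁻¹ *ᵥ v₀ r) (ρ r k⁻¹ *ᵥ v₀ r) = 0 := by rw [bil_ρ, bil_v₀_v₀]
  have hxt : 0 < (ρ r k⁻¹ *ᵥ v₀ r) (Sum.inr 1) := v₀_future _
  set x := ρ r k⁻¹ *ᵥ v₀ r with hxdef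
  have hk (i) : kap r a c i * x i = t ^ 2 * x i := by
    have h1 := congrFun (tMat_sq_mulVec r a c x) i
    rw [ht, mulVec_smul, ht, smul_smul] at h1
    rw [← h1]
    simp [sq]
  by_cases hz : ∀ i, x (Sum.inl i) = 0
  · have h0 : x ∘ Sum.inl = 0 := by ext i; exact hz i
    rw [bil_apply, h0] at hx
    have hsq : (x (Sum.inr 0) - x (Sum.inr 1)) * (x (Sum.inr 0) + x (Sum.inr 1)) = 0 := by
      simp at hx
      linarith
    rcases mul_eq_zero.1 hsq with h1 | h1
    · left
      have := mem_orbit_of_mul_inv_mem (k := k) (l := 1) (mem_P_of_ray_inv hxt.ne' ?_) (semisimpleElt r a c)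
      · rwa [one_smul] at this
      · rw [inv_one, map_one, one_mulVec, ← hxdef]
        ext i
        rcases i with i | i
        · simp [hz i]
        · fin_cases i <;> simp; linarith
    · right
      refine mem_orbit_of_mul_inv_mem (mem_P_of_ray_inv hxt.ne' ?_) _
      rw [ρ_gInf_inv_v₀, ← hxdef]
      ext i
      rcases i with i | i
      · simp [hz i]
      · fin_cases i <;> simp; linarith
  · push Not at hz
    obtain ⟨⟨s, i⟩, hi⟩ := hz
    have h1 := mul_right_cancel₀ hi (hk _)
    simp only [kap, Sum.elim_inl] at h1
    have ha : a i = 0 := by nlinarith [sq_nonneg t, sq_nonneg (a i)]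
    have ht0 : t = 0 := by nlinarith [sq_nonneg t, sq_nonneg (a i)]
    have hc : c = 0 := by
      by_contra hc
      have h2 := hk (Sum.inr 1)
      simp only [kap, Sum.elim_inr, ht0] at h2
      have : 0 < c ^ 2 * x (Sum.inr 1) := by positivity
      linarith
    left
    have hTx : tMat r a c *ᵥ x = 0 := by rw [ht, ht0, zero_smul]
    have hd : 0 < bil r (x - v₀ r) (x - v₀ r) := by
      have h2 := bil_null_nonpos r x (v₀ r) hx hxt (bil_v₀_v₀ r) (by simp)
      have h3 : bil r x (v₀ r) ≠ 0 := by
        intro h3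
        apply hi
        rw [eq_smul_v₀ r x hx h3]
        simp
      have h4 := lt_of_le_of_ne h2 h3
      simp only [bil_sub_left, bil_sub_right, hx, bil_v₀_v₀, bil_comm r (v₀ r) x]
      linarith
    -- A spacelike kernel vector orthogonal to v₀, available because a i = 0; it makes the number of
    -- reflections even.
    set e : Idx r → ℝ := Sum.elim (Pi.single (0, i) 1) 0 with he
    have hee : 0 < bil r e e := by rw [he, bil_inl]; simp
    obtain ⟨l, hl1, hl2⟩ := exists_commuting_rotor_of_kernel (tMat_mem r a c) hd hee
      (by rw [mulVec_sub, hTx, tMat_mulVec_v₀, hc]; simp) (by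
        refine tMat_of_support_zero fun j hj => ?_
        rcases j with ⟨u, j⟩ | j
        · by_cases hij : j = i
          · subst hij; simp [kap, ha] at hj
          · simp [he, hij]
        · simp [he])
    have hlx : ρ r l *ᵥ x = v₀ r := by
      rw [hl1, ← mulVec_mulVec, refl_sub r _ _ (by rw [hx, bil_v₀_v₀]) hd.ne', refl_mulVec, bil_v₀]
      simp [he]
    have := mem_orbit_of_mul_inv_mem (k := k) (l := l) (mem_P_of_ray_inv (t := 1) one_ne_zero ?_)
      (semisimpleElt r a c)
    · rwa [(smul_semisimpleElt_eq_iff l).2 hl2] at this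
    · rw [one_smul, ← ρ_mulVec_eq_iff]
      exact hlx

theorem smul_res (p : P r) (φ : 𝔤Dual r) : p • res r φ = res r ((p : G r) • φ) := rfl

theorem isDepthZero_orbit : IsDepthZero r (MulAction.orbit (P r) (res r (semisimpleElt r a c))) :=
  ⟨⟨_, rfl⟩, (orbit_subset_𝔩Dual (tElt r a c)).2 lin_tElt.1⟩

theorem isDepthZero_orbit_gInf :
    IsDepthZero r (MulAction.orbit (P r) (res r (gInf r • semisimpleElt r a c))) := by
  refine ⟨⟨_, rfl⟩, ?_⟩
  change MulAction.orbit (P r) (res r (gInf r • iota r (tElt r a c))) ⊆ _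
  rw [res_smul_iota]
  exact (orbit_subset_𝔩Dual _).2 lin_Ad_gInf.1

theorem gInf_smul (h : a (Fin.last r) = 0) (hc : c = 0) :
    gInf r • semisimpleElt r a c = semisimpleElt r a c := by
  rw [smul_semisimpleElt_eq_iff, ρ_gInf]
  apply ext_mulVec'
  intro u
  rw [← mulVec_mulVec, ← mulVec_mulVec, tMat_mulVec, tMat_mulVec]
  ext k
  rw [mulVec_diagonal]
  rcases k with ⟨s, i⟩ | k
  · by_cases hi : i = Fin.last r
    · subst hi; simp [h]
    · fin_cases s <;> simp [hi, mulVec_diagonal]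
  · fin_cases k <;> simp [hc]

/-! ### Action of P on the components of a functional, and the two orbits of depth zero -/

theorem ρ_inv_eq {k : G r} {A B : Matrix (Idx r) (Idx r) ℝ} (h : ρ r k = A) (hAB : A * B = 1) :
    ρ r k⁻¹ = B := by
  rw [← Matrix.mul_one (ρ r k⁻¹), ← hAB, ← h, ← Matrix.mul_assoc, ρ_inv_mul, Matrix.one_mul]

theorem Ad_of_eq_aMat {k : G r} {s : ℝ} (h : ρ r k = aMat r s) (Z : 𝔤 r) :
    lin r (Ad r k Z).1 = Real.exp (-s) • lin r Z.1 ∧ tau r (Ad r k Z).1 = tau r Z.1 ∧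
      (Ad r k Z).1.toBlocks₁₁ = Z.1.toBlocks₁₁ := by
  have h' := ρ_inv_eq h (B := aMat r (-s)) (by rw [aMat_mul, add_neg_cancel, aMat_zero])
  have l := lin_of_mulVec_v₀ (aMat_conj_v₀ Z.2 s)
  rw [Ad_coe, h, h']
  exact ⟨l.1, l.2, aMat_conj_toBlocks₁₁ s⟩

theorem Ad_of_eq_mMat {k : G r} {W : Matrix (Coord r) (Coord r) ℝ}
    (hW : W ∈ specialOrthogonalGroup (Coord r) ℝ) (h : ρ r k = mMat r W) (Z : 𝔤 r) :
    lin r (Ad r k Z).1 = W *ᵥ lin r Z.1 ∧ tau r (Ad r k Z).1 = tau r Z.1 ∧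
      (Ad r k Z).1.toBlocks₁₁ = W * Z.1.toBlocks₁₁ * Wᵀ := by
  have hO : W * Wᵀ = 1 := (mem_orthogonalGroup_iff _ _).1 (mem_specialOrthogonalGroup_iff.1 hW).1
  have h' := ρ_inv_eq h (B := mMat r Wᵀ) (by rw [mMat_mul, hO, mMat_one])
  have l := lin_of_mulVec_v₀ (mMat_conj_v₀ Z.2 W)
  rw [Ad_coe, h, h']
  exact ⟨l.1, l.2, mMat_conj_toBlocks₁₁ W⟩

theorem Ad_of_eq_nMat {k : G r} {α : Coord r → ℝ} (h : ρ r k = nMat r α) (Z : 𝔤 r) :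
    lin r (Ad r k Z).1 = lin r Z.1 ∧ tau r (Ad r k Z).1 = tau r Z.1 + α ⬝ᵥ lin r Z.1 ∧
      (Ad r k Z).1.toBlocks₁₁ =
        Z.1.toBlocks₁₁ - vecMulVec (lin r Z.1) α + vecMulVec α (lin r Z.1) := by
  have h' := ρ_inv_eq h (B := nMat r (-α)) (by rw [nMat_mul, add_neg_cancel, nMat_zero])
  have l := lin_of_mulVec_v₀ (nMat_conj_v₀ Z.2 α)
  rw [Ad_coe, h, h']
  exact ⟨l.1, l.2, nMat_conj_toBlocks₁₁ Z.2 α⟩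

theorem Ad_of_eq_man {k : G r} {W : Matrix (Coord r) (Coord r) ℝ}
    (hW : W ∈ specialOrthogonalGroup (Coord r) ℝ) {s : ℝ} {α : Coord r → ℝ}
    (h : ρ r k = mMat r W * aMat r s * nMat r α) (Z : 𝔤 r) :
    lin r (Ad r k Z).1 = Real.exp (-s) • (W *ᵥ lin r Z.1) ∧
      tau r (Ad r k Z).1 = tau r Z.1 + α ⬝ᵥ lin r Z.1 ∧
      (Ad r k Z).1.toBlocks₁₁ =
        W * (Z.1.toBlocks₁₁ - vecMulVec (lin r Z.1) α + vecMulVec α (lin r Z.1)) * Wᵀ := by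
  obtain ⟨k1, hk1⟩ := exists_lift_nMat r α
  obtain ⟨k2, hk2⟩ := exists_lift_aMat r s
  obtain ⟨k3, hk3⟩ := exists_lift_mMat r W hW
  have h1 : ρ r k = ρ r (k3 * k2 * k1) := by rw [map_mul, map_mul, hk1, hk2, hk3, h]
  have h2 : ρ r k⁻¹ = ρ r (k3 * k2 * k1)⁻¹ := ρ_inv_eq h1 (ρ_mul_inv _ _)
  have h3 : Ad r k Z = Ad r k3 (Ad r k2 (Ad r k1 Z)) := by
    rw [Ad_Ad, Ad_Ad]
    apply Subtype.ext
    rw [Ad_coe, Ad_coe, h1, h2, mul_assoc]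
  obtain ⟨n1, n2, n3⟩ := Ad_of_eq_nMat hk1 Z
  obtain ⟨l1, l2, l3⟩ := Ad_of_eq_aMat hk2 (Ad r k1 Z)
  obtain ⟨m1, m2, m3⟩ := Ad_of_eq_mMat hW hk3 (Ad r k2 (Ad r k1 Z))
  rw [h3]
  exact ⟨by rw [m1, l1, n1, mulVec_smul], by rw [m2, l2, n2], by rw [m3, l3, n3]⟩

/-- When b = 0, A and N act trivially on the remaining data and only conjugation by SO(m) is left.
-/
theorem Ad_P_of_lin_eq_zero (p : P r) (Z : 𝔤 r) (h : lin r Z.1 = 0) :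
    tau r (Ad r p Z).1 = tau r Z.1 ∧ ∃ W ∈ specialOrthogonalGroup (Coord r) ℝ,
      (Ad r p Z).1.toBlocks₁₁ = W * Z.1.toBlocks₁₁ * Wᵀ := by
  obtain ⟨W, hW, s, α, hp⟩ := p.2
  obtain ⟨-, h2, h3⟩ := Ad_of_eq_man hW hp Z
  exact ⟨by rw [h2, h]; simp, W, hW, by rw [h3, h]; simp⟩

theorem toBlocks_tMat : (tMat r a c).toBlocks₁₁ = blockDiagonal fun i => a i • blockH' := by
  rw [tMat, toBlocks_fromBlocks₁₁]

/-- P preserves τ on depth zero functionals, so c = −c. If then the last a_i were nonzero, all would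
be, and W composed with the coordinate flip F would commute with the 𝔪-block and have determinant
−1. -/
theorem orbit_eq_orbit_gInf_iff (ha : ∀ i : Fin r, |a i.succ| ≤ a i.castSucc) :
    MulAction.orbit (P r) (res r (semisimpleElt r a c)) =
      MulAction.orbit (P r) (res r (gInf r • semisimpleElt r a c)) ↔ a (Fin.last r) = 0 ∧ c = 0 := by
  constructor
  · intro h
    have h1 : res r (semisimpleElt r a c) ∈ MulAction.orbit (P r) (res r (gInf r • semisimpleElt r a c)) :=
      h ▸ MulAction.mem_orbit_self _
    obtain ⟨p, hp⟩ := h1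
    change p • res r (gInf r • iota r (tElt r a c)) = pr r (tElt r a c) at hp
    rw [res_smul_iota, smul_pr, pr_eq_iff] at hp
    obtain ⟨hp1, -, hp2⟩ := hp
    obtain ⟨h3, W, hW, h4⟩ := Ad_P_of_lin_eq_zero p _ (lin_Ad_gInf (a := a) (c := c)).1
    rw [hp2, lin_tElt.2, lin_Ad_gInf.2] at h3
    have hc : c = 0 := by linarith
    refine ⟨?_, hc⟩
    by_contra hlast
    have hall : ∀ i, a i ≠ 0 := by
      intro i
      induction i using Fin.lastCases with
      | last => exact hlast
      | cast i =>
        suffices ∀ i : Fin (r + 1), i = Fin.last r ∨ |a (Fin.last r)| ≤ a i by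
          rcases this i.castSucc with h | h
          · exact absurd h (Fin.castSucc_ne_last i)
          · exact ((abs_pos.2 hlast).trans_le h).ne'
        intro i
        induction i using Fin.reverseInduction with
        | last => exact Or.inl rfl
        | cast j ih =>
          right
          rcases ih with ih | ih
          · rw [← ih]; exact ha j
          · exact ih.trans ((le_abs_self _).trans (ha j))
    set F : Matrix (Coord r) (Coord r) ℝ := diagonal fun i => if i = (1, Fin.last r) then -1 else 1 with hF
    have hFF : F * F = 1 := by
      rw [hF, diagonal_mul_diagonal, ← diagonal_one]
      congr 1
      ext i
      split_ifs <;> simp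
    have hgI : ρ r (gInf r)⁻¹ = ρ r (gInf r) := by
      have : ρ r (gInf r) * ρ r (gInf r) = 1 := by
        rw [ρ_gInf, diagonal_mul_diagonal, ← diagonal_one]
        congr 1
        ext i
        split_ifs <;> simp
      rw [← Matrix.mul_one (ρ r (gInf r)⁻¹), ← this, ← Matrix.mul_assoc, ρ_inv_mul, Matrix.one_mul]
    have hFY : (Ad r (gInf r) (tElt r a c)).1.toBlocks₁₁ = F * (blockDiagonal fun i => a i • blockH') * F := by
      rw [Ad_coe, hgI, ρ_gInf, ← toBlocks_tMat (c := c)]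
      change (_ * tMat r a c * _).toBlocks₁₁ = _
      ext i j
      simp [toBlocks₁₁, diagonal_mul, mul_diagonal, hF]
    rw [hp1, hFY] at h4
    change (tMat r a c).toBlocks₁₁ = _ at h4
    rw [toBlocks_tMat] at h4
    have hO := (mem_specialOrthogonalGroup_iff.1 hW).1
    have hO1 : Wᵀ * W = 1 := (mem_orthogonalGroup_iff' _ _).1 hO
    have hcomm : (W * F) * blockDiagonal (fun i => a i • blockH') =
        blockDiagonal (fun i => a i • blockH') * (W * F) := by
      set Y := blockDiagonal fun i => a i • blockH'
      calc (W * F) * Y = (W * (F * Y * F) * Wᵀ) * (W * F) := by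
            simp only [Matrix.mul_assoc]
            rw [← Matrix.mul_assoc Wᵀ, hO1, Matrix.one_mul, hFF, Matrix.mul_one]
        _ = _ := by rw [← h4]
    have hdet : (W * F).det = -1 := by
      rw [det_mul, (mem_specialOrthogonalGroup_iff.1 hW).2, hF, det_diagonal, one_mul,
        Finset.prod_ite_eq']
      simp
    have := det_nonneg_of_commute hall hcomm
    rw [hdet] at this
    linarith
  · rintro ⟨h, hc⟩
    rw [gInf_smul h hc]

/-! ### Reduced spaces -/

/-- Away from the two exceptional orbits b ≠ 0, so any two points of the fibre are conjugate under
P; the conjugating element automatically stabilizes their common restriction. -/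
theorem reducedSpace_unique (k : G r) (hk : k • semisimpleElt r a c ∉
    MulAction.orbit (P r) (semisimpleElt r a c) ∪ MulAction.orbit (P r) (gInf r • semisimpleElt r a c)) :
    Nonempty (Unique (ReducedSpace r (semisimpleElt r a c) (res r (k • semisimpleElt r a c)))) := by
  set f := semisimpleElt r a c with hf
  have hb (l : G r) (hl : res r (l • f) = res r (k • f)) : lin r (Ad r l (tElt r a c)).1 ≠ 0 := by
    have hl' : pr r (Ad r l (tElt r a c)) = pr r (Ad r k (tElt r a c)) := by
      rw [← res_smul_iota, ← res_smul_iota]; exact hl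
    rw [((pr_eq_iff _ _).1 hl').2.1]
    exact fun h => hk (mem_orbit_of_lin_eq_zero k h)
  have key (φ φ' : {φ : orb r f // q r f φ = res r (k • f)}) :
      (φ : 𝔤Dual r) ∈ MulAction.orbit (MulAction.stabilizer (P r) (res r (k • f))) (φ' : 𝔤Dual r) := by
    obtain ⟨⟨_, l, rfl⟩, h⟩ := φ
    obtain ⟨⟨_, l', rfl⟩, h'⟩ := φ'
    change res r (l • f) = _ at h
    change res r (l' • f) = _ at h'
    obtain ⟨p, hp⟩ := exists_smul_eq_of_res_eq (h'.trans h.symm) (hb l' h')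
    refine ⟨⟨p, ?_⟩, hp⟩
    change p • res r (k • f) = res r (k • f)
    conv_lhs => rw [← h']
    rw [smul_res, hp, h]
  refine ⟨⟨⟨Quotient.mk _ ⟨⟨_, k, rfl⟩, rfl⟩⟩, fun x => ?_⟩⟩
  induction x using Quotient.inductionOn with
  | h φ => exact Quotient.sound (key φ _)

end

end SpinOrbit

namespace SpinOrbit

/-! ### The image of the moment map -/

section
variable {r : ℕ}

/-- A coadjoint orbit of depth one is determined by its singular values. -/
theorem orbit_eq_of_hasSingularValues {ψ ψ' : 𝔭Dual r} {x : Fin r → ℝ}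
    (h : HasSingularValues r (MulAction.orbit (P r) ψ) x)
    (h' : HasSingularValues r (MulAction.orbit (P r) ψ') x) :
    MulAction.orbit (P r) ψ = MulAction.orbit (P r) ψ' := by
  obtain ⟨-, -, Y, β, Z, hZ, hβ, hY, hmem, hchar⟩ := h
  obtain ⟨-, -, Y', β', Z', hZ', hβ', hY', hmem', hchar'⟩ := h'
  rw [← MulAction.orbit_eq_iff.2 hmem, ← MulAction.orbit_eq_iff.2 hmem']
  have hYt : Yᵀ = -Y := by
    have := toBlocks₁₁_transpose Z.2
    rwa [hZ, oppMat, toBlocks_fromBlocks₁₁] at this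
  have hYt' : Y'ᵀ = -Y' := by
    have := toBlocks₁₁_transpose Z'.2
    rwa [hZ', oppMat, toBlocks_fromBlocks₁₁] at this
  have hpos (γ : Coord r → ℝ) (hγ : γ ≠ 0) : 0 < γ ⬝ᵥ γ :=
    lt_of_le_of_ne (dotProduct_self_nonneg' γ) fun h => hγ (dotProduct_self_eq_zero.1 h.symm)
  -- The scaling by A matches |β| with |β'|; SO(m) then handles the direction and the block
  -- simultaneously.
  set s := Real.log (√(β' ⬝ᵥ β') / √(β ⬝ᵥ β)) with hs
  have p1 := Real.sqrt_pos.2 (hpos β hβ)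
  have p2 := Real.sqrt_pos.2 (hpos β' hβ')
  have hes : Real.exp s = √(β' ⬝ᵥ β') / √(β ⬝ᵥ β) := Real.exp_log (by positivity)
  obtain ⟨W, hW, hWY, hWβ⟩ := exists_specialOrthogonal_conj (by simp) hYt hYt'
    (b := Real.exp s • β) (b' := β') (smul_ne_zero (Real.exp_pos s).ne' hβ) (by
      rw [smul_dotProduct, dotProduct_smul, smul_eq_mul, smul_eq_mul, ← mul_assoc, ← sq, hes, div_pow,
        Real.sq_sqrt (hpos β' hβ').le, Real.sq_sqrt (hpos β hβ).le, div_mul_cancel₀ _ (hpos β hβ).ne'])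
    (by rw [mulVec_smul, hY, smul_zero]) hY' (by rw [hchar, hchar'])
  obtain ⟨k1, hk1⟩ := exists_lift_aMat r (-s)
  obtain ⟨k2, hk2⟩ := exists_lift_mMat r W hW
  have hk1P : k1 ∈ P r := mem_P_of_ray r k1 _ (by rw [hk1, aMat_mulVec_v₀])
  have hk2P : k2 ∈ P r := mem_P_of_ray r k2 1 (by rw [hk2, mMat_mulVec_v₀, one_smul])
  obtain ⟨l1, l2, l3⟩ := Ad_of_eq_aMat hk1 Z
  obtain ⟨m1, m2, m3⟩ := Ad_of_eq_mMat hW hk2 (Ad r k1 Z)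
  symm
  rw [MulAction.orbit_eq_iff]
  refine ⟨⟨k2, hk2P⟩ * ⟨k1, hk1P⟩, ?_⟩
  change (_ * _ : P r) • pr r Z = _
  rw [mul_smul, smul_pr, smul_pr, pr_eq_iff]
  refine ⟨?_, ?_, ?_⟩
  · change (Ad r k2 (Ad r k1 Z)).1.toBlocks₁₁ = _
    rw [m3, l3, hZ, hZ', oppMat, oppMat, toBlocks_fromBlocks₁₁, toBlocks_fromBlocks₁₁, hWY]
  · change lin r (Ad r k2 (Ad r k1 Z)).1 = _
    rw [m1, l1, neg_neg, hZ, hZ', lin_oppMat, lin_oppMat, smul_comm, mulVec_smul, hWβ]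
  · change tau r (Ad r k2 (Ad r k1 Z)).1 = _
    rw [m2, l2, hZ, hZ', tau_oppMat, tau_oppMat]

variable {a : Fin (r + 1) → ℝ} {c : ℝ}

theorem antitone_sq (ha : ∀ i : Fin r, |a i.succ| ≤ a i.castSucc) : Antitone fun k => a k ^ 2 := by
  rw [Fin.antitone_iff_succ_le]
  intro i
  rw [← sq_abs (a i.succ)]
  exact pow_le_pow_left₀ (abs_nonneg _) (ha i) 2

theorem castSucc_nonneg (ha : ∀ i : Fin r, |a i.succ| ≤ a i.castSucc) (i : Fin r) : 0 ≤ a i.castSucc :=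
  (abs_nonneg _).trans (ha i)

theorem last_eq_zero (ha : ∀ i : Fin r, |a i.succ| ≤ a i.castSucc) (k : Fin (r + 1)) (hk : a k = 0) :
    a (Fin.last r) = 0 := by
  have h := antitone_sq ha (Fin.le_last k)
  simp only [hk] at h
  exact pow_eq_zero_iff (two_ne_zero) |>.1 (le_antisymm (by simpa using h) (sq_nonneg _))

theorem semisimpleElt_eq_zero (ha : ∀ i : Fin r, |a i.succ| ≤ a i.castSucc) (h0 : a 0 = 0) (hc : c = 0) :
    semisimpleElt r a c = 0 := by
  have hall (k) : a k = 0 := by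
    have h := antitone_sq ha (Fin.zero_le k)
    simp only [h0] at h
    exact pow_eq_zero_iff (two_ne_zero) |>.1 (le_antisymm (by simpa using h) (sq_nonneg _))
  have : tMat r a c = 0 := by
    apply ext_mulVec'
    intro u
    rw [tMat_mulVec]
    ext k
    rcases k with k | k
    · simp [hall]
    · fin_cases k <;> simp [hc]
  ext X
  change 1 / 2 * (tMat r a c * X.1).trace = 0
  rw [this]
  simp

/-- The squared singular values interlace the a_k². If c = 0, the weights vanish where a_k = 0 and
`interlacing_eq_zero` applies. -/
theorem exists_hasSingularValues (ha : ∀ i : Fin r, |a i.succ| ≤ a i.castSucc) (k : G r)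
    (hb : lin r (Ad r k (tElt r a c)).1 ≠ 0) :
    ∃ x : Fin r → ℝ, HasSingularValues r (MulAction.orbit (P r) (pr r (Ad r k (tElt r a c)))) x ∧
      (∀ i : Fin r, x i ≤ a i.castSucc ∧ |a i.succ| ≤ x i) ∧
      (a (Fin.last r) = 0 → c = 0 → ∀ i : Fin r, a i.succ = 0 → x i = 0) := by
  set w := wt a c (ρ r k⁻¹ *ᵥ v₀ r) with hw
  have hA := antitone_sq ha
  obtain ⟨y, hy, hyw⟩ := exists_interlacing hA (wt_nonneg a c (ρ r k⁻¹ *ᵥ v₀ r))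
  have hy0 (i) : 0 ≤ y i := (sq_nonneg _).trans (hy i).1
  have hanti : Antitone fun i => √(y i) := by
    intro i j hij
    refine Real.sqrt_le_sqrt ?_
    rcases hij.eq_or_lt with rfl | hij
    · exact le_rfl
    · exact (hy j).2.trans ((hA (Fin.succ_le_castSucc_iff.2 hij)).trans (hy i).1)
  refine ⟨fun i => √(y i), ?_, fun i => ⟨?_, ?_⟩, fun _ hc i hi => ?_⟩
  · refine hasSingularValues_orbit a c k hb _ hanti (fun i => Real.sqrt_nonneg _) ?_
    simp only [Real.sq_sqrt (hy0 _)]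
    exact hyw
  · rw [← Real.sqrt_sq (castSucc_nonneg ha i)]
    exact Real.sqrt_le_sqrt (hy i).2
  · rw [← Real.sqrt_sq_eq_abs]
    exact Real.sqrt_le_sqrt (hy i).1
  · have hS : 0 < ∑ i, w i := by
      rw [hw, ← lin_sq]
      exact lt_of_le_of_ne (dotProduct_self_nonneg' _) fun h => hb (dotProduct_self_eq_zero.1 h.symm)
    have := interlacing_eq_zero (A := fun k => a k ^ 2) (fun _ => sq_nonneg _)
      (wt_nonneg a c (ρ r k⁻¹ *ᵥ v₀ r)) hS (fun i => (hy i).1) hyw (fun k hk => by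
        simp [wt, hk, hc]) i (by simp [hi])
    change √(y i) = 0
    rw [this, Real.sqrt_zero]

/-- An isotropic vector with prescribed weights is written down and moved to the ray of v₀. The
group element doing this gives the point of the orbit. -/
theorem exists_of_hasSingularValues (ha : ∀ i : Fin r, |a i.succ| ≤ a i.castSucc)
    (hf : semisimpleElt r a c ≠ 0) {x : Fin r → ℝ} (hanti : Antitone x) (hx0 : ∀ i, 0 ≤ x i)
    (hx : ∀ i : Fin r, x i ≤ a i.castSucc ∧ |a i.succ| ≤ x i)
    (hdeg : a (Fin.last r) = 0 → c = 0 → ∀ i : Fin r, a i.succ = 0 → x i = 0) :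
    ∃ k : G r, HasSingularValues r (MulAction.orbit (P r) (pr r (Ad r k (tElt r a c)))) x := by
  have hA := antitone_sq ha
  have hxa (i : Fin r) : a i.succ ^ 2 ≤ x i ^ 2 ∧ x i ^ 2 ≤ a i.castSucc ^ 2 := by
    constructor
    · rw [← sq_abs]; exact pow_le_pow_left₀ (abs_nonneg _) (hx i).2 2
    · exact pow_le_pow_left₀ (hx0 i) (hx i).1 2
  obtain ⟨w, hw0, hw1, hw⟩ := exists_weights hA (y := fun i => x i ^ 2) hxa
  have hw' : ∀ μ, ∑ k, w k * ∏ i, (μ + a (k.succAbove i) ^ 2) = (∑ k, w k) * ∏ i, (μ + x i ^ 2) := by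
    intro μ; rw [hw1, one_mul]; exact hw μ
  have hwdeg (k) (hk : a k ^ 2 + c ^ 2 = 0) : w k = 0 := by
    have hk1 : a k = 0 := by nlinarith [sq_nonneg (a k), sq_nonneg c]
    have hc : c = 0 := by nlinarith [sq_nonneg (a k), sq_nonneg c]
    have ha0 : a 0 ≠ 0 := fun h => hf (semisimpleElt_eq_zero ha h hc)
    refine weight_eq_zero (A := fun k => a k ^ 2) (fun _ => sq_nonneg _) (by positivity) hw0
      (fun i => (hxa i).1) hw' (fun i hi => ?_) k (by simp [hk1])
    rw [hdeg (last_eq_zero ha k hk1) hc i (by simpa using hi)]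
    simp
  -- Where a_i = c = 0 the quotient is zero; no weight is lost, by `hwdeg`.
  set ξ : Fin (r + 1) → ℝ := fun i => √(w i / (a i ^ 2 + c ^ 2)) with hξ
  have hξsq (i) : ξ i ^ 2 = w i / (a i ^ 2 + c ^ 2) :=
    Real.sq_sqrt (div_nonneg (hw0 i) (by positivity))
  set q := √(∑ i, ξ i ^ 2) with hq
  have hqsq : q ^ 2 = ∑ i, ξ i ^ 2 := Real.sq_sqrt (Finset.sum_nonneg fun i _ => sq_nonneg _)
  have hwξ (i) : ξ i ^ 2 * (a i ^ 2 + c ^ 2) = w i := by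
    rw [hξsq]
    by_cases h : a i ^ 2 + c ^ 2 = 0
    · rw [h, hwdeg i h]; simp
    · rw [div_mul_cancel₀ _ h]
  have hqpos : 0 < q := by
    refine Real.sqrt_pos.2 (lt_of_le_of_ne (Finset.sum_nonneg fun i _ => sq_nonneg _) fun h => ?_)
    have h1 := (Finset.sum_eq_zero_iff_of_nonneg fun i _ => sq_nonneg (ξ i)).1 h.symm
    have h2 : ∑ k, w k = 0 := Finset.sum_eq_zero fun i hi => by rw [← hwξ, h1 i hi, zero_mul]
    rw [h2] at hw1
    exact zero_ne_one hw1
  set v : Idx r → ℝ := Sum.elim (fun i => if i.1 = 0 then ξ i.2 else 0) ![0, q] with hv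
  have hvnull : bil r v v = 0 := by
    rw [bil_apply]
    simp only [dotProduct, Fintype.sum_prod_type, Fin.sum_univ_two, hv, Function.comp]
    simp [← sq, hqsq]
  obtain ⟨k, t, ht, hk⟩ := exists_move_to_v₀ r v hvnull hqpos
  have hkv : ρ r k⁻¹ *ᵥ v₀ r = t⁻¹ • v := by
    have h1 := (ρ_mulVec_eq_iff k v _).1 hk
    rw [h1, mulVec_smul, smul_smul, inv_mul_cancel₀ ht.ne', one_smul]
  have hwt (i) : wt a c (ρ r k⁻¹ *ᵥ v₀ r) i = (t⁻¹) ^ 2 * w i := by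
    rw [hkv, wt, ← hwξ]
    simp [hv]
    ring
  refine ⟨k, hasSingularValues_orbit a c k ?_ x hanti hx0 fun μ => ?_⟩
  · intro h0
    have h1 := lin_sq a c k
    rw [h0] at h1
    simp only [hwt, ← Finset.mul_sum, hw1] at h1
    have : 0 < (t⁻¹) ^ 2 := by positivity
    simp at h1
    exact (pow_pos ht 2).ne h1
  · simp only [hwt, mul_assoc, ← Finset.mul_sum, hw']

theorem range_q (ha : ∀ i : Fin r, |a i.succ| ≤ a i.castSucc) (hf : semisimpleElt r a c ≠ 0) :
    Set.range (q r (semisimpleElt r a c)) = MulAction.orbit (P r) (res r (semisimpleElt r a c)) ∪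
      MulAction.orbit (P r) (res r (gInf r • semisimpleElt r a c)) ∪ ⋃₀ {O | IsDepthOne r O ∧
      ∃ x : Fin r → ℝ, HasSingularValues r O x ∧
        (∀ i : Fin r, x i ≤ a i.castSucc ∧ |a i.succ| ≤ x i) ∧
        (a (Fin.last r) = 0 → c = 0 → ∀ i : Fin r, a i.succ = 0 → x i = 0)} := by
  set f := semisimpleElt r a c with hfdef
  have hres (k : G r) : res r (k • f) = pr r (Ad r k (tElt r a c)) := res_smul_iota r k _
  apply subset_antisymm
  · rintro _ ⟨⟨_, k, rfl⟩, rfl⟩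
    change res r (k • f) ∈ _
    by_cases hb : lin r (Ad r k (tElt r a c)).1 = 0
    · left
      rcases mem_orbit_of_lin_eq_zero k hb with ⟨p, hp⟩ | ⟨p, hp⟩
      · exact Or.inl ⟨p, by rw [← hp]; rfl⟩
      · exact Or.inr ⟨p, by rw [← hp]; rfl⟩
    · right
      obtain ⟨x, hx⟩ := exists_hasSingularValues ha k hb
      refine ⟨MulAction.orbit (P r) (res r (k • f)), ⟨⟨⟨_, rfl⟩, ?_⟩, x, ?_⟩, MulAction.mem_orbit_self _⟩
      · rw [hres, orbit_subset_𝔩Dual]; exact hb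
      · rw [hres]; exact hx
  · have horb (k : G r) : MulAction.orbit (P r) (res r (k • f)) ⊆ Set.range (q r f) := by
      rintro _ ⟨p, rfl⟩
      exact ⟨⟨_, (p : G r) * k, rfl⟩, by change res r (((p : G r) * k) • f) = _; rw [mul_smul]; rfl⟩
    refine Set.union_subset (Set.union_subset ?_ (horb _)) ?_
    · have := horb 1
      rwa [one_smul] at this
    · refine Set.sUnion_subset ?_
      rintro O ⟨⟨⟨ψ, rfl⟩, -⟩, x, hx, hxa, hdeg⟩
      obtain ⟨k, hk⟩ := exists_of_hasSingularValues ha hf hx.1 hx.2.1 hxa hdeg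
      rw [orbit_eq_of_hasSingularValues hx hk, ← hres]
      exact horb k

theorem smul_zero_dual (k : G r) : k • (0 : 𝔤Dual r) = 0 := by
  ext X
  rfl

theorem range_q_zero : Set.range (q r 0) = {0} := by
  ext ψ
  constructor
  · rintro ⟨⟨_, k, rfl⟩, rfl⟩
    change res r (k • (0 : 𝔤Dual r)) = 0
    rw [smul_zero_dual]
    rfl
  · rintro rfl
    exact ⟨⟨0, MulAction.mem_orbit_self _⟩, rfl⟩

end

end SpinOrbit

namespace SpinOrbit

/-! ### Properness of the moment map -/

section
variable {r : ℕ}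

theorem continuous_res : Continuous (res r) := by
  let L : 𝔤Dual r →ₗ[ℝ] 𝔭Dual r :=
    { toFun := res r
      map_add' := fun _ _ => rfl
      map_smul' := fun _ _ => rfl }
  exact L.continuous_of_finiteDimensional

theorem continuous_dual_apply (X : 𝔤 r) : Continuous fun φ : 𝔤Dual r => φ X := by
  let L : 𝔤Dual r →ₗ[ℝ] ℝ :=
    { toFun := fun φ => φ X
      map_add' := fun _ _ => rfl
      map_smul' := fun _ _ => rfl }
  exact L.continuous_of_finiteDimensional

theorem continuous_q (f : 𝔤Dual r) : Continuous (q r f) := continuous_res.comp continuous_subtype_val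

theorem isProperMap_q_zero : IsProperMap (q r 0) := by
  have : Subsingleton (orb r (0 : 𝔤Dual r)) := by
    constructor
    rintro ⟨_, k, rfl⟩ ⟨_, l, rfl⟩
    exact Subtype.ext ((smul_zero_dual k).trans (smul_zero_dual l).symm)
  exact (continuous_q 0).isProperMap

theorem pairing_oppMat {Z : Matrix (Idx r) (Idx r) ℝ} (hZ : Z ∈ 𝔤 r) (γ : Coord r → ℝ) :
    1 / 2 * (Z * oppMat r 0 γ 0).trace =
      (Z *ᵥ Sum.elim γ 0) (Sum.inr 0) + (Z *ᵥ Sum.elim γ 0) (Sum.inr 1) := by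
  have hs (i j) : Z j i * sign r j = -(sign r i * Z i j) := by
    have := congrFun (congrFun ((mem_𝔤 r Z).1 hZ) i) j
    simpa [J, mul_diagonal, diagonal_mul] using this
  have h0 (i) : Z (Sum.inl i) (Sum.inr 0) = -Z (Sum.inr 0) (Sum.inl i) := by
    have := hs (Sum.inr 0) (Sum.inl i); simpa [sign] using this
  have h1 (i) : Z (Sum.inl i) (Sum.inr 1) = Z (Sum.inr 1) (Sum.inl i) := by
    have := hs (Sum.inr 1) (Sum.inl i); simpa [sign] using this
  simp only [Matrix.trace, diag_apply, Matrix.mul_apply, mulVec, dotProduct, Fintype.sum_sum_type, Fin.sum_univ_two]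
  simp [oppMat, h0, h1, Finset.sum_add_distrib]
  ring

variable {a : Fin (r + 1) → ℝ} {c : ℝ}

/-- A skew matrix equal to c times the identity vanishes together with c. -/
theorem exists_resolvent_ne_zero (hf : semisimpleElt r a c ≠ 0) : ∃ γ : Coord r → ℝ,
    (blockDiagonal fun i => a i • blockH') *ᵥ γ - c • γ ≠ 0 := by
  by_contra! h
  apply hf
  have hY := toBlocks₁₁_transpose (tMat_mem r a c)
  rw [toBlocks_tMat] at hY
  have hc : c = 0 := by
    have h1 := congrArg (fun v => (Pi.single (0, 0) 1 : Coord r → ℝ) ⬝ᵥ v) (h (Pi.single (0, 0) 1))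
    simp only [dotProduct_sub, skew_dotProduct_self hY, dotProduct_smul] at h1
    simpa using h1
  have hY0 : (blockDiagonal fun i => a i • blockH') = (0 : Matrix (Coord r) (Coord r) ℝ) := by
    apply ext_mulVec'
    intro y
    have := h y
    rw [hc, zero_smul, sub_zero] at this
    rw [this, zero_mulVec]
  have hT : tMat r a c = 0 := by
    rw [tMat, hY0, hc, zero_smul, fromBlocks_zero]
  ext X
  change 1 / 2 * (tMat r a c * X.1).trace = 0
  rw [hT]
  simp

/-- Since f vanishes on 𝔫, translating it by N does not change its restriction, but the pairing with
an opposite nilpotent element grows linearly. -/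
theorem not_isProperMap_q (hf : semisimpleElt r a c ≠ 0) : ¬IsProperMap (q r (semisimpleElt r a c)) := by
  intro hq
  obtain ⟨γ, hγ⟩ := exists_resolvent_ne_zero hf
  set f := semisimpleElt r a c with hfdef
  set Y := (blockDiagonal fun i => a i • blockH' : Matrix (Coord r) (Coord r) ℝ) with hY
  set δ := Y *ᵥ γ - c • γ with hδ
  have hδpos : 0 < δ ⬝ᵥ δ :=
    lt_of_le_of_ne (dotProduct_self_nonneg' δ) fun h => hγ (dotProduct_self_eq_zero.1 h.symm)
  let X : 𝔤 r := ⟨_, oppMat_mem r 0 (by simp) γ 0⟩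
  have hcomp := hq.isCompact_preimage (isCompact_singleton (x := res r f))
  have hcont : Continuous fun φ : orb r f => (φ : 𝔤Dual r) X :=
    (continuous_dual_apply X).comp continuous_subtype_val
  obtain ⟨C, hC⟩ := (hcomp.image hcont).isBounded.exists_norm_le
  -- With δ = Yγ − cγ, translation by n_{sδ} pairs with X to give 2s|δ|², unbounded in s.
  have key (s : ℝ) : |2 * (s * (δ ⬝ᵥ δ))| ≤ C := by
    obtain ⟨k, hk⟩ := exists_lift_nMat r (s • δ)
    have hk' := ρ_inv_eq hk (B := nMat r (-(s • δ))) (by rw [nMat_mul, add_neg_cancel, nMat_zero])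
    have hv : k • f = iota r (Ad r k (tElt r a c)) := smul_iota r k _
    refine hC _ ⟨⟨k • f, k, rfl⟩, ?_, ?_⟩
    · change res r (k • f) = res r f
      rw [hv]
      change pr r _ = pr r (tElt r a c)
      have l := lin_of_mulVec_v₀ (nMat_conj_v₀ (tElt r a c).2 (s • δ))
      rw [pr_eq_iff, Ad_coe, hk, hk', l.1, l.2, nMat_conj_toBlocks₁₁ (tElt r a c).2, lin_tElt.1]
      simp
    · change (k • f) X = _
      rw [hv]
      change 1 / 2 * ((Ad r k (tElt r a c)).1 * oppMat r 0 γ 0).trace = _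
      have e1 : tMat r a c *ᵥ Sum.elim γ 0 = Sum.elim (Y *ᵥ γ) 0 := by
        rw [tMat, fromBlocks_mulVec]
        simp
        rfl
      have e2 : (Ad r k (tElt r a c)).1 *ᵥ Sum.elim γ 0 =
          Sum.elim (Y *ᵥ γ) 0 + ((s • δ) ⬝ᵥ δ) • v₀ r := by
        rw [conj_mulVec, hk, hk', nMat_mulVec_inl, mulVec_add, mulVec_smul]
        change nMat r (s • δ) *ᵥ (tMat r a c *ᵥ _ + _ • (tMat r a c *ᵥ _)) = _
        rw [e1, tMat_mulVec_v₀, mulVec_add, mulVec_smul, mulVec_smul, nMat_mulVec_v₀, nMat_mulVec_inl, add_assoc,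
          smul_smul, ← add_smul, hδ, dotProduct_sub, dotProduct_smul, neg_dotProduct, smul_eq_mul]
        congr 2
        ring
      rw [pairing_oppMat (Ad r k _).2, e2]
      simp
      ring
  have h0 := key 0
  have hC0 : 0 ≤ C := (abs_nonneg _).trans h0
  have h1 := key ((C + 1) / (δ ⬝ᵥ δ))
  rw [div_mul_cancel₀ _ hδpos.ne', abs_of_pos (by linarith)] at h1
  linarith

end

end SpinOrbit

namespace SpinOrbit

/-! ### Regular elements do not vanish on `𝔫` -/

section
variable {r : ℕ}

theorem parMat_bracket (Y Y' : Matrix (Coord r) (Coord r) ℝ) (hY : Yᵀ = -Y) (hY' : Y'ᵀ = -Y') (t t' : ℝ)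
    (α α' : Coord r → ℝ) : parMat r Y t α * parMat r Y' t' α' - parMat r Y' t' α' * parMat r Y t α =
      parMat r (Y * Y' - Y' * Y) 0 (Y *ᵥ α' + t • α' - Y' *ᵥ α - t' • α) := by
  have hv (Y : Matrix (Coord r) (Coord r) ℝ) (hY : Yᵀ = -Y) (α : Coord r → ℝ) (j) :
      ∑ i, α i * Y i j = -∑ i, Y j i * α i := by
    rw [← Finset.sum_neg_distrib]
    refine Finset.sum_congr rfl fun i _ => ?_
    have := congrFun (congrFun hY j) i
    simp at this
    rw [this]
    ring
  ext i j
  rcases i with i | i <;> rcases j with j | j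
  · simp [parMat, Matrix.mul_apply, Fintype.sum_sum_type]
  · fin_cases j <;> simp [parMat, Matrix.mul_apply, Fintype.sum_sum_type, mulVec, dotProduct, blockH] <;> ring
  · fin_cases i <;>
    simp [parMat, Matrix.mul_apply, Fintype.sum_sum_type, mulVec, dotProduct, blockH, hv Y hY, hv Y' hY'] <;> ring
  · have hc : ∑ i, α' i * α i = ∑ i, α i * α' i := Finset.sum_congr rfl fun i _ => mul_comm _ _
    fin_cases i <;> fin_cases j <;>
      simp [parMat, Matrix.mul_apply, Fintype.sum_sum_type, blockH, hc] <;> ring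

/-- The `𝔞 + 𝔫` part of an element of `𝔭`. -/
def anPart (r : ℕ) : 𝔭 r →ₗ[ℝ] ℝ × (Coord r → ℝ) where
  toFun X := (X.1.1 (Sum.inr 0) (Sum.inr 1), fun i => X.1.1 (Sum.inr 0) (Sum.inl i))
  map_add' _ _ := rfl
  map_smul' _ _ := rfl

/-- The element `diag(Y, 0) + t H_0 + X_α` of `𝔭`. -/
def parElt (Y : Matrix (Coord r) (Coord r) ℝ) (hY : Yᵀ = -Y) (t : ℝ) (α : Coord r → ℝ) : 𝔭 r :=
  ⟨⟨parMat r Y t α, parMat_mem r Y hY t α⟩, Y, t, α, rfl⟩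

theorem transpose_zero_eq_neg : (0 : Matrix (Coord r) (Coord r) ℝ)ᵀ = -0 := by simp

theorem exists_parElt (X : 𝔭 r) : ∃ Y, ∃ hY : Yᵀ = -Y, ∃ t α, X = parElt Y hY t α := by
  obtain ⟨Y, t, α, h⟩ := X.2
  have hY := toBlocks₁₁_transpose X.1.2
  rw [h, parMat, toBlocks_fromBlocks₁₁] at hY
  exact ⟨Y, hY, t, α, Subtype.ext (Subtype.ext h)⟩

theorem anPart_parElt (Y : Matrix (Coord r) (Coord r) ℝ) (hY : Yᵀ = -Y) (t : ℝ) (α : Coord r → ℝ) :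
    anPart r (parElt Y hY t α) = (t, α) := by
  refine Prod.ext ?_ (funext fun i => ?_)
  · change parMat r Y t α (Sum.inr 0) (Sum.inr 1) = t
    simp [parMat, blockH]
  · change parMat r Y t α (Sum.inr 0) (Sum.inl i) = α i
    simp [parMat]

theorem skew_bracket {Y Y' : Matrix (Coord r) (Coord r) ℝ} (hY : Yᵀ = -Y) (hY' : Y'ᵀ = -Y') :
    (Y * Y' - Y' * Y)ᵀ = -(Y * Y' - Y' * Y) := by
  rw [transpose_sub, transpose_mul, transpose_mul, hY, hY']
  simp

theorem parElt_bracket (Y Y' : Matrix (Coord r) (Coord r) ℝ) (hY : Yᵀ = -Y) (hY' : Y'ᵀ = -Y') (t t' : ℝ)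
    (α α' : Coord r → ℝ) : ⁅parElt Y hY t α, parElt Y' hY' t' α'⁆ =
      parElt (Y * Y' - Y' * Y) (skew_bracket hY hY') 0 (Y *ᵥ α' + t • α' - Y' *ᵥ α - t' • α) :=
  Subtype.ext (Subtype.ext (parMat_bracket Y Y' hY hY' t t' α α'))

theorem parElt_add (Y : Matrix (Coord r) (Coord r) ℝ) (hY : Yᵀ = -Y) (t : ℝ) (α : Coord r → ℝ) :
    parElt Y hY t α = parElt Y hY t 0 + parElt 0 transpose_zero_eq_neg 0 α := by
  apply Subtype.ext
  apply Subtype.ext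
  change parMat r Y t α = parMat r Y t 0 + parMat r 0 0 α
  simp only [parMat, fromBlocks_add]
  congr 1
  · simp
  · ext i j; fin_cases j <;> simp
  · ext i j; fin_cases i <;> simp
  · simp

theorem finrank_eq_map_add_inf_ker {V V' : Type*} [AddCommGroup V] [Module ℝ V] [FiniteDimensional ℝ V]
    [AddCommGroup V'] [Module ℝ V'] (L : V →ₗ[ℝ] V') (S : Submodule ℝ V) :
    Module.finrank ℝ S = Module.finrank ℝ (S.map L) + Module.finrank ℝ (S ⊓ LinearMap.ker L : Submodule ℝ V) := by
  have h := LinearMap.finrank_range_add_finrank_ker (L.domRestrict S)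
  rw [LinearMap.range_domRestrict] at h
  have e : (LinearMap.ker (L.domRestrict S)).map S.subtype = S ⊓ LinearMap.ker L := by
    ext v
    simp [LinearMap.domRestrict_apply]
    tauto
  rw [← h, ← e, Submodule.finrank_map_subtype_eq]

/-- If ψ vanishes on 𝔫, its stabilizer contains 𝔞 + 𝔫. Adding a functional ν that is nonzero on 𝔫
destroys surjectivity onto 𝔞 + 𝔫 and does not enlarge the intersection with 𝔪, so the stabilizer
shrinks. -/
theorem not_mem_𝔩Dual_of_isRegularElt {ψ : 𝔭Dual r} (h : IsRegularElt r ψ) : ψ ∉ 𝔩Dual r := by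
  intro hψ
  have hψn (α) : ψ (parElt 0 transpose_zero_eq_neg 0 α) = 0 := hψ _ ⟨α, rfl⟩
  set β : Coord r → ℝ := Pi.single (0, 0) 1 with hβ
  have hββ : β ⬝ᵥ β = 1 := by simp [hβ]
  let ν : 𝔭Dual r := pr r ⟨_, oppMat_mem r 0 (by simp) β 0⟩
  have hν (Y) (hY : Yᵀ = -Y) (t α) : ν (parElt Y hY t α) = 2 * (α ⬝ᵥ β) := by
    change 1 / 2 * (oppMat r 0 β 0 * parMat r Y t α).trace = _
    rw [pairing (oppMat_mem r 0 (by simp) β 0), lin_oppMat, tau_oppMat]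
    simp [oppMat]
  set L := anPart r with hL
  have ht {Y : Matrix (Coord r) (Coord r) ℝ} {hY : Yᵀ = -Y} {t : ℝ}
      (hX : parElt Y hY t 0 ∈ stabAlg r (ψ + ν)) : t = 0 := by
    have h1 := hX (parElt 0 transpose_zero_eq_neg 0 β)
    rw [parElt_bracket] at h1
    simp only [Matrix.mul_zero, Matrix.zero_mul, sub_zero, mulVec_zero, smul_zero] at h1
    change ψ _ + ν _ = 0 at h1
    rw [hψn, hν, add_dotProduct, dotProduct_comm, skew_dotProduct_self hY, smul_dotProduct, hββ] at h1
    simpa using h1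
  have hker : stabAlg r (ψ + ν) ⊓ LinearMap.ker L ≤ stabAlg r ψ ⊓ LinearMap.ker L := by
    rintro X ⟨hX, hXL⟩
    refine ⟨?_, hXL⟩
    obtain ⟨Y, hY, t, α, rfl⟩ := exists_parElt X
    rw [SetLike.mem_coe, LinearMap.mem_ker, hL, anPart_parElt] at hXL
    obtain ⟨rfl, rfl⟩ : t = 0 ∧ α = 0 := Prod.ext_iff.1 hXL
    intro X'
    obtain ⟨Y', hY', t', α', rfl⟩ := exists_parElt X'
    have h1 := hX (parElt Y' hY' 0 0)
    rw [parElt_bracket] at h1 ⊢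
    change ψ _ + ν _ = 0 at h1
    rw [hν] at h1
    rw [parElt_add, map_add, hψn, add_zero]
    simpa using h1
  have hlt : Module.finrank ℝ ((stabAlg r (ψ + ν)).map L) < Module.finrank ℝ (ℝ × (Coord r → ℝ)) := by
    refine Submodule.finrank_lt fun htop => ?_
    have h1 : ((1 : ℝ), (0 : Coord r → ℝ)) ∈ (stabAlg r (ψ + ν)).map L := htop ▸ Submodule.mem_top
    obtain ⟨X, hX, hXL⟩ := h1
    obtain ⟨Y, hY, t, α, rfl⟩ := exists_parElt X
    rw [hL, anPart_parElt] at hXL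
    obtain ⟨rfl, rfl⟩ := Prod.ext_iff.1 hXL
    exact one_ne_zero (ht hX)
  have htop : (stabAlg r ψ).map L = ⊤ := by
    rw [eq_top_iff]
    rintro ⟨t, α⟩ -
    refine ⟨parElt 0 transpose_zero_eq_neg t α, fun X' => ?_, anPart_parElt _ _ _ _⟩
    obtain ⟨Y', hY', t', α', rfl⟩ := exists_parElt X'
    rw [parElt_bracket]
    simp only [Matrix.mul_zero, Matrix.zero_mul, sub_zero]
    exact hψn _
  have h1 := h (ψ + ν)
  rw [finrank_eq_map_add_inf_ker L (stabAlg r ψ), finrank_eq_map_add_inf_ker L (stabAlg r (ψ + ν)), htop,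
    finrank_top] at h1
  have h2 := Submodule.finrank_mono hker
  omega

end

end SpinOrbit

namespace SpinOrbit

/-! ### Weak properness of the moment map -/

section
variable {r : ℕ}

/-- The `𝔫`-component of a functional on `𝔭`. -/
noncomputable def dualLin (ψ : 𝔭Dual r) : Coord r → ℝ :=
  fun i => ψ (parElt 0 transpose_zero_eq_neg 0 (Pi.single i 1))

/-- The `𝔞`-component of a functional on `𝔭`. -/
noncomputable def dualTau (ψ : 𝔭Dual r) : ℝ := ψ (parElt 0 transpose_zero_eq_neg 1 0)

/-- The `𝔪`-component of a functional on `𝔭`. -/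
noncomputable def dualBlock (ψ : 𝔭Dual r) : Matrix (Coord r) (Coord r) ℝ :=
  of fun i j => ψ (parElt (Matrix.single j i 1 - Matrix.single i j 1) (by simp) 0 0)

theorem pr_parElt (Z : 𝔤 r) (Y : Matrix (Coord r) (Coord r) ℝ) (hY : Yᵀ = -Y) (t : ℝ) (α : Coord r → ℝ) :
    pr r Z (parElt Y hY t α) =
      1 / 2 * (Z.1.toBlocks₁₁ * Y).trace + t * tau r Z.1 + α ⬝ᵥ lin r Z.1 := pairing Z.2 Y t α

theorem dualLin_pr (Z : 𝔤 r) : dualLin (pr r Z) = lin r Z.1 := by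
  ext i
  rw [dualLin, pr_parElt]
  simp

theorem dualTau_pr (Z : 𝔤 r) : dualTau (pr r Z) = tau r Z.1 := by
  rw [dualTau, pr_parElt]
  simp

theorem dualBlock_pr (Z : 𝔤 r) : dualBlock (pr r Z) = Z.1.toBlocks₁₁ := by
  ext i j
  have h := congrFun (congrFun (toBlocks₁₁_transpose Z.2) i) j
  rw [transpose_apply, Matrix.neg_apply] at h
  rw [dualBlock, of_apply, pr_parElt]
  simp only [Matrix.mul_sub, trace_sub, zero_mul, zero_dotProduct, add_zero, Matrix.trace_mul_comm _ (Matrix.single _ _ _),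
    trace_single_mul, one_mul, h]
  simp
  ring

theorem continuous_dualP_apply (X : 𝔭 r) : Continuous fun ψ : 𝔭Dual r => ψ X := by
  let L : 𝔭Dual r →ₗ[ℝ] ℝ :=
    { toFun := fun ψ => ψ X
      map_add' := fun _ _ => rfl
      map_smul' := fun _ _ => rfl }
  exact L.continuous_of_finiteDimensional

theorem continuous_dualLin : Continuous (dualLin (r := r)) :=
  continuous_pi fun _ => continuous_dualP_apply _

theorem continuous_dualTau : Continuous (dualTau (r := r)) := continuous_dualP_apply _

theorem continuous_dualBlock : Continuous (dualBlock (r := r)) :=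
  continuous_matrix fun _ _ => continuous_dualP_apply _

/-! ### Compact parameters for the part of the orbit over a compact set -/

theorem refl_transpose_mul_self {d : Idx r → ℝ} (hd : bil r d d ≠ 0) (ht : d (Sum.inr 1) = 0) :
    (refl r d)ᵀ * refl r d = 1 := by
  have h1 : J r *ᵥ d = d := by
    ext i
    rw [J, mulVec_diagonal]
    rcases i with i | i
    · simp [sign]
    · fin_cases i
      · simp [sign]
      · simp [sign, ht]
  have h2 : (refl r d)ᵀ = refl r d := by
    rw [refl, h1, transpose_sub, transpose_one, transpose_smul]
    congr 2
    ext i j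
    simp [vecMulVec_apply, mul_comm]
  rw [h2, refl_mul_self r d hd]

/-- The maximal compact subgroup acts transitively on the directions of isotropic vectors. -/
theorem exists_orthogonal_move {x : Idx r → ℝ} (hx : bil r x x = 0) :
    ∃ k : G r, (ρ r k)ᵀ * ρ r k = 1 ∧ ρ r k *ᵥ x = x (Sum.inr 1) • v₀ r := by
  by_cases hd0 : x = x (Sum.inr 1) • v₀ r
  · exact ⟨1, by simp, by rw [map_one, one_mulVec]; exact hd0⟩
  set d := x - x (Sum.inr 1) • v₀ r with hd
  have hdt : d (Sum.inr 1) = 0 := by simp [hd]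
  have hdd : 0 < bil r d d := by
    rw [bil_spatial, hdt, mul_zero, sub_zero]
    refine lt_of_le_of_ne (dotProduct_self_nonneg' _) fun h => hd0 (sub_eq_zero.1 ?_)
    have h1 := dotProduct_self_eq_zero.1 h.symm
    rw [spatial, ← hdt, Function.update_eq_self] at h1
    exact h1
  set e : Idx r → ℝ := Sum.elim (Pi.single (0, 0) 1) 0 with he
  have hee : 0 < bil r e e := by rw [he, bil_inl]; simp
  obtain ⟨k, hk⟩ := exists_rotor r e d hee hdd
  refine ⟨k, ?_, ?_⟩
  · rw [hk, transpose_mul, Matrix.mul_assoc, ← Matrix.mul_assoc (refl r e)ᵀ,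
      refl_transpose_mul_self hee.ne' (by simp [he]), Matrix.one_mul, refl_transpose_mul_self hdd.ne' hdt]
  · have h0 : bil r x x = bil r (x (Sum.inr 1) • v₀ r) (x (Sum.inr 1) • v₀ r) := by
      simp [hx, bil_v₀_v₀]
    rw [hk, ← mulVec_mulVec, refl_sub r _ _ h0 hdd.ne', mulVec_smul, refl_mulVec, bil_v₀]
    simp [he]

variable {a : Fin (r + 1) → ℝ} {c : ℝ}

/-- Every point of the orbit of depth one is `l • f` with `ρ(l)⁻¹ v₀` in a normal form. -/
theorem exists_adapted (k : G r) (hb : lin r (Ad r k (tElt r a c)).1 ≠ 0) :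
    ∃ l : G r, l • semisimpleElt r a c = k • semisimpleElt r a c ∧
      (ρ r l⁻¹ *ᵥ v₀ r) (Sum.inr 0) = 0 ∧
      ∀ i, a i.2 ^ 2 + c ^ 2 = 0 → (ρ r l⁻¹ *ᵥ v₀ r) (Sum.inl i) = 0 := by
  have hw : ∑ i, wt a c (ρ r k⁻¹ *ᵥ v₀ r) i ≠ 0 := by
    rw [← lin_sq]; exact fun h0 => hb (dotProduct_self_eq_zero.1 h0)
  have hneg := bil_comp_neg (a := a) (c := c) (x := ρ r k⁻¹ *ᵥ v₀ r) (by rw [bil_ρ, bil_v₀_v₀]) hw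
  have hxt : 0 < (ρ r k⁻¹ *ᵥ v₀ r) (Sum.inr 1) := v₀_future _
  set x := ρ r k⁻¹ *ᵥ v₀ r with hx
  set s := √(-bil r (comp a c (c ^ 2) x) (comp a c (c ^ 2) x)) with hs
  have hs0 : 0 < s := Real.sqrt_pos.2 (by linarith)
  have hs2 : s ^ 2 = -bil r (comp a c (c ^ 2) x) (comp a c (c ^ 2) x) := Real.sq_sqrt (by linarith)
  -- The timelike c²-component becomes a multiple of the time vector. This clears the other
  -- coordinates of that eigenspace, including those with a² + c² = 0.
  obtain ⟨h, h1, h2, h3⟩ := exists_centralizer_swap (a := a) (c := c) (c ^ 2) (y' := s • eT r)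
    (comp_support (c ^ 2) x) (by
      intro j hj
      rcases j with j | j
      · simp [eT]
      · exact absurd rfl hj) (by
      rw [bil_smul_left, bil_smul_right, bil_eT_eT]; linarith) (fun _ => ⟨hneg, by simpa [comp, kap] using hxt, by
        simpa [eT] using hs0⟩)
  have hhx : ρ r h *ᵥ x = x - comp a c (c ^ 2) x + s • eT r := by
    have e : x = comp a c (c ^ 2) x + (x - comp a c (c ^ 2) x) := by abel
    conv_lhs => rw [e]
    rw [mulVec_add, h2, h3, add_comm]
    intro j hj
    simp [comp, hj]
  have hl : ρ r (k * h⁻¹)⁻¹ *ᵥ v₀ r = x - comp a c (c ^ 2) x + s • eT r := by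
    rw [_root_.mul_inv_rev, inv_inv, map_mul, ← mulVec_mulVec, ← hx, hhx]
  refine ⟨k * h⁻¹, ?_, ?_, fun i hi => ?_⟩
  · have h4 := (smul_semisimpleElt_eq_iff (a := a) (c := c) h).2 h1
    rw [mul_smul, inv_smul_eq_iff.2 h4.symm]
  · rw [hl]; simp [comp, kap, eT]
  · rw [hl]
    have : -a i.2 ^ 2 = c ^ 2 := by linarith
    simp [comp, kap, eT, this]

/-- For an adapted isotropic vector the squared time coordinate is the sum of the squared lengths in
the planes, so it is comparable to the sum of the weights, hence to |b|². -/
theorem sq_bounds {x : Idx r → ℝ} (hx : bil r x x = 0) (h0 : x (Sum.inr 0) = 0)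
    (hx0 : ∀ i : Coord r, a i.2 ^ 2 + c ^ 2 = 0 → x (Sum.inl i) = 0) {δ M : ℝ}
    (hδ : ∀ i, a i ^ 2 + c ^ 2 ≠ 0 → δ ≤ a i ^ 2 + c ^ 2) (hM : ∀ i, a i ^ 2 + c ^ 2 ≤ M) :
    δ * x (Sum.inr 1) ^ 2 ≤ ∑ i, wt a c x i ∧ ∑ i, wt a c x i ≤ M * x (Sum.inr 1) ^ 2 := by
  have h := null_eq hx
  have h1 : x (Sum.inr 1) ^ 2 = ∑ i, (x (Sum.inl (0, i)) ^ 2 + x (Sum.inl (1, i)) ^ 2) := by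
    rw [h0] at h; linarith
  rw [h1, Finset.mul_sum, Finset.mul_sum]
  constructor
  · refine Finset.sum_le_sum fun i _ => ?_
    rw [wt]
    by_cases hi : a i ^ 2 + c ^ 2 = 0
    · rw [hx0 (0, i) hi, hx0 (1, i) hi]; simp
    · rw [mul_comm]
      exact mul_le_mul_of_nonneg_left (hδ i hi) (by positivity)
  · refine Finset.sum_le_sum fun i _ => ?_
    rw [wt, mul_comm M]
    exact mul_le_mul_of_nonneg_left (hM i) (by positivity)

/-- The matrix of an element of `G` in terms of an orthogonal matrix and of the restriction to `𝔭`
of the functional. -/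
noncomputable def paramMat (T : Matrix (Idx r) (Idx r) ℝ) (Y : Matrix (Coord r) (Coord r) ℝ) (t : ℝ)
    (K : Matrix (Idx r) (Idx r) ℝ) (W : Matrix (Coord r) (Coord r) ℝ) (s u : ℝ) : Matrix (Idx r) (Idx r) ℝ :=
  mMat r W * aMat r s * nMat r (u • ((t - tau r (K * T * Kᵀ)) • lin r (K * T * Kᵀ) -
    ((K * T * Kᵀ).toBlocks₁₁ - Wᵀ * Y * W) *ᵥ lin r (K * T * Kᵀ))) * K

theorem continuous_paramMat {X : Type*} [TopologicalSpace X] (T : Matrix (Idx r) (Idx r) ℝ)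
    {Y : X → Matrix (Coord r) (Coord r) ℝ} {t : X → ℝ} {K : X → Matrix (Idx r) (Idx r) ℝ}
    {W : X → Matrix (Coord r) (Coord r) ℝ} {s u : X → ℝ} (hY : Continuous Y) (ht : Continuous t)
    (hK : Continuous K) (hW : Continuous W) (hs : Continuous s) (hu : Continuous u) :
    Continuous fun x => paramMat T (Y x) (t x) (K x) (W x) (s x) (u x) := by
  unfold paramMat mMat aMat nMat tau lin toBlocks₁₁
  fun_prop

/-- An orthogonal K sends x to a multiple of v₀, and ρ(l)K⁻¹ lies in MAN. Its A-part is the scaling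
of v₀; its N-part is recovered from the restricted functional. -/
theorem exists_paramMat {l : G r} (hb : lin r (Ad r l (tElt r a c)).1 ≠ 0) {x : Idx r → ℝ}
    (hx : x = ρ r l⁻¹ *ᵥ v₀ r) :
    ∃ K W, Kᵀ * K = 1 ∧ Wᵀ * W = 1 ∧
      ρ r l = paramMat (tMat r a c) (Ad r l (tElt r a c)).1.toBlocks₁₁ (tau r (Ad r l (tElt r a c)).1) K W
        (Real.log (x (Sum.inr 1))⁻¹)
        (x (Sum.inr 1) ^ 2 / (lin r (Ad r l (tElt r a c)).1 ⬝ᵥ lin r (Ad r l (tElt r a c)).1)) := by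
  have hnull : bil r x x = 0 := by rw [hx, bil_ρ, bil_v₀_v₀]
  have hq : 0 < x (Sum.inr 1) := by rw [hx]; exact v₀_future _
  obtain ⟨k, hk1, hk2⟩ := exists_orthogonal_move hnull
  set y := x (Sum.inr 1) with hy
  have hkinv : ρ r k⁻¹ = (ρ r k)ᵀ := ρ_inv_eq rfl (mul_eq_one_comm.1 hk1)
  have hp : ρ r (l * k⁻¹) *ᵥ v₀ r = y⁻¹ • v₀ r := by
    have h1 := (ρ_mulVec_eq_iff k _ _).1 hk2
    rw [mulVec_smul] at h1
    have h2 : ρ r k⁻¹ *ᵥ v₀ r = y⁻¹ • x := by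
      conv_rhs => rw [h1]
      rw [smul_smul, inv_mul_cancel₀ hq.ne', one_smul]
    rw [map_mul, ← mulVec_mulVec, h2, mulVec_smul, hx, mulVec_mulVec, ρ_mul_inv, one_mulVec]
  have hL := isLor_ρ r (l * k⁻¹)
  obtain ⟨W, hW, α, hWα⟩ := exists_man r _ hL.adj hL.det y⁻¹ (by positivity) hp
  have hO1 : Wᵀ * W = 1 := (mem_orthogonalGroup_iff' _ _).1 (mem_specialOrthogonalGroup_iff.1 hW).1
  refine ⟨ρ r k, W, hk1, hO1, ?_⟩
  obtain ⟨m1, m2, m3⟩ := Ad_of_eq_man hW hWα (Ad r k (tElt r a c))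
  rw [Ad_Ad, inv_mul_cancel_right] at m1 m2 m3
  have hZ : (Ad r k (tElt r a c)).1 = ρ r k * tMat r a c * (ρ r k)ᵀ := by
    rw [Ad_coe, hkinv]; rfl
  rw [paramMat, ← hZ]
  set b' := lin r (Ad r k (tElt r a c)).1 with hb'
  rw [← Real.log_inv, inv_inv, Real.exp_log hq] at m1
  have hWb : (W *ᵥ b') ⬝ᵥ (W *ᵥ b') = b' ⬝ᵥ b' := by
    rw [dotProduct_mulVec, vecMul_mulVec, ← dotProduct_mulVec, hO1, one_mulVec]
  have hbb : lin r (Ad r l (tElt r a c)).1 ⬝ᵥ lin r (Ad r l (tElt r a c)).1 = y ^ 2 * (b' ⬝ᵥ b') := by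
    rw [m1, smul_dotProduct, dotProduct_smul, hWb, smul_eq_mul, smul_eq_mul]; ring
  have hb0 : b' ⬝ᵥ b' ≠ 0 := by
    intro h0
    rw [h0, mul_zero] at hbb
    exact hb (dotProduct_self_eq_zero.1 hbb)
  -- Applying the change of the 𝔪-block to b' gives (α·b')b' − |b'|²α, and α·b' is the change of τ.
  have hα : α = (y ^ 2 / (lin r (Ad r l (tElt r a c)).1 ⬝ᵥ lin r (Ad r l (tElt r a c)).1)) •
      ((tau r (Ad r l (tElt r a c)).1 - tau r (Ad r k (tElt r a c)).1) • b' -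
        ((Ad r k (tElt r a c)).1.toBlocks₁₁ - Wᵀ * (Ad r l (tElt r a c)).1.toBlocks₁₁ * W) *ᵥ b') := by
    have e : Wᵀ * (Ad r l (tElt r a c)).1.toBlocks₁₁ * W =
        (Ad r k (tElt r a c)).1.toBlocks₁₁ - vecMulVec b' α + vecMulVec α b' := by
      rw [m3]
      simp only [Matrix.mul_assoc, hO1, Matrix.mul_one]
      rw [← Matrix.mul_assoc, hO1, Matrix.one_mul]
    have hu : y ^ 2 / (lin r (Ad r l (tElt r a c)).1 ⬝ᵥ lin r (Ad r l (tElt r a c)).1) = (b' ⬝ᵥ b')⁻¹ := by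
      rw [hbb]; field_simp
    have e2 : ((Ad r k (tElt r a c)).1.toBlocks₁₁ - ((Ad r k (tElt r a c)).1.toBlocks₁₁ - vecMulVec b' α +
        vecMulVec α b')) *ᵥ b' = (α ⬝ᵥ b') • b' - (b' ⬝ᵥ b') • α := by
      simp only [sub_mulVec, add_mulVec, vecMulVec_mulVec, op_smul_eq_smul]
      abel
    rw [e, e2, hu, m2, add_sub_cancel_left, sub_sub_cancel, smul_smul, inv_mul_cancel₀ hb0, one_smul]
  rw [← hα, ← hWα, ← map_mul, inv_mul_cancel_right]

theorem isCompact_orthogonal (n : Type*) [Fintype n] [DecidableEq n] :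
    IsCompact {K : Matrix n n ℝ | Kᵀ * K = 1} := by
  have h1 : IsCompact {K : Matrix n n ℝ | ∀ i j, K i j ∈ Set.Icc (-1 : ℝ) 1} := by
    have := isCompact_univ_pi (X := fun _ : n => n → ℝ)
      (s := fun _ => Set.univ.pi fun _ => Set.Icc (-1 : ℝ) 1) fun _ => isCompact_univ_pi fun _ => isCompact_Icc
    have e : {K : n → n → ℝ | ∀ i j, K i j ∈ Set.Icc (-1 : ℝ) 1} =
        Set.univ.pi fun _ => Set.univ.pi fun _ => Set.Icc (-1 : ℝ) 1 := by
      ext K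
      simp only [Set.mem_ofPred_eq, Set.mem_univ_pi]
    exact e ▸ this
  refine h1.of_isClosed_subset ?_ fun K hK i j => ?_
  · exact isClosed_eq (by fun_prop) continuous_const
  · have := entry_norm_bound_of_unitary (U := K) ((mem_orthogonalGroup_iff' _ _).2 hK) i j
    exact abs_le.1 this

/-- The open condition on the time entry is equivalent to the closed condition that it be at least
1, since its square is at least 1. -/
theorem isClosed_setOf_isLor : IsClosed {A : Matrix (Idx r) (Idx r) ℝ | IsLor r A} := by
  have : {A : Matrix (Idx r) (Idx r) ℝ | IsLor r A} =
      {A | Aᵀ * J r * A = J r} ∩ {A | A.det = 1} ∩ {A | 1 ≤ A (Sum.inr 1) (Sum.inr 1)} := by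
    ext A
    constructor
    · intro h
      refine ⟨⟨h.adj, h.det⟩, ?_⟩
      have := one_le_sq_apply r A h.adj
      have := h.pos
      change 1 ≤ A (Sum.inr 1) (Sum.inr 1)
      nlinarith
    · rintro ⟨⟨h1, h2⟩, h3⟩
      exact ⟨h1, h2, lt_of_lt_of_le one_pos h3⟩
  rw [this]
  refine (IsClosed.inter ?_ ?_).inter ?_
  · exact isClosed_eq (by fun_prop) continuous_const
  · exact isClosed_eq (by fun_prop) continuous_const
  · exact isClosed_le continuous_const (by fun_prop)

/-- The functional `X ↦ tr (Q X) / 2`. -/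
noncomputable def traceFunctional (r : ℕ) : Matrix (Idx r) (Idx r) ℝ →ₗ[ℝ] 𝔤Dual r where
  toFun Q :=
    { toFun := fun X => (1 / 2) * (Q * X.1).trace
      map_add' := fun X Y => by simp [Matrix.mul_add, mul_add]
      map_smul' := fun t X => by simp; ring
      cont := by fun_prop }
  map_add' Q Q' := by ext X; simp [Matrix.add_mul, mul_add]
  map_smul' t Q := by ext X; simp; ring

theorem smul_iota_eq_traceFunctional (k : G r) (Z : 𝔤 r) :
    k • iota r Z = traceFunctional r (ρ r k * Z.1 * (J r * (ρ r k)ᵀ * J r)) := by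
  have h : ρ r k⁻¹ = J r * (ρ r k)ᵀ * J r := by
    rw [Matrix.mul_assoc, ρ_transpose_mul_J, ← Matrix.mul_assoc, J_mul_J, Matrix.one_mul]
  rw [smul_iota, ← h]
  rfl

theorem isWeaklyProper (a : Fin (r + 1) → ℝ) (c : ℝ) : IsWeaklyProper r (semisimpleElt r a c) := by
  intro Ω hΩ hsub
  set f := semisimpleElt r a c with hf
  have hres (k : G r) : res r (k • f) = pr r (Ad r k (tElt r a c)) := res_smul_iota r k _
  -- δ bounds the nonzero values of a_i² + c² from below; the default 1 keeps it positive if all of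
  -- them vanish.
  obtain ⟨i₀, hi₀⟩ := Finite.exists_min fun i => if a i ^ 2 + c ^ 2 = 0 then 1 else a i ^ 2 + c ^ 2
  set δ := if a i₀ ^ 2 + c ^ 2 = 0 then 1 else a i₀ ^ 2 + c ^ 2 with hδdef
  have hδ0 : 0 < δ := by
    rw [hδdef]
    split_ifs with h
    · exact one_pos
    · exact lt_of_le_of_ne (by positivity) (Ne.symm h)
  have hδ (i) (hi : a i ^ 2 + c ^ 2 ≠ 0) : δ ≤ a i ^ 2 + c ^ 2 := by
    have := hi₀ i
    simp only [if_neg hi] at this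
    exact this
  set M := 1 + ∑ i, (a i ^ 2 + c ^ 2) with hMdef
  have hM0 : 0 < M := by
    have : 0 ≤ ∑ i, (a i ^ 2 + c ^ 2) := Finset.sum_nonneg fun i _ => by positivity
    linarith
  have hM (i) : a i ^ 2 + c ^ 2 ≤ M := by
    have := Finset.single_le_sum (f := fun i => a i ^ 2 + c ^ 2) (fun i _ => by positivity) (Finset.mem_univ i)
    linarith
  have hcont : Continuous fun ψ : 𝔭Dual r => dualLin ψ ⬝ᵥ dualLin ψ :=
    continuous_dualLin.dotProduct continuous_dualLin
  obtain ⟨C, hC⟩ := hΩ.exists_bound_of_continuousOn hcont.continuousOn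
  have hdepth (k : G r) (hk : res r (k • f) ∈ Ω) : lin r (Ad r k (tElt r a c)).1 ≠ 0 := by
    have h1 := not_mem_𝔩Dual_of_isRegularElt (hsub hk).2.1
    rwa [hres, pr_mem_𝔩Dual] at h1
  -- Regularity excludes b = 0 on Ω, so compactness gives a positive lower bound for |b|².
  obtain ⟨ε, hε0, hε⟩ := hΩ.exists_forall_le' (a := 0) hcont.continuousOn (by
    intro ψ hψ
    obtain ⟨⟨_, k, rfl⟩, rfl⟩ := (hsub hψ).1
    change res r (k • f) ∈ Ω at hψ
    change 0 < dualLin (res r (k • f)) ⬝ᵥ dualLin (res r (k • f))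
    rw [hres, dualLin_pr]
    exact lt_of_le_of_ne (dotProduct_self_nonneg' _) fun h => hdepth k hψ (dotProduct_self_eq_zero.1 h.symm))
  -- The bounds come from δy² ≤ |b|² ≤ My² with ε ≤ |b|² ≤ C, for the logarithm of y⁻¹ and for
  -- y²/|b|².
  set S : Set (𝔭Dual r × Matrix (Idx r) (Idx r) ℝ × Matrix (Coord r) (Coord r) ℝ × ℝ × ℝ) :=
    Ω ×ˢ {K | Kᵀ * K = 1} ×ˢ {W | Wᵀ * W = 1} ×ˢ
      Set.Icc (-Real.log (C / δ) / 2) (-Real.log (ε / M) / 2) ×ˢ Set.Icc 0 (1 / δ) with hS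
  have hScomp : IsCompact S := hΩ.prod ((isCompact_orthogonal _).prod
    ((isCompact_orthogonal _).prod (isCompact_Icc.prod isCompact_Icc)))
  set F : 𝔭Dual r × Matrix (Idx r) (Idx r) ℝ × Matrix (Coord r) (Coord r) ℝ × ℝ × ℝ → Matrix (Idx r) (Idx r) ℝ :=
    fun p => paramMat (tMat r a c) (dualBlock p.1) (dualTau p.1) p.2.1 p.2.2.1 p.2.2.2.1 p.2.2.2.2 with hF
  have hFcont : Continuous F := by
    refine continuous_paramMat _ (continuous_dualBlock.comp continuous_fst) (continuous_dualTau.comp continuous_fst)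
      ?_ ?_ ?_ ?_ <;> fun_prop
  set L : Set (Matrix (Idx r) (Idx r) ℝ) := F '' S ∩ {A | IsLor r A} with hL
  have hLcomp : IsCompact L := (hScomp.image hFcont).inter_right isClosed_setOf_isLor
  -- Replacing the inverse by JAᵗJ makes Φ a continuous map on all matrices.
  set Φ : Matrix (Idx r) (Idx r) ℝ → 𝔤Dual r :=
    fun A => traceFunctional r (A * tMat r a c * (J r * Aᵀ * J r)) with hΦ
  have hΦcont : Continuous Φ := (traceFunctional r).continuous_of_finiteDimensional.comp (by fun_prop)
  have hΦρ (k : G r) : Φ (ρ r k) = k • f := (smul_iota_eq_traceFunctional k (tElt r a c)).symm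
  have himage : ((↑) : orb r f → 𝔤Dual r) '' (q r f ⁻¹' Ω) = Φ '' L ∩ res r ⁻¹' Ω := by
    ext φ
    constructor
    · rintro ⟨⟨_, k, rfl⟩, hk, rfl⟩
      change res r (k • f) ∈ Ω at hk
      change k • f ∈ _
      -- The given k may be arbitrarily large in the centralizer direction; the adapted
      -- representative of the same point has bounded parameters.
      obtain ⟨l, hl, hl0, hl1⟩ := exists_adapted (a := a) (c := c) k (hdepth k hk)
      change l • f = k • f at hl
      rw [← hl] at hk ⊢
      have hb := hdepth l hk
      refine ⟨⟨ρ r l, ⟨?_, isLor_ρ r l⟩, hΦρ l⟩, hk⟩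
      obtain ⟨K, W, hK, hW, hKW⟩ := exists_paramMat (l := l) hb rfl
      have hnull : bil r (ρ r l⁻¹ *ᵥ v₀ r) (ρ r l⁻¹ *ᵥ v₀ r) = 0 := by rw [bil_ρ, bil_v₀_v₀]
      have hpos : 0 < (ρ r l⁻¹ *ᵥ v₀ r) (Sum.inr 1) := v₀_future _
      obtain ⟨b1, b2⟩ := sq_bounds hnull hl0 hl1 hδ hM
      rw [← lin_sq] at b1 b2
      have b3 := hε _ hk
      have b4 := (le_abs_self _).trans (hC _ hk)
      rw [hres, dualLin_pr] at b3 b4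
      set b := lin r (Ad r l (tElt r a c)).1
      set y := (ρ r l⁻¹ *ᵥ v₀ r) (Sum.inr 1)
      have hbb : 0 < b ⬝ᵥ b := hε0.trans_le b3
      have hlog : Real.log y⁻¹ = -Real.log (y ^ 2) / 2 := by
        rw [Real.log_inv, Real.log_pow]; push_cast; ring
      have hy2 : 0 < y ^ 2 := by positivity
      have i1 : -Real.log (C / δ) / 2 ≤ Real.log y⁻¹ := by
        have := Real.log_le_log hy2 (show y ^ 2 ≤ C / δ by rw [le_div_iff₀ hδ0]; linarith)
        rw [hlog]; linarith
      have i2 : Real.log y⁻¹ ≤ -Real.log (ε / M) / 2 := by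
        have := Real.log_le_log (by positivity) (show ε / M ≤ y ^ 2 by rw [div_le_iff₀ hM0]; linarith)
        rw [hlog]; linarith
      have i3 : 0 ≤ y ^ 2 / (b ⬝ᵥ b) := by positivity
      have i4 : y ^ 2 / (b ⬝ᵥ b) ≤ 1 / δ := by
        rw [div_le_div_iff₀ hbb hδ0]; linarith
      refine ⟨(res r (l • f), K, W, Real.log y⁻¹, y ^ 2 / (b ⬝ᵥ b)), Set.mk_mem_prod hk (Set.mk_mem_prod hK
        (Set.mk_mem_prod hW (Set.mk_mem_prod ⟨i1, i2⟩ ⟨i3, i4⟩))), ?_⟩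
      change paramMat (tMat r a c) (dualBlock (res r (l • f))) (dualTau (res r (l • f))) K W (Real.log y⁻¹)
        (y ^ 2 / (b ⬝ᵥ b)) = ρ r l
      rw [hres, dualBlock_pr, dualTau_pr, hKW]
    · rintro ⟨⟨A, ⟨-, hA⟩, rfl⟩, hφ⟩
      obtain ⟨k, rfl⟩ := exists_lift r A hA
      rw [hΦρ] at hφ ⊢
      exact ⟨⟨_, k, rfl⟩, hφ, rfl⟩
  rw [Subtype.isCompact_iff, himage]
  exact (hLcomp.image hΦcont).inter_right (hΩ.isClosed.preimage continuous_res)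

end

end SpinOrbit

open SpinOrbit
theorem propositionP (r : ℕ) (a : Fin (r + 1) → ℝ) (c : ℝ)
    (ha : ∀ i : Fin r, |a i.succ| ≤ a i.castSucc) (hc : 0 ≤ c) :
    let f : 𝔤Dual r := semisimpleElt r a c
    let D : Set (𝔭Dual r) := MulAction.orbit (P r) (res r f)
    let D' : Set (𝔭Dual r) := MulAction.orbit (P r) (res r (gInf r • f))
    (IsDepthZero r D ∧ IsDepthZero r D' ∧ (D = D' ↔ a (Fin.last r) = 0 ∧ c = 0)) ∧
    (f ≠ 0 → Set.range (q r f) = D ∪ D' ∪ ⋃₀ {O | IsDepthOne r O ∧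
      ∃ x : Fin r → ℝ, HasSingularValues r O x ∧
        (∀ i : Fin r, x i ≤ a i.castSucc ∧ |a i.succ| ≤ x i) ∧
        (a (Fin.last r) = 0 → c = 0 → ∀ i : Fin r, a i.succ = 0 → x i = 0)}) ∧
    (f = 0 → Set.range (q r f) = {0}) ∧
    (∀ g : G r, g • f ∉ MulAction.orbit (P r) f ∪ MulAction.orbit (P r) (gInf r • f) →
      Nonempty (Unique (ReducedSpace r f (res r (g • f))))) ∧
    IsWeaklyProper r f ∧
    (IsProperMap (q r f) ↔ f = 0) := by
  intro f D D'
  refine ⟨⟨isDepthZero_orbit, isDepthZero_orbit_gInf, orbit_eq_orbit_gInf_iff ha⟩, range_q ha, fun hf => ?_,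
    reducedSpace_unique, isWeaklyProper a c, fun h => ?_, fun hf => ?_⟩
  · rw [hf]; exact range_q_zero
  · by_contra hf; exact not_isProperMap_q hf h
  · rw [hf]; exact isProperMap_q_zero
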